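/- Let $M$ be a smooth 3-manifold with (possibly empty) boundary (Hausdorff, second countable), and let $(B,\nu,\mu)$ be a flux system on $M$: $B$ is a smooth vector field, $\nu$ a smooth closed 1-form and $\mu$ a smooth volume form on $M$ with $\nu(B)=0$ and $\mathcal L_B\mu=0$. A *regular closed leaf* of $\nu$ is a compact connected (boundaryless, embedded) surface $S\subset\operatorname{int}M$ such that $\nu|_p\neq 0$ and $T_pS=\ker\nu|_p$ for all $p\in S$. An *axis* of $(B,\nu,\mu)$ is a 1-dimensional periodic orbit $\gamma\subset\operatorname{int}M$ of $B$ along which $\nu$ vanishes and which has a neighbourhood $U$ such that every point of $U\setminus\gamma$ lies on a regular closed leaf of $\nu$. The axis $\gamma$ is *non-degenerate* if on some neighbourhood of $\gamma$ one has $\nu=d\psi$ for a smooth function $\psi$ having $\gamma$ as a Morse–Bott critical manifold (for every $p\in\gamma$, the kernel of the Hessian of $\psi$ at $p$ is $T_p\gamma$). Let $\gamma$ be a non-degenerate axis of the flux system $(B,\nu,\mu)$ and put $\beta:=\iota_B\mu$. Then there exist a tubular neighbourhood $\mathcal U$ of $\gamma$, a diffeomorphism $\Phi=(x,y,\varphi):\mathcal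 U\to D^2\times\mathbb T$, where $D^2\subset\mathbb R^2$ is the open unit disk, $\mathbb T=\mathbb R/2\pi\mathbb Z$ and $\Phi(\gamma)=\{0\}\times\mathbb T$, a smooth function $f:\mathcal U\to(0,\infty)$, and smooth functions $F,G,\rho:[0,1/2)\to\mathbb R$ with $\rho>0$, such that in $\mathcal U$, with $s=\tfrac12(x^2+y^2)$, $$\beta=F(s)\,dx\wedge dy+dG(s)\wedge d\varphi,$$ $$B/f=\frac{G'(s)}{\rho(s)}\,(y\,\partial_x-x\,\partial_y)+\frac{F(s)}{\rho(s)}\,\partial_\varphi,$$ $$f\mu=\rho(s)\,dx\wedge dy\wedge d\varphi .$$ -/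

import Mathlib

open Set Topology Manifold ContDiff

noncomputable section

namespace FluxSystem

/-! ### Differential forms on a smooth 3-manifold with (possibly empty) boundary

Manifolds with boundary are modelled on the half-space `EuclideanHalfSpace 3`, with model with
corners `𝓡∂ 3`. -/

section Forms

variable {M : Type*} [TopologicalSpace M] [ChartedSpace (EuclideanHalfSpace 3) M]

variable (M) in
/-- Not necessarily smooth vector fields on `M`. -/
abbrev VField : Type _ := (p : M) → TangentSpace (𝓡∂ 3) p

variable (M) in
/-- Not necessarily smooth differential `k`-forms on `M`. -/
abbrev Form (k : ℕ) : Type _ := (p : M) → TangentSpace (𝓡∂ 3) p [⋀^Fin k]→L[ℝ] ℝ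

/-- A vector field is smooth if it is smooth as a section of the tangent bundle. -/
def SmoothField [IsManifold (𝓡∂ 3) ∞ M] (X : VField M) : Prop :=
  ContMDiff (𝓡∂ 3) (𝓡∂ 3).tangent ∞ (fun p => (⟨p, X p⟩ : TangentBundle (𝓡∂ 3) M))

/-- The pullback `g^*α` of a form by a map `g : V → M`, with the derivative of `g` taken within
the set `t`. -/
def pullbackWithin {V : Type*} [NormedAddCommGroup V] [NormedSpace ℝ V] {k : ℕ}
    (g : V → M) (t : Set V) (α : Form M k) (y : V) : V [⋀^Fin k]→L[ℝ] ℝ :=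
  (α (g y)).compContinuousLinearMap (mfderivWithin 𝓘(ℝ, V) (𝓡∂ 3) g t y)

/-- The pullback `g^*α` of a form by a map `g : V → M`. -/
def pullback {V : Type*} [NormedAddCommGroup V] [NormedSpace ℝ V] {k : ℕ}
    (g : V → M) (α : Form M k) : V → V [⋀^Fin k]→L[ℝ] ℝ :=
  pullbackWithin g univ α

/-- The expression of a form in the chart around `x₀`. -/
def chartRep {k : ℕ} (α : Form M k) (x₀ : M) :
    EuclideanSpace ℝ (Fin 3) → EuclideanSpace ℝ (Fin 3) [⋀^Fin k]→L[ℝ] ℝ :=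
  pullbackWithin (extChartAt (𝓡∂ 3) x₀).symm (range (𝓡∂ 3)) α

/-- A form is smooth if its expression in every chart is. -/
def SmoothForm {k : ℕ} (α : Form M k) : Prop :=
  ∀ x₀ : M, ContDiffOn ℝ ∞ (chartRep α x₀) (extChartAt (𝓡∂ 3) x₀).target

/-- The exterior derivative `dα`, computed at `p` in the chart around `p`. -/
def extD {k : ℕ} (α : Form M k) : Form M (k + 1) := fun p =>
  (extDerivWithin (chartRep α p) (range (𝓡∂ 3))
    (extChartAt (𝓡∂ 3) p p)).compContinuousLinearMap
      (mfderiv (𝓡∂ 3) 𝓘(ℝ, EuclideanSpace ℝ (Fin 3)) (extChartAt (𝓡∂ 3) p) p)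

/-- The interior product `ι_X α = α(X, ·, …, ·)`. -/
def iota {k : ℕ} (X : VField M) (α : Form M (k + 1)) : Form M k := fun p =>
  ContinuousAlternatingMap.curryLeft (E := EuclideanSpace ℝ (Fin 3)) (α p) (X p)

/-- The Lie derivative of a form, `L_X α = d ι_X α + ι_X dα`. -/
def lieD {k : ℕ} (X : VField M) (α : Form M (k + 1)) : Form M (k + 1) := fun p =>
  extD (iota X α) p + iota X (extD α) p

/-- `(B, ν, μ)` is a flux system on `M`: `B` is a smooth vector field, `ν` is a smooth closed
1-form, `μ` is a smooth volume form (nowhere zero 3-form), `ν(B) = 0` and `L_B μ = 0`. -/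
structure IsFluxSystem [IsManifold (𝓡∂ 3) ∞ M] (B : VField M) (ν : Form M 1) (μ : Form M 3) : Prop where
  smooth_B : SmoothField B
  smooth_nu : SmoothForm ν
  smooth_mu : SmoothForm μ
  volume : ∀ p, μ p ≠ 0
  closed : ∀ p, extD ν p = 0
  nu_B : ∀ p, ν p (fun _ => B p) = 0
  div_free : ∀ p, lieD B μ p = 0

/-! ### Regular closed leaves and axes

All of these are notions for the restriction of the flux system to the interior of `M`. -/

/-- `S` is a (boundaryless, embedded) integral surface of the distribution `ker ν` on the
set `{ν ≠ 0}`: around each of its points there is a local diffeomorphism `e` onto an open subset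
of `ℝ³` which straightens `S` to `{e₂ = 0}`, and the tangent space
`T_q S = {v | (d e_q v)₂ = 0}` at points `q` of `S` is `ker ν_q` (in particular `ν_q ≠ 0`). -/
def IsIntegralSurface (ν : Form M 1) (S : Set M) : Prop :=
  ∀ p ∈ S, ∃ e : OpenPartialHomeomorph M (EuclideanSpace ℝ (Fin 3)),
    p ∈ e.source ∧
    ContMDiffOn (𝓡∂ 3) 𝓘(ℝ, EuclideanSpace ℝ (Fin 3)) ∞ e e.source ∧
    ContMDiffOn 𝓘(ℝ, EuclideanSpace ℝ (Fin 3)) (𝓡∂ 3) ∞ e.symm e.target ∧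
    (∀ q ∈ e.source, q ∈ S ↔ e q 2 = 0) ∧
    ∀ q ∈ e.source, q ∈ S → ∀ v : TangentSpace (𝓡∂ 3) q,
      ν q (fun _ => v) = 0 ↔
        (show EuclideanSpace ℝ (Fin 3) from
          mfderiv (𝓡∂ 3) 𝓘(ℝ, EuclideanSpace ℝ (Fin 3)) e q v) 2 = 0

/-- A regular closed leaf of `ν` in the interior of `M`: a closed (compact, without boundary)
leaf of the foliation of `{ν ≠ 0}` defined by `ker ν`, that is, a compact connected integral
surface. (A compact connected integral manifold is automatically a maximal one.) -/
structure IsRegularClosedLeaf (ν : Form M 1) (S : Set M) : Prop where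
  compact : IsCompact S
  connected : IsConnected S
  subset_interior : S ⊆ (𝓡∂ 3).interior M
  integral : IsIntegralSurface ν S

/-- The pre-closed region of `ν`: the union of its regular closed leaves. -/
def preClosedRegion (ν : Form M 1) : Set M :=
  {p | ∃ S, IsRegularClosedLeaf ν S ∧ p ∈ S}

/-- `γ` is an axis: a 1-dimensional periodic orbit of `B` which is also a degenerate closed leaf
of `ν`, i.e. it lies in the interior of `M`, `ν` vanishes along it, and it has a neighbourhood `U`
such that `U \ γ` is contained in the pre-closed region. (A 1-dimensional periodic orbit is
a compact connected embedded submanifold of codimension 2.) -/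
structure IsAxis (B : VField M) (ν : Form M 1) (γ : Set M) : Prop where
  periodic_orbit : ∃ (c : ℝ → M) (T : ℝ), 0 < T ∧ IsMIntegralCurve (I := 𝓡∂ 3) c B ∧
    Function.Periodic c T ∧ γ = range c
  one_dimensional : ∀ p ∈ γ, B p ≠ 0
  subset_interior : γ ⊆ (𝓡∂ 3).interior M
  critical : ∀ p ∈ γ, ν p = 0
  nearby_leaves : ∃ U : Set M, IsOpen U ∧ γ ⊆ U ∧ U \ γ ⊆ preClosedRegion ν

/-- The Hessian of `ψ` at an interior critical point `p`, computed in the chart around `p`. -/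
def hessianAt (ψ : M → ℝ) (p : M) (v w : TangentSpace (𝓡∂ 3) p) : ℝ :=
  fderiv ℝ (fderiv ℝ (ψ ∘ (extChartAt (𝓡∂ 3) p).symm)) (extChartAt (𝓡∂ 3) p p)
    (mfderiv (𝓡∂ 3) 𝓘(ℝ, EuclideanSpace ℝ (Fin 3)) (extChartAt (𝓡∂ 3) p) p v)
    (mfderiv (𝓡∂ 3) 𝓘(ℝ, EuclideanSpace ℝ (Fin 3)) (extChartAt (𝓡∂ 3) p) p w)

/-- `γ` is a non-degenerate axis: on a neighbourhood of `γ`, `ν = dψ` for a smooth `ψ` which has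
`γ` as a Morse-Bott critical manifold: the kernel of the Hessian of `ψ` at each `p ∈ γ` is the
tangent space `T_p γ`, which is spanned by `B p`. -/
def IsNondegenerateAxis (B : VField M) (ν : Form M 1) (γ : Set M) : Prop :=
  IsAxis B ν γ ∧ ∃ (U : Set M) (ψ : M → ℝ), IsOpen U ∧ γ ⊆ U ∧
    ContMDiffOn (𝓡∂ 3) 𝓘(ℝ, ℝ) ∞ ψ U ∧
    (∀ p ∈ U, ∀ v : TangentSpace (𝓡∂ 3) p,
      mfderiv (𝓡∂ 3) 𝓘(ℝ, ℝ) ψ p v = ν p (fun _ => v)) ∧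
    ∀ p ∈ γ, ∀ v : TangentSpace (𝓡∂ 3) p,
      (∀ w, hessianAt ψ p v w = 0) ↔ v ∈ Submodule.span ℝ {B p}

/-! ### Tubular coordinates `(x, y, φ)` -/

/-- `Φ = (x, y, φ)` is a diffeomorphism from an open neighbourhood `U = Φ.source` of `γ` onto
`D² × 𝕋`, with `D²` the open unit disk and `𝕋` the unit circle, under which `γ` corresponds to
`{0} × 𝕋`; so `U` is a tubular neighbourhood of `γ`. -/
structure IsTubularDiffeo (γ : Set M)
    (Φ : OpenPartialHomeomorph M (EuclideanSpace ℝ (Fin 2) × Circle)) : Prop where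
  subset_source : γ ⊆ Φ.source
  target_eq : Φ.target = Metric.ball 0 1 ×ˢ univ
  smooth : ContMDiffOn (𝓡∂ 3) ((𝓡 2).prod (𝓡 1)) ∞ Φ Φ.source
  smooth_symm : ContMDiffOn ((𝓡 2).prod (𝓡 1)) (𝓡∂ 3) ∞ Φ.symm Φ.target
  axis : ∀ p ∈ Φ.source, p ∈ γ ↔ (Φ p).1 = 0

/-- `(x, y, φ) ↦ Φ⁻¹(x, y, e^{iφ})`. Its local inverses are the local coordinate systems
`(x, y, φ)` on `Φ.source`, where `φ` is determined up to multiples of `2π`. -/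
def coordParam (Φ : OpenPartialHomeomorph M (EuclideanSpace ℝ (Fin 2) × Circle)) :
    EuclideanSpace ℝ (Fin 2) × ℝ → M :=
  fun q => Φ.symm (q.1, Circle.exp q.2)

end Forms

section Coordinates

/-- The wedge product `α₀ ∧ ⋯ ∧ α_{k-1}` of covectors, i.e. `(v_j) ↦ det (α_i v_j)`. -/
def wedge {V : Type*} [NormedAddCommGroup V] [NormedSpace ℝ V] {k : ℕ}
    (α : Fin k → (V →L[ℝ] ℝ)) : V [⋀^Fin k]→L[ℝ] ℝ :=
  ContinuousMultilinearMap.alternatization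
    ((ContinuousMultilinearMap.mkPiAlgebra ℝ (Fin k) ℝ).compContinuousLinearMap α)

/-- The space `ℝ² × ℝ` with coordinates `(x, y, φ)`. -/
abbrev Cyl : Type := EuclideanSpace ℝ (Fin 2) × ℝ

/-- `dx`. -/
def dx : Cyl →L[ℝ] ℝ := (EuclideanSpace.proj 0).comp (ContinuousLinearMap.fst ℝ _ ℝ)

/-- `dy`. -/
def dy : Cyl →L[ℝ] ℝ := (EuclideanSpace.proj 1).comp (ContinuousLinearMap.fst ℝ _ ℝ)

/-- `dφ`. -/
def dphi : Cyl →L[ℝ] ℝ := ContinuousLinearMap.snd ℝ _ ℝ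

/-- `∂_x`. -/
def ex : Cyl := (EuclideanSpace.single 0 1, 0)

/-- `∂_y`. -/
def ey : Cyl := (EuclideanSpace.single 1 1, 0)

/-- `∂_φ`. -/
def ephi : Cyl := (0, 1)

/-- `s = (x² + y²) / 2`. -/
def sFun (q : Cyl) : ℝ := ((q.1 0) ^ 2 + (q.1 1) ^ 2) / 2

end Coordinates

end FluxSystem

end

open FluxSystem

/-!
The forms `ν` and `β = ι_B μ` are closed and both kill `B`. Near the axis this leaves a two
dimensional problem: the potential `ψ` of `ν` provides invariant tori, and `β` is straightened on
each of them by averaging, as for an integrable system with one action variable.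

**Tubular coordinates.** The Hessian of `ψ` identifies the normal bundle of `γ` with its conormal
bundle. So there is a finite family of functions vanishing on `γ` whose derivatives span the
conormal space at every point of `γ` (`exists_conormal_family`). A generic combination of them has
nonzero derivative all along `γ`: failure at a given point is two conditions on the parameters, and
`γ` is one-dimensional (`exists_forall_dfun_ne_zero`). The area form `ι_B μ` on the
normal bundle gives the conormal bundle an orientation, the combinations which complete the first
derivative to an oriented frame form a convex set at each point, and a partition of unity yields
the second coordinate (`exists_conormal_frame`). Together with the angle along the orbit
(`exists_angle`), this gives `IsNondegenerateAxis.exists_isTubularDiffeo`.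

**The potential.** The leaves of `ν` are locally level sets of `ψ`. If the Hessian of `ψ` were
indefinite on the normal bundle, a curve in the level set of `γ` would start on `γ` and leave it
(`exists_null_curve`). It would run into a leaf, which is compact and so contains the limit on `γ`,
where `ν` vanishes: a contradiction (`IsIntegralSurface.notMem_of_level_curve`). Hence the Hessian
is definite, and the Morse–Bott lemma in the form of `IsNondegenerateAxis.exists_morse_coords`
gives `ψ = c₀ + κ s` with `s = (x² + y²) / 2` and `κ ≠ 0`. A reflection arranges that `μ` is
positive (`exists_oriented_morse_coords`).

**The flux form.** From `β ∧ ds = 0` it follows that `β = F dx ∧ dy + b ds ∧ dφ` with functions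
`F` and `b` of `(x, y, φ)`, and `dβ = 0` reads `∂_φ F = ∂_θ b`, where `∂_θ = x ∂_y - y ∂_x`
(`IsTubularDiffeo.exists_flux_components`). Let `F_a` and `b_a` be the averages of `F` and `b` over
the tori. They are functions of `s`, since an even smooth function is a smooth function of the
square (`exists_eq_comp_sFun`), and averaging also produces a function `w` with
`∂_θ w = F - F_a` and `∂_φ w = b - b_a` (`exists_torus_linearization`). On the axis `F ≠ 0`, because
`B ≠ 0`; so `F_a ≠ 0` nearby, and rotating the disks by the angle `u = w / F_a` turns `β` into
`F_a dx ∧ dy + b_a ds ∧ dφ` (`rot_form_eq`, `IsTubularDiffeo.exists_normal_form`).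

**Conclusion.** One may take `ρ = 1`: let `f` be the inverse of the density of `μ` with respect to
`dx ∧ dy ∧ dφ`, and `G` an antiderivative of `b_a`. The formula for `B / f` is then the only vector
field `X` with `ι_X (f μ) = β` (`IsTubularDiffeo.conclusion`).
-/

noncomputable section

namespace FluxSystem

open MeasureTheory intervalIntegral

/-! ### Integrals depending on a parameter -/

/-- Differentiation under the integral sign, for a compact interval of integration. -/
theorem hasFDerivAt_parametric_integral {E F : Type*} [NormedAddCommGroup E] [NormedSpace ℝ E]
    [ProperSpace E] [NormedAddCommGroup F] [NormedSpace ℝ F] [CompleteSpace F]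
    {U : Set E} (hU : IsOpen U) {f : E × ℝ → F} (hf : ContDiffOn ℝ 1 f (U ×ˢ univ)) (a b : ℝ)
    {x : E} (hx : x ∈ U) :
    HasFDerivAt (fun x => ∫ t in a..b, f (x, t))
      (∫ t in a..b, (fderiv ℝ f (x, t)).comp (ContinuousLinearMap.inl ℝ E ℝ)) x := by
  have hO : IsOpen (U ×ˢ (univ : Set ℝ)) := hU.prod isOpen_univ
  have hcf : ContinuousOn f (U ×ˢ univ) := hf.continuousOn
  have hcf' : ContinuousOn (fun p => (fderiv ℝ f p).comp (ContinuousLinearMap.inl ℝ E ℝ))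
      (U ×ˢ univ) :=
    (hf.continuousOn_fderiv_of_isOpen hO le_rfl).clm_comp continuousOn_const
  obtain ⟨r, hr, hrU⟩ := Metric.nhds_basis_closedBall.mem_iff.1 (hU.mem_nhds hx)
  obtain ⟨C, hC⟩ := ((isCompact_closedBall x r).prod (isCompact_uIcc (a := a) (b := b))
    ).exists_bound_of_continuousOn (hcf'.mono (prod_mono hrU (subset_univ _)))
  refine intervalIntegral.hasFDerivAt_integral_of_dominated_of_fderiv_le
    (F' := fun y t => (fderiv ℝ f (y, t)).comp (ContinuousLinearMap.inl ℝ E ℝ))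
    (bound := fun _ => C) (s := Metric.closedBall x r) (Metric.closedBall_mem_nhds x hr) ?_ ?_ ?_ ?_ ?_ ?_
  · filter_upwards [hU.mem_nhds hx] with y hy
    exact (hcf.comp_continuous (by fun_prop) fun t => ⟨hy, mem_univ _⟩).aestronglyMeasurable
  · exact (hcf.comp_continuous (by fun_prop) fun t => ⟨hx, mem_univ _⟩).intervalIntegrable _ _
  · exact (hcf'.comp_continuous (f := fun t : ℝ => (x, t)) (by fun_prop)
      fun t => ⟨hx, mem_univ _⟩).aestronglyMeasurable
  · exact .of_forall fun t ht y hy => hC (y, t) ⟨hy, uIoc_subset_uIcc ht⟩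
  · exact intervalIntegrable_const
  · refine .of_forall fun t _ y hy => ?_
    have h1 : HasFDerivAt f (fderiv ℝ f (y, t)) (y, t) :=
      ((hf.contDiffAt (hO.mem_nhds ⟨hrU hy, mem_univ _⟩)).differentiableAt one_ne_zero).hasFDerivAt
    exact h1.comp y (hasFDerivAt_prodMk_left y t)

universe u

theorem contDiffOn_parametric_integral_nat {E : Type u} [NormedAddCommGroup E] [NormedSpace ℝ E]
    [ProperSpace E] {U : Set E} (hU : IsOpen U) (a b : ℝ) (n : ℕ) :
    ∀ {F : Type u} [NormedAddCommGroup F] [NormedSpace ℝ F] [CompleteSpace F] {f : E × ℝ → F},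
      ContDiffOn ℝ ∞ f (U ×ˢ univ) → ContDiffOn ℝ n (fun x => ∫ t in a..b, f (x, t)) U := by
  have hO : IsOpen (U ×ˢ (univ : Set ℝ)) := hU.prod isOpen_univ
  induction n with
  | zero =>
    intro F _ _ _ f hf
    refine contDiffOn_zero.2 fun x hx => ?_
    exact (hasFDerivAt_parametric_integral hU (hf.of_le (by exact_mod_cast le_top)) a b
      hx).continuousAt.continuousWithinAt
  | succ n ih =>
    intro F _ _ _ f hf
    have hd := fun x hx => hasFDerivAt_parametric_integral hU
      (hf.of_le (by exact_mod_cast le_top)) a b (x := x) hx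
    have : ((n + 1 : ℕ) : WithTop ℕ∞) = (n : WithTop ℕ∞) + 1 := by push_cast; rfl
    rw [this, contDiffOn_succ_iff_fderiv_of_isOpen hU]
    refine ⟨fun x hx => (hd x hx).differentiableAt.differentiableWithinAt, by simp, ?_⟩
    have h2 : ContDiffOn ℝ ∞ (fun p => (fderiv ℝ f p).comp (ContinuousLinearMap.inl ℝ E ℝ))
        (U ×ˢ univ) :=
      ((hf.fderiv_of_isOpen hO (by simp)).clm_comp contDiffOn_const)
    exact (ih h2).congr fun x hx => (hd x hx).fderiv

/-- The integral over a compact interval of a smooth function is smooth in the parameters. -/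
theorem contDiffOn_parametric_integral {E F : Type u} [NormedAddCommGroup E] [NormedSpace ℝ E]
    [ProperSpace E] [NormedAddCommGroup F] [NormedSpace ℝ F] [CompleteSpace F]
    {U : Set E} (hU : IsOpen U) {f : E × ℝ → F} (hf : ContDiffOn ℝ ∞ f (U ×ˢ univ)) (a b : ℝ) :
    ContDiffOn ℝ ∞ (fun x => ∫ t in a..b, f (x, t)) U :=
  contDiffOn_infty.2 fun n => contDiffOn_parametric_integral_nat hU a b n hf

/-- A version of `contDiffOn_parametric_integral` for functions which are smooth on
an open set containing `U × [0, 1]` only. -/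
theorem contDiffOn_unit_integral {E : Type} [NormedAddCommGroup E] [NormedSpace ℝ E]
    [ProperSpace E] {U : Set E} (hU : IsOpen U) {W : Set (E × ℝ)} {f : E × ℝ → ℝ}
    (hf : ContDiffOn ℝ ∞ f W) (hW : ∀ x ∈ U, ∀ t ∈ Icc (0 : ℝ) 1, (x, t) ∈ W) :
    ContDiffOn ℝ ∞ (fun x => ∫ t in (0 : ℝ)..1, f (x, t)) U := by
  -- The substitution `t = sin² τ` makes the integrand smooth for all real `τ`.
  have hs : ∀ τ : ℝ, Real.sin τ ^ 2 ∈ Icc (0 : ℝ) 1 :=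
    fun τ => ⟨sq_nonneg _, Real.sin_sq_le_one τ⟩
  let g : E × ℝ → ℝ := fun p => f (p.1, Real.sin p.2 ^ 2) * (2 * Real.sin p.2 * Real.cos p.2)
  have hg : ContDiffOn ℝ ∞ g (U ×ˢ univ) :=
    (hf.comp (f := fun p : E × ℝ => (p.1, Real.sin p.2 ^ 2)) (by fun_prop)
      fun p hp => hW _ hp.1 _ (hs _)).mul (by fun_prop)
  refine (contDiffOn_parametric_integral hU hg 0 (Real.pi / 2)).congr fun x hx => ?_
  have h2 : ∀ τ, HasDerivAt (fun τ => Real.sin τ ^ 2) (2 * Real.sin τ * Real.cos τ) τ := fun τ => by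
    have := (Real.hasDerivAt_sin τ).fun_pow 2
    simpa using this
  have := intervalIntegral.integral_comp_mul_deriv'' (a := 0) (b := Real.pi / 2)
    (f := fun τ => Real.sin τ ^ 2) (f' := fun τ => 2 * Real.sin τ * Real.cos τ)
    (g := fun t => f (x, t)) (by fun_prop) (fun τ _ => (h2 τ).hasDerivWithinAt) (by fun_prop)
    (hf.continuousOn.comp (by fun_prop) (by rintro _ ⟨τ, _, rfl⟩; exact hW x hx _ (hs τ)))
  simpa using this.symm

/-! ### The cylinder -/

/-- The plane `ℝ²`. -/
abbrev E2 : Type := EuclideanSpace ℝ (Fin 2)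

/-- The solid cylinder `{|z| < r} × ℝ`. -/
def cyl (r : ℝ) : Set Cyl := Metric.ball 0 r ×ˢ univ

theorem isOpen_cyl (r : ℝ) : IsOpen (cyl r) := Metric.isOpen_ball.prod isOpen_univ

theorem mem_cyl {r : ℝ} {q : Cyl} : q ∈ cyl r ↔ ‖q.1‖ < r := by
  simp [cyl]

theorem norm_sq_eq (z : E2) : ‖z‖ ^ 2 = z 0 ^ 2 + z 1 ^ 2 := by
  rw [EuclideanSpace.norm_sq_eq]; simp

theorem sFun_eq (q : Cyl) : sFun q = ‖q.1‖ ^ 2 / 2 := by rw [sFun, norm_sq_eq]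

theorem sFun_mem {q : Cyl} (hq : q ∈ cyl 1) : sFun q ∈ Ico (0 : ℝ) (1 / 2) := by
  have := mem_cyl.1 hq
  rw [sFun_eq]
  constructor
  · positivity
  · nlinarith [norm_nonneg q.1]

theorem cyl_eq_sum (v : Cyl) : v = v.1 0 • ex + v.1 1 • ey + v.2 • ephi := by
  refine Prod.ext ?_ ?_
  · ext i; fin_cases i <;> simp [ex, ey, ephi]
  · simp [ex, ey, ephi]

/-- The rotation of the plane by the angle `t`. -/
def rot (t : ℝ) (z : E2) : E2 :=
  !₂[Real.cos t * z 0 - Real.sin t * z 1, Real.sin t * z 0 + Real.cos t * z 1]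

@[simp] theorem rot_zero' (t : ℝ) (z : E2) :
    rot t z 0 = Real.cos t * z 0 - Real.sin t * z 1 := by simp [rot]

@[simp] theorem rot_one' (t : ℝ) (z : E2) :
    rot t z 1 = Real.sin t * z 0 + Real.cos t * z 1 := by simp [rot]

theorem E2_ext {z w : E2} (h0 : z 0 = w 0) (h1 : z 1 = w 1) : z = w := by
  ext i; fin_cases i <;> simpa

theorem rot_of_zero (z : E2) : rot 0 z = z := E2_ext (by simp) (by simp)

theorem rot_two_pi (z : E2) : rot (2 * Real.pi) z = z := E2_ext (by simp) (by simp)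

theorem norm_rot (t : ℝ) (z : E2) : ‖rot t z‖ = ‖z‖ := by
  refine (sq_eq_sq₀ (norm_nonneg _) (norm_nonneg _)).1 ?_
  rw [norm_sq_eq, norm_sq_eq, rot_zero', rot_one']
  linear_combination (z 0 ^ 2 + z 1 ^ 2) * Real.sin_sq_add_cos_sq t

theorem contDiff_rot : ContDiff ℝ ∞ fun p : ℝ × E2 => rot p.1 p.2 := by
  have h0 : ∀ i : Fin 2, ContDiff ℝ ∞ fun p : ℝ × E2 => p.2 i := fun i =>
    (contDiff_piLp_apply (p := 2) (i := i)).comp contDiff_snd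
  refine (contDiff_piLp 2).2 fun i => ?_
  have hs := Real.contDiff_sin.comp (contDiff_fst : ContDiff ℝ ∞ fun p : ℝ × E2 => p.1)
  have hc := Real.contDiff_cos.comp (contDiff_fst : ContDiff ℝ ∞ fun p : ℝ × E2 => p.1)
  fin_cases i
  · simpa [rot, Function.comp_def] using (hc.mul (h0 0)).sub (hs.mul (h0 1))
  · simpa [rot, Function.comp_def] using (hs.mul (h0 0)).add (hc.mul (h0 1))

/-- The rotation by a right angle. -/
def rotJ (z : E2) : E2 := !₂[-z 1, z 0]

/-- The generator `x ∂_y - y ∂_x` of the rotations of the cylinder. -/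
def dth (q : Cyl) : Cyl := (rotJ q.1, 0)

@[simp] theorem rotJ_zero (z : E2) : rotJ z 0 = - z 1 := by simp [rotJ]

@[simp] theorem rotJ_one (z : E2) : rotJ z 1 = z 0 := by simp [rotJ]

theorem dth_eq (q : Cyl) : dth q = q.1 0 • ey - q.1 1 • ex := by
  refine Prod.ext (E2_ext ?_ ?_) ?_ <;> simp [dth, ex, ey]

theorem hasDerivAt_rot (z : E2) (t : ℝ) : HasDerivAt (fun t => rot t z) (rotJ (rot t z)) t := by
  have h1 : (fun t => rot t z) = fun t => Real.cos t • z + Real.sin t • rotJ z := by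
    funext t
    refine E2_ext ?_ ?_ <;> simp <;> ring
  have h2 : rotJ (rot t z) = -Real.sin t • z + Real.cos t • rotJ z := by
    refine E2_ext ?_ ?_ <;> simp <;> ring
  rw [h1, h2]
  exact ((Real.hasDerivAt_cos t).smul_const z).add ((Real.hasDerivAt_sin t).smul_const (rotJ z))

/-- The rotation as a linear map. -/
def rotL (t : ℝ) : E2 →L[ℝ] E2 :=
  LinearMap.toContinuousLinearMap
    { toFun := rot t
      map_add' := fun z w => E2_ext (by simp; ring) (by simp; ring)
      map_smul' := fun c z => E2_ext (by simp; ring) (by simp; ring) }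

@[simp] theorem rotL_apply (t : ℝ) (z : E2) : rotL t z = rot t z := rfl

theorem rot_rotJ (t : ℝ) (z : E2) : rot t (rotJ z) = rotJ (rot t z) := by
  refine E2_ext ?_ ?_ <;> simp <;> ring

/-! ### Averaging along a periodic flow of the cylinder -/

/-- A flow on the cylinder by smooth maps with derivatives `DA` which preserve `|z|`,
generated by the vector field `V`. -/
structure IsCylFlow (A : ℝ → Cyl → Cyl) (DA : ℝ → Cyl →L[ℝ] Cyl) (V : Cyl → Cyl) : Prop where
  smooth : ContDiff ℝ ∞ fun p : Cyl × ℝ => A p.2 p.1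
  norm : ∀ t q, ‖(A t q).1‖ = ‖q.1‖
  zero : ∀ q, A 0 q = q
  hasDeriv : ∀ q t, HasDerivAt (fun t => A t q) (V (A t q)) t
  hasFDeriv : ∀ t q, HasFDerivAt (A t) (DA t) q

theorem isCylFlow_rot : IsCylFlow (fun t q => (rot t q.1, q.2))
    (fun t => (rotL t).prodMap (ContinuousLinearMap.id ℝ ℝ)) dth where
  smooth := (contDiff_rot.comp (contDiff_snd.prodMk (contDiff_fst.comp contDiff_fst))).prodMk
    (contDiff_snd.comp contDiff_fst)
  norm t q := norm_rot t q.1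
  zero q := by simp [rot_of_zero]
  hasDeriv q t := (hasDerivAt_rot q.1 t).prodMk (hasDerivAt_const t q.2)
  hasFDeriv t q := ((rotL t).prodMap (ContinuousLinearMap.id ℝ ℝ)).hasFDerivAt

theorem isCylFlow_shift : IsCylFlow (fun t q => (q.1, q.2 + t))
    (fun _ => ContinuousLinearMap.id ℝ Cyl) (fun _ => ephi) where
  smooth := by fun_prop
  norm t q := rfl
  zero q := by simp
  hasDeriv q t := (hasDerivAt_const t q.1).prodMk ((hasDerivAt_id t).const_add q.2)
  hasFDeriv t q := by
    have : (fun q : Cyl => (q.1, q.2 + t)) = fun q => q + (0, t) := by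
      ext q <;> simp
    rw [this]
    exact (hasFDerivAt_id q).add_const _

section Averaging

variable {A : ℝ → Cyl → Cyl} {DA : ℝ → Cyl →L[ℝ] Cyl} {V : Cyl → Cyl} {r : ℝ}

theorem IsCylFlow.mem (hA : IsCylFlow A DA V) {q : Cyl} (hq : q ∈ cyl r) (t : ℝ) :
    A t q ∈ cyl r := mem_cyl.2 (hA.norm t q ▸ mem_cyl.1 hq)

/-- The weighted average `(2π)⁻¹ ∫₀^{2π} k(t) f(A_t q) dt`. -/
def wavg (A : ℝ → Cyl → Cyl) (k : ℝ → ℝ) (f : Cyl → ℝ) (q : Cyl) : ℝ :=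
  ∫ t in (0 : ℝ)..(2 * Real.pi), (2 * Real.pi)⁻¹ * k t * f (A t q)

theorem IsCylFlow.contDiffOn_integrand (hA : IsCylFlow A DA V) {k : ℝ → ℝ} (hk : ContDiff ℝ ∞ k)
    {f : Cyl → ℝ} (hf : ContDiffOn ℝ ∞ f (cyl r)) :
    ContDiffOn ℝ ∞ (fun p : Cyl × ℝ => (2 * Real.pi)⁻¹ * k p.2 * f (A p.2 p.1))
      (cyl r ×ˢ univ) := by
  refine ((contDiff_const.mul (hk.comp contDiff_snd)).contDiffOn).mul ?_
  exact hf.comp hA.smooth.contDiffOn fun p hp => hA.mem hp.1 _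

theorem IsCylFlow.contDiffOn_wavg (hA : IsCylFlow A DA V) {k : ℝ → ℝ} (hk : ContDiff ℝ ∞ k)
    {f : Cyl → ℝ} (hf : ContDiffOn ℝ ∞ f (cyl r)) : ContDiffOn ℝ ∞ (wavg A k f) (cyl r) :=
  contDiffOn_parametric_integral (isOpen_cyl r) (hA.contDiffOn_integrand hk hf) _ _

theorem differentiableAt_of_cyl {f : Cyl → ℝ} (hf : ContDiffOn ℝ ∞ f (cyl r)) {q : Cyl}
    (hq : q ∈ cyl r) : DifferentiableAt ℝ f q :=
  (hf.contDiffAt ((isOpen_cyl r).mem_nhds hq)).differentiableAt (by simp)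

theorem contDiffOn_fderiv_apply {f : Cyl → ℝ} (hf : ContDiffOn ℝ ∞ f (cyl r)) {W : Cyl → Cyl}
    (hW : ContDiff ℝ ∞ W) : ContDiffOn ℝ ∞ (fun q => fderiv ℝ f q (W q)) (cyl r) :=
  (hf.fderiv_of_isOpen (isOpen_cyl r) (by simp)).clm_apply hW.contDiffOn

/-- Averaging commutes with the derivative along an invariant vector field. -/
theorem IsCylFlow.fderiv_wavg (hA : IsCylFlow A DA V) {k : ℝ → ℝ} (hk : ContDiff ℝ ∞ k)
    {f : Cyl → ℝ} (hf : ContDiffOn ℝ ∞ f (cyl r)) {W : Cyl → Cyl}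
    (hW : ∀ t q, DA t (W q) = W (A t q)) {q : Cyl} (hq : q ∈ cyl r) :
    fderiv ℝ (wavg A k f) q (W q) = wavg A k (fun q => fderiv ℝ f q (W q)) q := by
  have hi := hA.contDiffOn_integrand hk hf
  have hO : IsOpen (cyl r ×ˢ (univ : Set ℝ)) := (isOpen_cyl r).prod isOpen_univ
  have h := hasFDerivAt_parametric_integral (isOpen_cyl r) (hi.of_le (by exact_mod_cast le_top))
    0 (2 * Real.pi) hq
  have hint : IntervalIntegrable (fun t => (fderiv ℝ
      (fun p : Cyl × ℝ => (2 * Real.pi)⁻¹ * k p.2 * f (A p.2 p.1)) (q, t)).comp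
      (ContinuousLinearMap.inl ℝ Cyl ℝ)) volume 0 (2 * Real.pi) := by
    refine Continuous.intervalIntegrable ?_ _ _
    have := ((hi.fderiv_of_isOpen hO (m := ∞) (by simp)).continuousOn).comp_continuous
      (f := fun t : ℝ => (q, t)) (by fun_prop) fun t => ⟨hq, mem_univ _⟩
    exact this.clm_comp continuous_const
  have h' : HasFDerivAt (wavg A k f) _ q := h
  rw [h'.fderiv, ContinuousLinearMap.intervalIntegral_apply hint, wavg]
  refine intervalIntegral.integral_congr fun t _ => ?_
  have h1 := (hi.contDiffAt (hO.mem_nhds (x := (q, t)) ⟨hq, mem_univ _⟩)).differentiableAt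
    (by simp)
  have h2 : HasFDerivAt (fun q => (2 * Real.pi)⁻¹ * k t * f (A t q)) _ q :=
    HasFDerivAt.comp (g := fun p : Cyl × ℝ => (2 * Real.pi)⁻¹ * k p.2 * f (A p.2 p.1))
      (f := fun q : Cyl => (q, t)) q h1.hasFDerivAt (hasFDerivAt_prodMk_left q t)
  have h3 : HasFDerivAt (fun q => (2 * Real.pi)⁻¹ * k t * f (A t q)) _ q :=
    (((differentiableAt_of_cyl hf (hA.mem hq t)).hasFDerivAt.comp q (hA.hasFDeriv t q)).const_mul
      ((2 * Real.pi)⁻¹ * k t))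
  have h4 := DFunLike.congr_fun (h2.unique h3) (W q)
  simpa [hW] using h4

theorem IsCylFlow.hasDerivAt_comp (hA : IsCylFlow A DA V) {f : Cyl → ℝ}
    (hf : ContDiffOn ℝ ∞ f (cyl r)) {q : Cyl} (hq : q ∈ cyl r) (t : ℝ) :
    HasDerivAt (fun t => f (A t q)) (fderiv ℝ f (A t q) (V (A t q))) t :=
  (differentiableAt_of_cyl hf (hA.mem hq t)).hasFDerivAt.comp_hasDerivAt t (hA.hasDeriv q t)

theorem IsCylFlow.continuous_deriv (hA : IsCylFlow A DA V) (hV : ContDiff ℝ ∞ V) {f : Cyl → ℝ}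
    (hf : ContDiffOn ℝ ∞ f (cyl r)) {q : Cyl} (hq : q ∈ cyl r) :
    Continuous fun t => fderiv ℝ f (A t q) (V (A t q)) :=
  (contDiffOn_fderiv_apply hf hV).continuousOn.comp_continuous
    (hA.smooth.continuous.comp (continuous_const.prodMk continuous_id)) fun t => hA.mem hq t

/-- The average of a derivative along a periodic flow vanishes. -/
theorem IsCylFlow.wavg_one_deriv (hA : IsCylFlow A DA V) (hV : ContDiff ℝ ∞ V) {f : Cyl → ℝ}
    (hf : ContDiffOn ℝ ∞ f (cyl r)) {q : Cyl} (hq : q ∈ cyl r)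
    (hper : f (A (2 * Real.pi) q) = f q) :
    wavg A (fun _ => 1) (fun q => fderiv ℝ f q (V q)) q = 0 := by
  simp only [wavg, mul_one]
  rw [intervalIntegral.integral_const_mul, intervalIntegral.integral_eq_sub_of_hasDerivAt
    (fun t _ => hA.hasDerivAt_comp hf hq t) ((hA.continuous_deriv hV hf hq).intervalIntegrable _ _),
    hper, hA.zero]
  simp

/-- Integration by parts: the average with weight `t` inverts the derivative along a periodic
flow up to the average. -/
theorem IsCylFlow.wavg_id_deriv (hA : IsCylFlow A DA V) (hV : ContDiff ℝ ∞ V) {f : Cyl → ℝ}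
    (hf : ContDiffOn ℝ ∞ f (cyl r)) {q : Cyl} (hq : q ∈ cyl r)
    (hper : f (A (2 * Real.pi) q) = f q) :
    wavg A id (fun q => fderiv ℝ f q (V q)) q = f q - wavg A (fun _ => 1) f q := by
  have hc : Continuous fun t => f (A t q) := hf.continuousOn.comp_continuous
    (hA.smooth.continuous.comp (continuous_const.prodMk continuous_id)) fun t => hA.mem hq t
  have := intervalIntegral.integral_mul_deriv_eq_deriv_mul (a := 0) (b := 2 * Real.pi)
    (u := fun t : ℝ => t) (u' := fun _ => 1) (v := fun t => f (A t q))
    (fun t _ => hasDerivAt_id t) (fun t _ => hA.hasDerivAt_comp hf hq t)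
    intervalIntegrable_const ((hA.continuous_deriv hV hf hq).intervalIntegrable _ _)
  simp only [wavg, mul_assoc, id]
  rw [intervalIntegral.integral_const_mul, intervalIntegral.integral_const_mul, this, hper]
  have := Real.pi_pos
  field_simp
  ring

theorem IsCylFlow.wavg_congr (hA : IsCylFlow A DA V) {k : ℝ → ℝ} {f g : Cyl → ℝ}
    (hfg : ∀ q ∈ cyl r, f q = g q) {q : Cyl} (hq : q ∈ cyl r) : wavg A k f q = wavg A k g q :=
  intervalIntegral.integral_congr fun t _ => by simp only [hfg _ (hA.mem hq t)]

theorem wavg_zero (A : ℝ → Cyl → Cyl) (k : ℝ → ℝ) (q : Cyl) : wavg A k (fun _ => 0) q = 0 := by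
  simp [wavg]

end Averaging

/-! ### Even functions and functions invariant under rotations -/

/-- One step in the proof that an even smooth function is a smooth function of the square: if `h`
is smooth and even, so is `h'(r)/r`. -/
theorem exists_even_deriv_div {h : ℝ → ℝ} (hh : ContDiffOn ℝ ∞ h (Ioo (-1) 1))
    (he : ∀ r ∈ Ioo (-1 : ℝ) 1, h (-r) = h r) :
    ∃ k : ℝ → ℝ, ContDiffOn ℝ ∞ k (Ioo (-1) 1) ∧ (∀ r ∈ Ioo (-1 : ℝ) 1, k (-r) = k r) ∧
      ∀ r ∈ Ioo (-1 : ℝ) 1, deriv h r = r * k r := by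
  have hd : ContDiffOn ℝ ∞ (deriv h) (Ioo (-1) 1) := hh.deriv_of_isOpen isOpen_Ioo (by simp)
  have hd2 : ContDiffOn ℝ ∞ (deriv (deriv h)) (Ioo (-1) 1) := hd.deriv_of_isOpen isOpen_Ioo (by simp)
  have hneg : ∀ r ∈ Ioo (-1 : ℝ) 1, -r ∈ Ioo (-1 : ℝ) 1 := fun r hr =>
    ⟨by linarith [hr.2], by linarith [hr.1]⟩
  have hodd : ∀ r ∈ Ioo (-1 : ℝ) 1, deriv h (-r) = - deriv h r := by
    intro r hr
    have h1 : (fun x => h (-x)) =ᶠ[𝓝 r] h := by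
      filter_upwards [isOpen_Ioo.mem_nhds hr] with x hx using he x hx
    have h2 := h1.deriv_eq
    rw [deriv_comp_neg] at h2
    linarith
  have heven : ∀ r ∈ Ioo (-1 : ℝ) 1, deriv (deriv h) (-r) = deriv (deriv h) r := by
    intro r hr
    have h1 : (fun x => deriv h (-x)) =ᶠ[𝓝 r] fun x => - deriv h x := by
      filter_upwards [isOpen_Ioo.mem_nhds hr] with x hx using hodd x hx
    have h2 := h1.deriv_eq
    rw [deriv_comp_neg, deriv.fun_neg] at h2
    linarith
  have hscale : ∀ r ∈ Ioo (-1 : ℝ) 1, ∀ t ∈ Icc (0 : ℝ) 1, t * r ∈ Ioo (-1 : ℝ) 1 := by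
    intro r hr t ht
    rw [mem_Ioo, ← abs_lt] at hr ⊢
    rw [abs_mul, abs_of_nonneg ht.1]
    nlinarith [abs_nonneg r, ht.1, ht.2]
  refine ⟨fun r => ∫ t in (0 : ℝ)..1, deriv (deriv h) (t * r),
    contDiffOn_unit_integral isOpen_Ioo (f := fun p : ℝ × ℝ => deriv (deriv h) (p.2 * p.1))
      (W := {p | p.2 * p.1 ∈ Ioo (-1 : ℝ) 1}) (hd2.comp (by fun_prop) fun p hp => hp)
      fun r hr t ht => hscale r hr t ht, fun r hr => ?_, fun r hr => ?_⟩
  · refine intervalIntegral.integral_congr fun t ht => ?_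
    rw [uIcc_of_le zero_le_one] at ht
    simp only [mul_neg]
    exact heven _ (hscale r hr t ht)
  · have h0 := hodd 0 (by simp)
    simp only [neg_zero] at h0
    have hder : ∀ t ∈ uIcc (0 : ℝ) 1,
        HasDerivAt (fun t => deriv h (t * r)) (r * deriv (deriv h) (t * r)) t := by
      intro t ht
      rw [uIcc_of_le zero_le_one] at ht
      have h1 : HasDerivAt (deriv h) (deriv (deriv h) (t * r)) (t * r) :=
        ((hd.contDiffAt (isOpen_Ioo.mem_nhds (hscale r hr t ht))).differentiableAt
          (by simp)).hasDerivAt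
      have h3 := h1.comp t ((hasDerivAt_id t).mul_const r)
      rw [mul_comm] at h3
      simpa [Function.comp_def] using h3
    have hcont : ContinuousOn (fun t => r * deriv (deriv h) (t * r)) (uIcc 0 1) := by
      rw [uIcc_of_le zero_le_one]
      exact continuousOn_const.mul (hd2.continuousOn.comp (by fun_prop) (hscale r hr))
    have := intervalIntegral.integral_eq_sub_of_hasDerivAt hder hcont.intervalIntegrable
    rw [intervalIntegral.integral_const_mul] at this
    rw [this]
    simp
    linarith

theorem sqrt_two_mul_mem {s : ℝ} (hs : s ∈ Ico (0 : ℝ) (1 / 2)) :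
    √(2 * s) ∈ Ioo (-1 : ℝ) 1 := by
  have h0 := Real.sqrt_nonneg (2 * s)
  refine ⟨by linarith, ?_⟩
  rw [Real.sqrt_lt' one_pos]
  linarith [hs.2]

/-- If `h'(r) = r k(r)` with `k` even, the derivative of `s ↦ h(√(2s))` is `k(√(2s))`, at `s = 0` too. -/
theorem hasDerivWithinAt_comp_sqrt {h k : ℝ → ℝ} (hh : ContDiffOn ℝ ∞ h (Ioo (-1) 1))
    (hk : ContDiffOn ℝ ∞ k (Ioo (-1) 1)) (hd : ∀ r ∈ Ioo (-1 : ℝ) 1, deriv h r = r * k r)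
    {s : ℝ} (hs : s ∈ Ico (0 : ℝ) (1 / 2)) :
    HasDerivWithinAt (fun s => h √(2 * s)) (k √(2 * s)) (Ico 0 (1 / 2)) s := by
  have hpos : ∀ x ∈ Ioo (0 : ℝ) (1 / 2), HasDerivAt (fun s => h √(2 * s)) (k √(2 * x)) x := by
    intro x hx
    have hm := sqrt_two_mul_mem (Ioo_subset_Ico_self hx)
    have h1 : HasDerivAt h (√(2 * x) * k √(2 * x)) √(2 * x) := by
      rw [← hd _ hm]
      exact ((hh.contDiffAt (isOpen_Ioo.mem_nhds hm)).differentiableAt (by simp)).hasDerivAt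
    have hx0 : 0 < √(2 * x) := Real.sqrt_pos.2 (by linarith [hx.1])
    have h2 : HasDerivAt (fun s => √(2 * s)) (2 / (2 * √(2 * x))) x :=
      HasDerivAt.sqrt (by simpa using (hasDerivAt_id x).const_mul 2) (by linarith [hx.1])
    have h3 := h1.comp x h2
    have h4 : √(2 * x) * k √(2 * x) * (2 / (2 * √(2 * x))) = k √(2 * x) := by
      field_simp
    rwa [h4] at h3
  have hc : ∀ {f : ℝ → ℝ}, ContDiffOn ℝ ∞ f (Ioo (-1) 1) →
      ContinuousOn (fun s => f √(2 * s)) (Ico 0 (1 / 2)) := fun hf =>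
    hf.continuousOn.comp (by fun_prop) fun s hs => sqrt_two_mul_mem hs
  rcases hs.1.eq_or_lt with h0 | h0
  · subst h0
    refine (hasDerivWithinAt_Ici_of_tendsto_deriv (s := Ioo 0 (1 / 2)) ?_ ?_ ?_ ?_).mono
      Ico_subset_Ici_self
    · exact fun x hx => (hpos x hx).differentiableAt.differentiableWithinAt
    · exact ((hc hh) 0 hs).mono Ioo_subset_Ico_self
    · exact Ioo_mem_nhdsGT (by norm_num)
    · have : Filter.Tendsto (fun s => k √(2 * s)) (𝓝[>] 0) (𝓝 (k √(2 * 0))) := by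
        refine ((hc hk) 0 hs).mono_left (nhdsWithin_le_of_mem ?_)
        exact Filter.mem_of_superset (Ioo_mem_nhdsGT (by norm_num)) Ioo_subset_Ico_self
      refine this.congr' ?_
      filter_upwards [Ioo_mem_nhdsGT (show (0 : ℝ) < 1 / 2 by norm_num)] with x hx
      exact (hpos x hx).deriv.symm
  · exact (hpos s ⟨h0, hs.2⟩).hasDerivWithinAt

/-- A smooth even function on `(-1, 1)` is a smooth function of `r²/2`. -/
theorem contDiffOn_comp_sqrt {h : ℝ → ℝ} (hh : ContDiffOn ℝ ∞ h (Ioo (-1) 1))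
    (he : ∀ r ∈ Ioo (-1 : ℝ) 1, h (-r) = h r) :
    ContDiffOn ℝ ∞ (fun s => h √(2 * s)) (Ico 0 (1 / 2)) := by
  refine contDiffOn_infty.2 fun n => ?_
  induction n generalizing h with
  | zero =>
    exact contDiffOn_zero.2 (hh.continuousOn.comp (by fun_prop) fun s hs => sqrt_two_mul_mem hs)
  | succ n ih =>
    obtain ⟨k, hk, hke, hd⟩ := exists_even_deriv_div hh he
    have hu : UniqueDiffOn ℝ (Ico (0 : ℝ) (1 / 2)) := uniqueDiffOn_Ico _ _
    have hd' := fun s (hs : s ∈ Ico (0 : ℝ) (1 / 2)) => hasDerivWithinAt_comp_sqrt hh hk hd hs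
    have : ((n + 1 : ℕ) : WithTop ℕ∞) = (n : WithTop ℕ∞) + 1 := by push_cast; rfl
    rw [this, contDiffOn_succ_iff_derivWithin hu]
    exact ⟨fun s hs => (hd' s hs).differentiableWithinAt, by simp,
      (ih hk hke).congr fun s hs => (hd' s hs).derivWithin (hu s hs)⟩

/-- A function whose derivative along the generator of a flow vanishes is constant along the flow. -/
theorem const_along_flow {A : ℝ → Cyl → Cyl} {DA : ℝ → Cyl →L[ℝ] Cyl} {V : Cyl → Cyl} {r : ℝ}
    (hA : IsCylFlow A DA V) {f : Cyl → ℝ} (hf : ContDiffOn ℝ ∞ f (cyl r))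
    (h0 : ∀ q ∈ cyl r, fderiv ℝ f q (V q) = 0) {q : Cyl} (hq : q ∈ cyl r) (t : ℝ) :
    f (A t q) = f q := by
  have h1 : ∀ t, HasDerivAt (fun t => f (A t q)) 0 t := fun t => by
    have := hA.hasDerivAt_comp hf hq t
    rwa [h0 _ (hA.mem hq t)] at this
  have := is_const_of_deriv_eq_zero (fun t => (h1 t).differentiableAt) (fun t => (h1 t).deriv) t 0
  simpa only [hA.zero] using this

/-- Polar coordinates in the plane. -/
theorem exists_rot_eq (z : E2) : ∃ t, z = rot t !₂[‖z‖, 0] := by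
  let w : ℂ := ⟨z 0, z 1⟩
  have hw : ‖w‖ = ‖z‖ := by
    refine (sq_eq_sq₀ (norm_nonneg _) (norm_nonneg _)).1 ?_
    rw [norm_sq_eq, ← Complex.normSq_eq_norm_sq, Complex.normSq_apply]
    simp only [w]; ring
  refine ⟨Complex.arg w, E2_ext ?_ ?_⟩
  · have := Complex.norm_mul_cos_arg w
    rw [hw] at this
    simp; rw [mul_comm, this]
  · have := Complex.norm_mul_sin_arg w
    rw [hw] at this
    simp; rw [mul_comm, this]

/-- A smooth function on the solid cylinder which is invariant under rotations and translations
is a smooth function of `s`. -/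
theorem exists_eq_comp_sFun {f : Cyl → ℝ} (hf : ContDiffOn ℝ ∞ f (cyl 1))
    (hth : ∀ q ∈ cyl 1, fderiv ℝ f q (dth q) = 0) (hph : ∀ q ∈ cyl 1, fderiv ℝ f q ephi = 0) :
    ∃ F : ℝ → ℝ, ContDiffOn ℝ ∞ F (Ico 0 (1 / 2)) ∧ ∀ q ∈ cyl 1, f q = F (sFun q) := by
  -- the restriction to the ray `y = φ = 0`; it is even because of the rotation by `π`
  let ι : ℝ → Cyl := fun r => (!₂[r, 0], 0)
  have hιs : ContDiff ℝ ∞ ι := by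
    refine ContDiff.prodMk ((contDiff_piLp 2).2 fun i => ?_) contDiff_const
    fin_cases i
    · exact contDiff_id
    · simpa using contDiff_const
  have hnorm : ∀ r : ℝ, ‖(!₂[r, 0] : E2)‖ = |r| := fun r => by
    refine (sq_eq_sq₀ (norm_nonneg _) (abs_nonneg _)).1 ?_
    rw [norm_sq_eq]; simp
  have hιm : ∀ r ∈ Ioo (-1 : ℝ) 1, ι r ∈ cyl 1 := fun r hr => by
    rw [mem_cyl]; simpa only [ι, hnorm] using abs_lt.2 hr
  refine ⟨fun s => f (ι √(2 * s)), contDiffOn_comp_sqrt (h := fun r => f (ι r))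
    (hf.comp hιs.contDiffOn hιm) ?_, ?_⟩
  · intro r hr
    have := const_along_flow isCylFlow_rot hf hth (hιm r hr) Real.pi
    rw [← this]
    congr 1
    refine Prod.ext (E2_ext ?_ ?_) ?_ <;> simp [ι]
  · intro q hq
    obtain ⟨t, ht⟩ := exists_rot_eq q.1
    have h1 : √(2 * sFun q) = ‖q.1‖ := by
      rw [sFun_eq, mul_div_cancel₀ _ two_ne_zero, Real.sqrt_sq (norm_nonneg _)]
    have hm : ι ‖q.1‖ ∈ cyl 1 := hιm _ ⟨by linarith [norm_nonneg q.1], mem_cyl.1 hq⟩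
    have h2 := const_along_flow isCylFlow_rot hf hth hm t
    have h3 := const_along_flow isCylFlow_shift hf hph (isCylFlow_rot.mem hm t) q.2
    simp only [h1]
    rw [← h2, ← h3]
    congr 1
    refine Prod.ext ht ?_
    simp [ι]

/-! ### Linearizing a closed 1-form on the tori -/

/-- The form `F dθ + b dφ` on the tori `s = const`, closed by `hcl`, becomes invariant
(`Fa dθ + ba dφ`) after subtracting the differential of a smooth function `w` on each torus. -/
theorem exists_torus_linearization {F b : Cyl → ℝ} (hF : ContDiffOn ℝ ∞ F (cyl 1))
    (hb : ContDiffOn ℝ ∞ b (cyl 1))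
    (hFp : ∀ q : Cyl, F (q.1, q.2 + 2 * Real.pi) = F q)
    (hbp : ∀ q : Cyl, b (q.1, q.2 + 2 * Real.pi) = b q)
    (hcl : ∀ q ∈ cyl 1, fderiv ℝ F q ephi = fderiv ℝ b q (dth q)) :
    ∃ w Fa ba : Cyl → ℝ, ContDiffOn ℝ ∞ w (cyl 1) ∧ ContDiffOn ℝ ∞ Fa (cyl 1) ∧
      ContDiffOn ℝ ∞ ba (cyl 1) ∧ (∀ q : Cyl, w (q.1, q.2 + 2 * Real.pi) = w q) ∧
      (∀ q ∈ cyl 1, fderiv ℝ Fa q (dth q) = 0) ∧ (∀ q ∈ cyl 1, fderiv ℝ Fa q ephi = 0) ∧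
      (∀ q ∈ cyl 1, fderiv ℝ ba q (dth q) = 0) ∧ (∀ q ∈ cyl 1, fderiv ℝ ba q ephi = 0) ∧
      (∀ q ∈ cyl 1, fderiv ℝ w q (dth q) = F q - Fa q) ∧
      (∀ q ∈ cyl 1, fderiv ℝ w q ephi = b q - ba q) ∧
      (∀ q : Cyl, q.1 = 0 → Fa q = F q) := by
  have hR := isCylFlow_rot
  have hS := isCylFlow_shift
  set R : ℝ → Cyl → Cyl := fun t q => (rot t q.1, q.2)
  set S : ℝ → Cyl → Cyl := fun t q => (q.1, q.2 + t)
  have hdth : ContDiff ℝ ∞ dth := by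
    have : dth = fun q : Cyl => q.1 0 • ey - q.1 1 • ex := funext dth_eq
    rw [this]
    have h0 : ∀ i : Fin 2, ContDiff ℝ ∞ fun q : Cyl => q.1 i := fun i =>
      (contDiff_piLp_apply (p := 2) (i := i)).comp contDiff_fst
    exact ((h0 0).smul contDiff_const).sub ((h0 1).smul contDiff_const)
  -- rotations and translations commute, so both vector fields are invariant under both flows
  have hRth : ∀ t q, ((rotL t).prodMap (ContinuousLinearMap.id ℝ ℝ)) (dth q) = dth (R t q) := by
    intro t q
    simp [dth, R, rot_rotJ]
  have hRph : ∀ (t : ℝ) (q : Cyl), ((rotL t).prodMap (ContinuousLinearMap.id ℝ ℝ)) ephi = ephi := by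
    intro t q
    refine Prod.ext (E2_ext ?_ ?_) ?_ <;> simp [ephi]
  have hSth : ∀ t q, ContinuousLinearMap.id ℝ Cyl (dth q) = dth (S t q) :=
    fun _ _ => rfl
  have hSph : ∀ (t : ℝ) (q : Cyl), ContinuousLinearMap.id ℝ Cyl ephi = ephi := fun _ _ => rfl
  have hRper : ∀ (f : Cyl → ℝ) q, f (R (2 * Real.pi) q) = f q := fun f q => by
    simp only [R, rot_two_pi]
  have c1 : ContDiff ℝ ∞ fun _ : ℝ => (1 : ℝ) := contDiff_const
  have cid : ContDiff ℝ ∞ (id : ℝ → ℝ) := contDiff_id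
  -- `b` averaged over the rotations only
  set bt := wavg R (fun _ => 1) b
  have hbt : ContDiffOn ℝ ∞ bt (cyl 1) := hR.contDiffOn_wavg c1 hb
  have hper : ∀ (k : ℝ → ℝ) (f : Cyl → ℝ), (∀ q : Cyl, f (q.1, q.2 + 2 * Real.pi) = f q) →
      ∀ q : Cyl, wavg R k f (q.1, q.2 + 2 * Real.pi) = wavg R k f q := by
    intro k f hf q
    refine intervalIntegral.integral_congr fun t _ => ?_
    simp only [R]
    rw [← hf (rot t q.1, q.2)]
  have hper' : ∀ (k : ℝ → ℝ) (f : Cyl → ℝ), (∀ q : Cyl, f (q.1, q.2 + 2 * Real.pi) = f q) →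
      ∀ q : Cyl, wavg S k f (q.1, q.2 + 2 * Real.pi) = wavg S k f q := by
    intro k f hf q
    refine intervalIntegral.integral_congr fun t _ => ?_
    simp only [S]
    rw [← hf (q.1, q.2 + t)]
    simp only [add_right_comm]
  have hSper : ∀ q, bt (S (2 * Real.pi) q) = bt q := hper _ _ hbp
  have hbtth : ∀ q ∈ cyl 1, fderiv ℝ bt q (dth q) = 0 := fun q hq => by
    rw [hR.fderiv_wavg c1 hb hRth hq]
    exact hR.wavg_one_deriv hdth hb hq (hRper _ _)
  -- Averages with weight `t` invert `∂_θ` and `∂_φ` up to averages (`IsCylFlow.wavg_id_deriv`), so the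
  -- first summand solves `∂_θ w = F - Fa` and, by `hcl`, `∂_φ w = b - bt`; the second one corrects the
  -- latter to `b - ba`.
  refine ⟨fun q => wavg R id F q + wavg S id bt q, wavg R (fun _ => 1) F,
    wavg S (fun _ => 1) bt, (hR.contDiffOn_wavg cid hF).add (hS.contDiffOn_wavg cid hbt),
    hR.contDiffOn_wavg c1 hF, hS.contDiffOn_wavg c1 hbt, ?_, ?_, ?_, ?_, ?_, ?_, ?_, ?_⟩
  · intro q
    simp only [hper _ _ hFp, hper' _ _ (hper _ _ hbp), bt]
  · intro q hq
    rw [hR.fderiv_wavg c1 hF hRth hq]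
    exact hR.wavg_one_deriv hdth hF hq (hRper _ _)
  · intro q hq
    rw [hR.fderiv_wavg (W := fun _ => ephi) c1 hF hRph hq, hR.wavg_congr hcl hq]
    exact hR.wavg_one_deriv hdth hb hq (hRper _ _)
  · intro q hq
    rw [hS.fderiv_wavg c1 hbt hSth hq, hS.wavg_congr hbtth hq, wavg_zero]
  · intro q hq
    rw [hS.fderiv_wavg (W := fun _ => ephi) c1 hbt hSph hq]
    exact hS.wavg_one_deriv contDiff_const hbt hq (hSper _)
  · intro q hq
    rw [fderiv_fun_add (differentiableAt_of_cyl (hR.contDiffOn_wavg cid hF) hq)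
      (differentiableAt_of_cyl (hS.contDiffOn_wavg cid hbt) hq), add_apply,
      hR.fderiv_wavg cid hF hRth hq, hR.wavg_id_deriv hdth hF hq (hRper _ _),
      hS.fderiv_wavg cid hbt hSth hq, hS.wavg_congr hbtth hq, wavg_zero, add_zero]
  · intro q hq
    rw [fderiv_fun_add (differentiableAt_of_cyl (hR.contDiffOn_wavg cid hF) hq)
      (differentiableAt_of_cyl (hS.contDiffOn_wavg cid hbt) hq), add_apply,
      hR.fderiv_wavg (W := fun _ => ephi) cid hF hRph hq, hR.wavg_congr hcl hq,
      hR.wavg_id_deriv hdth hb hq (hRper _ _),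
      hS.fderiv_wavg (W := fun _ => ephi) cid hbt hSph hq,
      hS.wavg_id_deriv contDiff_const hbt hq (hSper _)]
    ring
  · intro q hq
    have : ∀ t, R t q = q := fun t => by
      refine Prod.ext (E2_ext ?_ ?_) rfl <;> simp [R, hq]
    have := Real.pi_pos
    simp [wavg, *]
    field_simp

/-! ### Taylor expansion along the axis -/

theorem periodic_fderiv {F : Type*} [NormedAddCommGroup F] [NormedSpace ℝ F] {f : Cyl → F}
    (hf : ∀ q : Cyl, f (q.1, q.2 + 2 * Real.pi) = f q) (q : Cyl) :
    fderiv ℝ f (q.1, q.2 + 2 * Real.pi) = fderiv ℝ f q := by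
  have h1 : ∀ q : Cyl, (q.1, q.2 + 2 * Real.pi) = q + ((0 : E2), 2 * Real.pi) := fun q =>
    Prod.ext (by simp) (by simp)
  have h2 : (fun q => f (q + ((0 : E2), 2 * Real.pi))) = f := funext fun q => by rw [← h1, hf]
  rw [h1, ← fderiv_comp_add_right, h2]

theorem hasDerivAt_radial {F : Type*} [NormedAddCommGroup F] [NormedSpace ℝ F] {f : Cyl → F}
    {q : Cyl} {t : ℝ} (hf : DifferentiableAt ℝ f (t • q.1, q.2)) :
    HasDerivAt (fun t : ℝ => f (t • q.1, q.2)) (fderiv ℝ f (t • q.1, q.2) (q.1, 0)) t := by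
  have h1 : HasDerivAt (fun t : ℝ => ((t • q.1, q.2) : Cyl)) (q.1, 0) t := by
    have := ((hasDerivAt_id t).smul_const q.1).prodMk (hasDerivAt_const t q.2)
    simpa using this
  exact HasFDerivAt.comp_hasDerivAt (f := fun t : ℝ => ((t • q.1, q.2) : Cyl)) t
    hf.hasFDerivAt h1

theorem radial_mem {r : ℝ} {q : Cyl} (hq : q ∈ cyl r) {t : ℝ} (ht : t ∈ Icc (0 : ℝ) 1) :
    ((t • q.1, q.2) : Cyl) ∈ cyl r := by
  rw [mem_cyl] at hq ⊢
  simp only [norm_smul, Real.norm_eq_abs, abs_of_nonneg ht.1]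
  nlinarith [norm_nonneg q.1, ht.1, ht.2]

theorem fst_eq_sum (z : E2) : ((z, 0) : Cyl) = z 0 • ex + z 1 • ey := by
  have := cyl_eq_sum (z, 0)
  simpa using this

/-- Second-order Taylor expansion of a function with critical points along the axis, with
smooth coefficients. -/
theorem exists_quadratic_form {ψ : Cyl → ℝ} (hψ : ContDiffOn ℝ ∞ ψ (cyl 1))
    (hper : ∀ q : Cyl, ψ (q.1, q.2 + 2 * Real.pi) = ψ q) {c₀ : ℝ} (h0 : ∀ φ, ψ (0, φ) = c₀)
    (hd : ∀ φ, fderiv ℝ ψ (0, φ) = 0) :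
    ∃ a b c : Cyl → ℝ, (ContDiffOn ℝ ∞ a (cyl 1) ∧ ContDiffOn ℝ ∞ b (cyl 1) ∧
      ContDiffOn ℝ ∞ c (cyl 1)) ∧ ((∀ q : Cyl, a (q.1, q.2 + 2 * Real.pi) = a q) ∧
      (∀ q : Cyl, b (q.1, q.2 + 2 * Real.pi) = b q) ∧
      (∀ q : Cyl, c (q.1, q.2 + 2 * Real.pi) = c q)) ∧
      (∀ q ∈ cyl 1, ψ q = c₀ + (a q * (q.1 0) ^ 2 + 2 * b q * (q.1 0 * q.1 1) +
        c q * (q.1 1) ^ 2)) ∧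
      ∀ φ, 2 * a (0, φ) = fderiv ℝ (fderiv ℝ ψ) (0, φ) ex ex ∧
        2 * b (0, φ) = fderiv ℝ (fderiv ℝ ψ) (0, φ) ex ey ∧
        2 * c (0, φ) = fderiv ℝ (fderiv ℝ ψ) (0, φ) ey ey := by
  have hd1 : ContDiffOn ℝ ∞ (fderiv ℝ ψ) (cyl 1) := hψ.fderiv_of_isOpen (isOpen_cyl 1) (by simp)
  have hd2 : ContDiffOn ℝ ∞ (fderiv ℝ (fderiv ℝ ψ)) (cyl 1) :=
    hd1.fderiv_of_isOpen (isOpen_cyl 1) (by simp)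
  have hsymm : ∀ q ∈ cyl 1, ∀ v w, fderiv ℝ (fderiv ℝ ψ) q v w = fderiv ℝ (fderiv ℝ ψ) q w v :=
    fun q hq v w => (((hψ.contDiffAt ((isOpen_cyl 1).mem_nhds hq)).of_le
      (m := 2) (by norm_cast)).isSymmSndFDerivAt (by simp)) v w
  -- Taylor's formula with integral remainder, on the segment from the axis to `q`
  let k : Cyl → Cyl → Cyl → ℝ := fun v w q =>
    ∫ t in (0 : ℝ)..1, (1 - t) * fderiv ℝ (fderiv ℝ ψ) (t • q.1, q.2) v w
  have hk : ∀ v w, ContDiffOn ℝ ∞ (k v w) (cyl 1) := fun v w =>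
    contDiffOn_unit_integral (isOpen_cyl 1)
      (f := fun p : Cyl × ℝ => (1 - p.2) * fderiv ℝ (fderiv ℝ ψ) (p.2 • p.1.1, p.1.2) v w)
      (W := {p | ((p.2 • p.1.1, p.1.2) : Cyl) ∈ cyl 1})
      (ContDiffOn.mul (by fun_prop) (((hd2.comp (f := fun p : Cyl × ℝ =>
        ((p.2 • p.1.1, p.1.2) : Cyl)) (by fun_prop) fun p hp => hp).clm_apply
        contDiffOn_const).clm_apply contDiffOn_const))
      fun q hq t ht => radial_mem hq ht
  have hkp : ∀ v w (q : Cyl), k v w (q.1, q.2 + 2 * Real.pi) = k v w q := fun v w q => by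
    refine intervalIntegral.integral_congr fun t _ => ?_
    simp only
    rw [← periodic_fderiv (periodic_fderiv hper) (t • q.1, q.2)]
  refine ⟨k ex ex, k ex ey, k ey ey, ⟨hk _ _, hk _ _, hk _ _⟩, ⟨hkp _ _, hkp _ _, hkp _ _⟩,
    fun q hq => ?_, fun φ => ?_⟩
  · have hrad : ContinuousOn (fun t : ℝ => ((t • q.1, q.2) : Cyl)) (uIcc 0 1) := by fun_prop
    have hmaps : MapsTo (fun t : ℝ => ((t • q.1, q.2) : Cyl)) (uIcc 0 1) (cyl 1) := by
      rw [uIcc_of_le zero_le_one]; exact fun t ht => radial_mem hq ht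
    have hint : ∀ v w : Cyl, IntervalIntegrable
        (fun t : ℝ => (1 - t) * fderiv ℝ (fderiv ℝ ψ) (t • q.1, q.2) v w)
        MeasureTheory.volume 0 1 := fun v w =>
      ContinuousOn.intervalIntegrable (ContinuousOn.mul (by fun_prop)
        (((hd2.continuousOn.comp hrad hmaps).clm_apply continuousOn_const).clm_apply
          continuousOn_const))
    set u : Cyl := (q.1, 0)
    have hder : ∀ t ∈ uIcc (0 : ℝ) 1, HasDerivAt
        (fun t : ℝ => ψ (t • q.1, q.2) + (1 - t) * fderiv ℝ ψ (t • q.1, q.2) u)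
        ((1 - t) * fderiv ℝ (fderiv ℝ ψ) (t • q.1, q.2) u u) t := by
      intro t ht
      have hm := (isOpen_cyl 1).mem_nhds (hmaps ht)
      have h1 := hasDerivAt_radial (q := q) ((hψ.contDiffAt hm).differentiableAt (by simp))
      have h2 := (hasDerivAt_radial (q := q) ((hd1.contDiffAt hm).differentiableAt
        (by simp))).clm_apply (hasDerivAt_const t u)
      refine (h1.add (((hasDerivAt_id t).const_sub 1).mul h2)).congr_deriv ?_
      simp [u]
    have hmain := intervalIntegral.integral_eq_sub_of_hasDerivAt hder (hint u u)
    have hexp : ∫ t in (0 : ℝ)..1, (1 - t) * fderiv ℝ (fderiv ℝ ψ) (t • q.1, q.2) u u =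
        ∫ t in (0 : ℝ)..1, ((q.1 0) ^ 2 * ((1 - t) * fderiv ℝ (fderiv ℝ ψ) (t • q.1, q.2) ex ex) +
          2 * (q.1 0 * q.1 1) * ((1 - t) * fderiv ℝ (fderiv ℝ ψ) (t • q.1, q.2) ex ey) +
          (q.1 1) ^ 2 * ((1 - t) * fderiv ℝ (fderiv ℝ ψ) (t • q.1, q.2) ey ey)) := by
      refine intervalIntegral.integral_congr fun t ht => ?_
      simp only [u, fst_eq_sum, map_add, map_smul, add_apply,
        smul_apply, smul_eq_mul]
      rw [hsymm _ (hmaps ht) ey ex]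
      ring
    rw [hexp, intervalIntegral.integral_add (((hint _ _).const_mul _).add
      ((hint _ _).const_mul _)) ((hint _ _).const_mul _),
      intervalIntegral.integral_add ((hint _ _).const_mul _) ((hint _ _).const_mul _)] at hmain
    simp only [intervalIntegral.integral_const_mul] at hmain
    simp [h0, hd] at hmain
    simp only [k]
    linarith
  · have hI : ∫ t in (0 : ℝ)..1, (1 - t) = 1 / 2 := by
      rw [intervalIntegral.integral_sub (by simp) (by simp)]
      simp; norm_num
    have : ∀ v w : Cyl, 2 * k v w (0, φ) = fderiv ℝ (fderiv ℝ ψ) (0, φ) v w := fun v w => by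
      simp only [k, smul_zero]
      rw [intervalIntegral.integral_mul_const, hI]
      ring
    exact ⟨this _ _, this _ _, this _ _⟩

/-- Hadamard's lemma in the variable `x`. -/
theorem exists_eq_x_mul {f : Cyl → ℝ} (hf : ContDiffOn ℝ ∞ f (cyl 1))
    (hper : ∀ q : Cyl, f (q.1, q.2 + 2 * Real.pi) = f q)
    (h0 : ∀ q ∈ cyl 1, q.1 0 = 0 → f q = 0) :
    ∃ b : Cyl → ℝ, ContDiffOn ℝ ∞ b (cyl 1) ∧ (∀ q : Cyl, b (q.1, q.2 + 2 * Real.pi) = b q) ∧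
      ∀ q ∈ cyl 1, f q = q.1 0 * b q := by
  have hd1 : ContDiffOn ℝ ∞ (fderiv ℝ f) (cyl 1) := hf.fderiv_of_isOpen (isOpen_cyl 1) (by simp)
  -- the homotopy which contracts the cylinder to the plane `x = 0`
  let H : Cyl → ℝ → Cyl := fun q t => q - ((1 - t) * q.1 0) • ex
  have h00 : ∀ q t, (H q t).1 0 = t * q.1 0 := fun q t => by simp [H, ex]; ring
  have h01 : ∀ q t, (H q t).1 1 = q.1 1 := fun q t => by simp [H, ex]
  have hx0 : ContDiff ℝ ∞ fun q : Cyl => q.1 0 :=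
    (contDiff_piLp_apply (p := 2) (i := (0 : Fin 2))).comp contDiff_fst
  have hHs : ContDiff ℝ ∞ fun p : Cyl × ℝ => H p.1 p.2 :=
    contDiff_fst.sub (((contDiff_const.sub contDiff_snd).mul (hx0.comp contDiff_fst)).smul
      contDiff_const)
  have hHm : ∀ q ∈ cyl 1, ∀ t ∈ Icc (0 : ℝ) 1, H q t ∈ cyl 1 := by
    intro q hq t ht
    rw [mem_cyl] at hq ⊢
    refine lt_of_le_of_lt ?_ hq
    refine (sq_le_sq₀ (norm_nonneg _) (norm_nonneg _)).1 ?_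
    rw [norm_sq_eq, norm_sq_eq, h00, h01, mul_pow]
    have : t ^ 2 ≤ 1 := by nlinarith [ht.1, ht.2]
    nlinarith [sq_nonneg (q.1 0)]
  have hsm : ContDiffOn ℝ ∞ (fun p : Cyl × ℝ => fderiv ℝ f (H p.1 p.2) ex)
      {p | H p.1 p.2 ∈ cyl 1} :=
    (hd1.comp hHs.contDiffOn fun p hp => hp).clm_apply contDiffOn_const
  refine ⟨fun q => ∫ t in (0 : ℝ)..1, fderiv ℝ f (H q t) ex,
    contDiffOn_unit_integral (isOpen_cyl 1) hsm hHm, fun q => ?_, fun q hq => ?_⟩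
  · refine intervalIntegral.integral_congr fun t _ => ?_
    rw [← periodic_fderiv hper (H q t)]
    congr 2
    refine Prod.ext (by simp [H]) (by simp [H, ex])
  · have hder : ∀ t ∈ uIcc (0 : ℝ) 1, HasDerivAt (fun t => f (H q t))
        (q.1 0 * fderiv ℝ f (H q t) ex) t := by
      intro t ht
      rw [uIcc_of_le zero_le_one] at ht
      have h1 := ((hf.contDiffAt ((isOpen_cyl 1).mem_nhds (hHm q hq t ht))).differentiableAt
        (by simp)).hasFDerivAt
      have h2 : HasDerivAt (H q) ((q.1 0) • ex) t := by
        have := ((((hasDerivAt_id t).const_sub 1).mul_const (q.1 0)).smul_const ex).const_sub q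
        simpa [H] using this
      refine (h1.comp_hasDerivAt t h2).congr_deriv ?_
      simp
    have hc : ContinuousOn (fun t => q.1 0 * fderiv ℝ f (H q t) ex) (uIcc 0 1) := by
      rw [uIcc_of_le zero_le_one]
      exact continuousOn_const.mul (hsm.continuousOn.comp
        (f := fun t : ℝ => (q, t)) (by fun_prop) fun t ht => hHm q hq t ht)
    have := intervalIntegral.integral_eq_sub_of_hasDerivAt hder hc.intervalIntegrable
    rw [intervalIntegral.integral_const_mul] at this
    rw [this, h0 (H q 0) (hHm q hq 0 (by simp)) (by rw [h00]; simp)]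
    simp [H]

/-! ### Quadratic forms along the axis -/

/-- A periodic continuous function which is positive on the axis is positive near the axis. -/
theorem exists_pos_on_cyl {h : Cyl → ℝ} (hc : ContinuousOn h (cyl 1))
    (hper : ∀ q : Cyl, h (q.1, q.2 + 2 * Real.pi) = h q) (h0 : ∀ φ, 0 < h (0, φ)) :
    ∃ δ, 0 < δ ∧ δ ≤ 1 ∧ ∀ q ∈ cyl δ, 0 < h q := by
  have hop : IsOpen (cyl 1 ∩ h ⁻¹' Ioi 0) := hc.isOpen_inter_preimage (isOpen_cyl 1) isOpen_Ioi
  -- by periodicity it suffices to treat the compact set of `φ ∈ [0, 2π]`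
  obtain ⟨u, v, hu, hv, h0u, hKv, huv⟩ := generalized_tube_lemma (s := {(0 : E2)})
    isCompact_singleton (t := Icc 0 (2 * Real.pi)) isCompact_Icc hop (by
      rintro ⟨z, φ⟩ ⟨hz, -⟩
      rw [mem_singleton_iff] at hz
      simp only at hz
      subst hz
      exact ⟨by simp [mem_cyl], h0 φ⟩)
  obtain ⟨δ, hδ, hδu⟩ := Metric.isOpen_iff.1 hu 0 (h0u rfl)
  refine ⟨min δ 1, lt_min hδ one_pos, min_le_right _ _, fun q hq => ?_⟩
  have hper' : ∀ z, Function.Periodic (fun φ => h (z, φ)) (2 * Real.pi) := fun z φ => hper (z, φ)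
  obtain ⟨φ, hφ, he⟩ := (hper' q.1).exists_mem_Ico₀ Real.two_pi_pos q.2
  have hq' := mem_cyl.1 hq
  have : ((q.1, φ) : Cyl) ∈ cyl 1 ∩ h ⁻¹' Ioi 0 :=
    huv ⟨hδu (by simpa using hq'.trans_le (min_le_left _ _)), hKv (Ico_subset_Icc_self hφ)⟩
  have h2 : 0 < h (q.1, φ) := this.2
  rwa [← he] at h2

/-- An indefinite quadratic form in two variables has a nonzero isotropic vector `e`, which is not in the
radical: it pairs nontrivially with some `f`. -/
theorem exists_isotropic {a b c : ℝ} (h : a * c - b ^ 2 < 0) :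
    ∃ e0 e1 f0 f1 : ℝ, a * e0 ^ 2 + 2 * b * (e0 * e1) + c * e1 ^ 2 = 0 ∧
      a * e0 * f0 + b * (e0 * f1 + e1 * f0) + c * e1 * f1 ≠ 0 := by
  by_cases ha : a = 0
  · refine ⟨1, 0, 0, 1, by simp [ha], ?_⟩
    rintro h0
    have : b = 0 := by linarith
    simp [ha, this] at h
  · have hD : 0 < b ^ 2 - a * c := by linarith
    have hs := Real.sq_sqrt hD.le
    have hs0 := Real.sqrt_pos.2 hD
    refine ⟨-b + √(b ^ 2 - a * c), a, 1, 0, ?_, ?_⟩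
    · linear_combination a * hs
    · intro h0
      have : a * √(b ^ 2 - a * c) = 0 := by linarith
      rcases mul_eq_zero.1 this with h1 | h1
      · exact ha h1
      · exact hs0.ne' h1

/-- If a quadratic form whose coefficients `a`, `b`, `c` depend smoothly on the point is indefinite at
the origin, its zero set contains a curve issuing from the origin. -/
theorem exists_null_curve {a b c : E2 → ℝ} (ha : ContDiffOn ℝ ∞ a (Metric.ball 0 1))
    (hb : ContDiffOn ℝ ∞ b (Metric.ball 0 1)) (hc : ContDiffOn ℝ ∞ c (Metric.ball 0 1))
    (h : a 0 * c 0 - b 0 ^ 2 < 0) :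
    ∃ σ : ℝ → E2, ∃ r > 0, ContinuousOn σ (Icc 0 r) ∧ σ 0 = 0 ∧ ∀ t ∈ Ioc 0 r, σ t ≠ 0 ∧ ‖σ t‖ < 1 ∧
      a (σ t) * (σ t 0) ^ 2 + 2 * b (σ t) * (σ t 0 * σ t 1) + c (σ t) * (σ t 1) ^ 2 = 0 := by
  obtain ⟨e0, e1, f0, f1, he, hf⟩ := exists_isotropic h
  have hdet : e0 * f1 - e1 * f0 ≠ 0 := by
    intro h0
    have key : ∀ x y : ℝ, (a 0 * e0 * f0 + b 0 * (e0 * f1 + e1 * f0) + c 0 * e1 * f1) * x =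
        y * (a 0 * e0 ^ 2 + 2 * b 0 * (e0 * e1) + c 0 * e1 ^ 2) → x = 0 := fun x y hxy => by
      rw [he, mul_zero] at hxy
      exact (mul_eq_zero.1 hxy).resolve_left hf
    have h1 := key e0 f0 (by linear_combination (b 0 * e0 + c 0 * e1) * h0)
    have h2 := key e1 f1 (by linear_combination (-(a 0) * e0 - b 0 * e1) * h0)
    simp [h1, h2] at hf
  -- Look for the curve in the form `t (e + m f)`; after division by `t²` the equation becomes
  -- `Q(t, m) = 0`, where `Q(0, 0) = 0` since `e` is isotropic, and `∂Q/∂m ≠ 0` since `e` and `f` pair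
  -- nontrivially. The implicit function theorem gives `m` as a function of `t`.
  let e : E2 := !₂[e0, e1]
  let f : E2 := !₂[f0, f1]
  let z : ℝ × ℝ → E2 := fun p => p.1 • (e + p.2 • f)
  let Q : ℝ × ℝ → ℝ := fun p => a (z p) * (e0 + p.2 * f0) ^ 2 +
    2 * b (z p) * ((e0 + p.2 * f0) * (e1 + p.2 * f1)) + c (z p) * (e1 + p.2 * f1) ^ 2
  have hz : ContDiff ℝ ∞ z := by fun_prop
  have hz0 : z (0, 0) = 0 := by simp [z]
  have hat : ∀ {g : E2 → ℝ}, ContDiffOn ℝ ∞ g (Metric.ball 0 1) →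
      ContDiffAt ℝ ∞ (fun p => g (z p)) (0, 0) := fun {g} hg => by
    have h1 : ContDiffAt ℝ ∞ g (z (0, 0)) := by
      rw [hz0]; exact hg.contDiffAt (Metric.ball_mem_nhds _ one_pos)
    exact h1.comp _ hz.contDiffAt
  have hQ : ContDiffAt ℝ ∞ Q (0, 0) := by
    refine ((hat ha).mul (by fun_prop)).add (?_ : ContDiffAt ℝ ∞ _ _) |>.add
      ((hat hc).mul (by fun_prop))
    exact (contDiffAt_const.mul (hat hb)).mul (by fun_prop)
  have hQ0 : Q (0, 0) = 0 := by simpa [Q, hz0] using he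
  have hdQ : fderiv ℝ Q (0, 0) (0, 1) =
      2 * (a 0 * e0 * f0 + b 0 * (e0 * f1 + e1 * f0) + c 0 * e1 * f1) := by
    have h1 : HasDerivAt (fun m : ℝ => Q (0, m)) (fderiv ℝ Q (0, 0) (0, 1)) 0 :=
      HasFDerivAt.comp_hasDerivAt (f := fun m : ℝ => ((0, m) : ℝ × ℝ)) 0
        (hQ.differentiableAt (by simp)).hasFDerivAt
        ((hasDerivAt_const _ _).prodMk (hasDerivAt_id _))
    have h2 : (fun m : ℝ => Q (0, m)) = fun m => a 0 * (e0 + m * f0) ^ 2 +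
        2 * b 0 * ((e0 + m * f0) * (e1 + m * f1)) + c 0 * (e1 + m * f1) ^ 2 := by
      funext m; simp [Q, z]
    have hl : ∀ u v : ℝ, HasDerivAt (fun m : ℝ => u + m * v) v 0 := fun u v => by
      simpa using ((hasDerivAt_id (0 : ℝ)).mul_const v).const_add u
    have h3 := ((((hl e0 f0).fun_pow 2).const_mul (a 0)).add
      (((hl e0 f0).mul (hl e1 f1)).const_mul (2 * b 0))).add (((hl e1 f1).fun_pow 2).const_mul (c 0))
    rw [h2] at h1
    rw [h1.unique h3]
    simp; ring
  have hinv : (fderiv ℝ Q (0, 0) ∘L .inr ℝ ℝ ℝ).IsInvertible := by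
    have hne : fderiv ℝ Q (0, 0) (0, 1) ≠ 0 := by rw [hdQ]; exact mul_ne_zero two_ne_zero hf
    refine ⟨ContinuousLinearEquiv.smulLeft (Units.mk0 _ hne), ?_⟩
    ext
    simp [ContinuousLinearEquiv.smulLeft]
  let m := hQ.implicitFunction (by simp) hinv
  have hm0 : m 0 = 0 := hQ.implicitFunction_apply_self (by simp) hinv
  have hmQ : ∀ᶠ x in 𝓝 (0 : ℝ), Q (x, m x) = 0 := by
    have := hQ.eventually_apply_implicitFunction (by simp) hinv
    rwa [hQ0] at this
  have hms : ∀ᶠ x in 𝓝 (0 : ℝ), ContinuousAt m x := by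
    have h1 : ContDiffAt ℝ 1 m 0 :=
      (hQ.contDiffAt_implicitFunction (by simp) hinv).of_le (by norm_cast)
    filter_upwards [h1.eventually (by simp)] with x hx using hx.continuousAt
  have hσc : ContinuousAt (fun x => z (x, m x)) 0 :=
    hz.continuous.continuousAt.comp (continuousAt_id.prodMk hms.self_of_nhds)
  have hσ1 : ∀ᶠ x in 𝓝 (0 : ℝ), ‖z (x, m x)‖ < 1 := by
    have := hσc.norm.eventually_lt (continuousAt_const (y := (1 : ℝ))) (by simp [hm0, hz0])
    exact this
  obtain ⟨r, hr, hball⟩ := Metric.eventually_nhds_iff_ball.1 (hmQ.and (hms.and hσ1))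
  have hmem : ∀ t ∈ Icc 0 (r / 2), t ∈ Metric.ball (0 : ℝ) r := fun t ht => by
    rw [Metric.mem_ball, dist_zero_right, Real.norm_eq_abs, abs_of_nonneg ht.1]
    linarith [ht.2]
  refine ⟨fun x => z (x, m x), r / 2, half_pos hr, ?_, by simp [hm0, hz0], ?_⟩
  · intro t ht
    have hmt := (hball t (hmem t ht)).2.1
    exact (hz.continuous.continuousAt.comp (continuousAt_id.prodMk hmt)).continuousWithinAt
  · intro t ht
    obtain ⟨h1, -, h3⟩ := hball t (hmem t (Ioc_subset_Icc_self ht))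
    have hz0' : z (t, m t) 0 = t * (e0 + m t * f0) := by simp [z, e, f]; ring
    have hz1' : z (t, m t) 1 = t * (e1 + m t * f1) := by simp [z, e, f]; ring
    refine ⟨fun h0 => hdet ?_, h3, ?_⟩
    · have ht0 := ht.1.ne'
      have h4 : e0 + m t * f0 = 0 := by
        have := hz0' ▸ congrArg (fun w : E2 => w 0) h0
        simpa [ht0] using this
      have h5 : e1 + m t * f1 = 0 := by
        have := hz1' ▸ congrArg (fun w : E2 => w 1) h0
        simpa [ht0] using this
      linear_combination f1 * h4 - f0 * h5
    · rw [hz0', hz1']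
      simp only [Q] at h1
      linear_combination t ^ 2 * h1

/-- The linear change of coordinates `(k₁₁ x + k₁₂ y, k₂₁ x + k₂₂ y)`
with variable coefficients. -/
def linMap (k11 k12 k21 k22 : Cyl → ℝ) (q : Cyl) : E2 :=
  !₂[k11 q * q.1 0 + k12 q * q.1 1, k21 q * q.1 0 + k22 q * q.1 1]

/-- A positive definite form is a sum of two squares, with smooth dependence on parameters. -/
theorem exists_diagonalization {a b c : Cyl → ℝ} (ha : ContDiffOn ℝ ∞ a (cyl 1))
    (hb : ContDiffOn ℝ ∞ b (cyl 1)) (hc : ContDiffOn ℝ ∞ c (cyl 1))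
    (hap : ∀ q : Cyl, a (q.1, q.2 + 2 * Real.pi) = a q)
    (hbp : ∀ q : Cyl, b (q.1, q.2 + 2 * Real.pi) = b q)
    (hcp : ∀ q : Cyl, c (q.1, q.2 + 2 * Real.pi) = c q)
    (h1 : ∀ φ, 0 < a (0, φ)) (h2 : ∀ φ, 0 < a (0, φ) * c (0, φ) - b (0, φ) ^ 2) :
    ∃ k11 k12 k21 k22 : Cyl → ℝ, ∃ δ, 0 < δ ∧ δ ≤ 1 ∧
      (ContDiffOn ℝ ∞ k11 (cyl δ) ∧ ContDiffOn ℝ ∞ k12 (cyl δ) ∧ ContDiffOn ℝ ∞ k21 (cyl δ) ∧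
        ContDiffOn ℝ ∞ k22 (cyl δ)) ∧
      ((∀ q : Cyl, k11 (q.1, q.2 + 2 * Real.pi) = k11 q) ∧
        (∀ q : Cyl, k12 (q.1, q.2 + 2 * Real.pi) = k12 q) ∧
        (∀ q : Cyl, k21 (q.1, q.2 + 2 * Real.pi) = k21 q) ∧
        (∀ q : Cyl, k22 (q.1, q.2 + 2 * Real.pi) = k22 q)) ∧
      (∀ φ, k11 (0, φ) * k22 (0, φ) - k12 (0, φ) * k21 (0, φ) ≠ 0) ∧
      ∀ q ∈ cyl δ, a q * (q.1 0) ^ 2 + 2 * b q * (q.1 0 * q.1 1) + c q * (q.1 1) ^ 2 =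
        ‖linMap k11 k12 k21 k22 q‖ ^ 2 := by
  obtain ⟨δ₁, hδ₁, hδ₁1, hpos₁⟩ := exists_pos_on_cyl ha.continuousOn hap h1
  obtain ⟨δ₂, hδ₂, hδ₂1, hpos₂⟩ := exists_pos_on_cyl (h := fun q => a q * c q - b q ^ 2)
    ((ha.mul hc).sub (hb.pow 2)).continuousOn (fun q => by simp only [hap, hbp, hcp]) h2
  set δ := min δ₁ δ₂
  have hsub : ∀ {ε}, δ ≤ ε → cyl δ ⊆ cyl ε := fun h => prod_mono (Metric.ball_subset_ball h) le_rfl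
  have hp1 : ∀ q ∈ cyl δ, 0 < a q := fun q hq => hpos₁ q (hsub (min_le_left _ _) hq)
  have hp2 : ∀ q ∈ cyl δ, 0 < (a q * c q - b q ^ 2) / a q := fun q hq =>
    div_pos (hpos₂ q (hsub (min_le_right _ _) hq)) (hp1 q hq)
  have hδ1 : cyl δ ⊆ cyl 1 := hsub ((min_le_left _ _).trans hδ₁1)
  have ha' := ha.mono hδ1
  have hb' := hb.mono hδ1
  have hc' := hc.mono hδ1
  have hne : ∀ q ∈ cyl δ, a q ≠ 0 := fun q hq => (hp1 q hq).ne'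
  -- completion of the square: `a (x + (b / a) y)² + ((a c - b²) / a) y²`
  refine ⟨fun q => √(a q), fun q => √(a q) * (b q / a q), fun _ => 0,
    fun q => √((a q * c q - b q ^ 2) / a q), δ, lt_min hδ₁ hδ₂, (min_le_left _ _).trans hδ₁1,
    ⟨ha'.sqrt hne, (ha'.sqrt hne).mul (hb'.div ha' hne), contDiffOn_const,
      (((ha'.mul hc').sub (hb'.pow 2)).div ha' hne).sqrt fun q hq => (hp2 q hq).ne'⟩,
    ⟨fun q => by simp only [hap], fun q => by simp only [hap, hbp], fun q => rfl,
      fun q => by simp only [hap, hbp, hcp]⟩, fun φ => ?_, fun q hq => ?_⟩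
  · have := Real.sqrt_pos.2 (h1 φ)
    have := Real.sqrt_pos.2 (div_pos (h2 φ) (h1 φ))
    rw [mul_zero, sub_zero]
    positivity
  · have e1 := Real.sq_sqrt (hp1 q hq).le
    have e2 := Real.sq_sqrt (hp2 q hq).le
    have := hne q hq
    rw [norm_sq_eq]
    simp only [linMap, PiLp.toLp_apply, Matrix.cons_val_zero, Matrix.cons_val_one]
    have : (√(a q) * q.1 0 + √(a q) * (b q / a q) * q.1 1) ^ 2 +
        (0 * q.1 0 + √((a q * c q - b q ^ 2) / a q) * q.1 1) ^ 2 =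
        √(a q) ^ 2 * (q.1 0 + b q / a q * q.1 1) ^ 2 +
        √((a q * c q - b q ^ 2) / a q) ^ 2 * q.1 1 ^ 2 := by ring
    rw [this, e1, e2]
    field_simp
    ring

/-! ### Local diffeomorphisms and tubular coordinates -/

/-- The covering `(x, y, φ) ↦ (x, y, e^{iφ})`. -/
def pexp (q : Cyl) : E2 × Circle := (q.1, Circle.exp q.2)

theorem contMDiff_pexp : ContMDiff 𝓘(ℝ, Cyl) ((𝓡 2).prod (𝓡 1)) ∞ pexp :=
  contDiff_fst.contMDiff.prodMk (contMDiff_circleExp.comp contDiff_snd.contMDiff)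

/-- The branch of the angle `φ` near `φ₀`, as a function on the plane. -/
def angleNear (φ₀ : ℝ) (w : ℂ) : ℝ := φ₀ + (Complex.log (w / Circle.exp φ₀)).im

/-- The branch of the angle is smooth away from the ray opposite to `e^{iφ₀}`. -/
theorem contDiffAt_angleNear {φ₀ : ℝ} {w : ℂ} (hw : w / Circle.exp φ₀ ∈ Complex.slitPlane) :
    ContDiffAt ℝ ∞ (angleNear φ₀) w := by
  have h1 : ContDiffAt ℝ ∞ (fun w : ℂ => w / Circle.exp φ₀) w := contDiffAt_id.div_const _
  have h2 : ContDiffAt ℝ ∞ Complex.log (w / Circle.exp φ₀) :=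
    (Complex.contDiffAt_log hw).restrict_scalars ℝ
  have h3 : ContDiffAt ℝ ∞ (fun w : ℂ => (Complex.log (w / Circle.exp φ₀)).im) w :=
    ContDiffAt.comp (g := Complex.imCLM) w Complex.imCLM.contDiff.contDiffAt
      (ContDiffAt.comp (g := Complex.log) w h2 h1)
  exact contDiffAt_const.add h3

theorem exp_angleNear (φ₀ : ℝ) (u : Circle) : Circle.exp (angleNear φ₀ u) = u := by
  rw [angleNear, Circle.exp_add, ← Circle.coe_div, Complex.log_im, Circle.exp_arg]
  simp

theorem exp_div_exp_mem {φ φ₀ : ℝ} (h : φ ∈ Ioo (φ₀ - Real.pi) (φ₀ + Real.pi)) :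
    ((Circle.exp φ : Circle) : ℂ) / Circle.exp φ₀ ∈ Complex.slitPlane := by
  rw [← Circle.coe_div, ← Circle.exp_sub, Complex.mem_slitPlane_iff_arg,
    Circle.arg_exp (by linarith [h.1]) (by linarith [h.2])]
  exact ⟨by linarith [h.2], by simp⟩

theorem angleNear_exp {φ φ₀ : ℝ} (h : φ ∈ Ioo (φ₀ - Real.pi) (φ₀ + Real.pi)) :
    angleNear φ₀ (Circle.exp φ) = φ := by
  rw [angleNear, ← Circle.coe_div, ← Circle.exp_sub, Complex.log_im,
    Circle.arg_exp (by linarith [h.1]) (by linarith [h.2])]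
  ring

/-- The local inverses of the covering are given by the branches of the angle. -/
theorem isLocalDiffeomorphAt_pexp (q : Cyl) :
    IsLocalDiffeomorphAt 𝓘(ℝ, Cyl) ((𝓡 2).prod (𝓡 1)) ∞ pexp q := by
  have hcont : Continuous fun w : E2 × Circle => (w.2 : ℂ) / Circle.exp q.2 := by fun_prop
  have hV : IsOpen {w : E2 × Circle | (w.2 : ℂ) / Circle.exp q.2 ∈ Complex.slitPlane} :=
    Complex.isOpen_slitPlane.preimage hcont
  refine ⟨{
    toFun := pexp
    invFun := fun w => (w.1, angleNear q.2 w.2)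
    source := univ ×ˢ Ioo (q.2 - Real.pi) (q.2 + Real.pi)
    target := {w | (w.2 : ℂ) / Circle.exp q.2 ∈ Complex.slitPlane}
    map_source' := fun p hp => exp_div_exp_mem hp.2
    map_target' := fun w hw => ⟨mem_univ _, ?_⟩
    left_inv' := fun p hp => Prod.ext rfl (angleNear_exp hp.2)
    right_inv' := fun w _ => Prod.ext rfl (exp_angleNear _ _)
    open_source := isOpen_univ.prod isOpen_Ioo
    open_target := hV
    contMDiffOn_toFun := contMDiff_pexp.contMDiffOn
    contMDiffOn_invFun := fun w hw => ContMDiffAt.contMDiffWithinAt ?_ }, ?_, fun p _ => rfl⟩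
  · rw [mem_ofPred_eq, ← Circle.coe_div, Complex.mem_slitPlane_iff_arg] at hw
    have h1 := Complex.neg_pi_lt_arg ((w.2 / Circle.exp q.2 : Circle) : ℂ)
    have h2 := lt_of_le_of_ne (Complex.arg_le_pi ((w.2 / Circle.exp q.2 : Circle) : ℂ)) hw.1
    rw [angleNear, ← Circle.coe_div, Complex.log_im]
    exact ⟨by linarith, by linarith⟩
  · have : Fact (Module.finrank ℝ ℂ = 1 + 1) := finrank_real_complex_fact'
    have h1 : ContMDiffAt ((𝓡 2).prod (𝓡 1)) 𝓘(ℝ, ℂ) ∞ (fun w : E2 × Circle => (w.2 : ℂ)) w :=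
      (contMDiff_coe_sphere.comp contMDiff_snd).contMDiffAt
    have h2 : ContMDiffAt ((𝓡 2).prod (𝓡 1)) 𝓘(ℝ, ℝ) ∞
        (fun w : E2 × Circle => angleNear q.2 w.2) w :=
      ContMDiffAt.comp (g := angleNear q.2) w (contDiffAt_angleNear hw).contMDiffAt h1
    exact contMDiffAt_fst.prodMk_space h2
  · exact ⟨mem_univ _, by constructor <;> linarith [Real.pi_pos]⟩

section

variable {M : Type*} [TopologicalSpace M] [ChartedSpace (EuclideanHalfSpace 3) M]

theorem isOpen_setOf_isLocalDiffeomorphAt {E F H H' N : Type*} [NormedAddCommGroup E]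
    [NormedSpace ℝ E] [NormedAddCommGroup F] [NormedSpace ℝ F] [TopologicalSpace H]
    [TopologicalSpace H'] {I : ModelWithCorners ℝ E H} {I' : ModelWithCorners ℝ F H'}
    {M : Type*} [TopologicalSpace M] [ChartedSpace H M] [TopologicalSpace N] [ChartedSpace H' N]
    (f : M → N) : IsOpen {p | IsLocalDiffeomorphAt I I' ∞ f p} := by
  rw [isOpen_iff_mem_nhds]
  rintro p ⟨Φ, hp, he⟩
  exact Filter.mem_of_superset (Φ.open_source.mem_nhds hp) fun q hq => ⟨Φ, hq, he⟩

/-- A map which is a local diffeomorphism along `γ` and maps `γ` bijectively to the central circle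
defines tubular coordinates, up to a rescaling of the disk. -/
theorem exists_isTubularDiffeo {γ U : Set M} (hγ : IsCompact γ) (hU : IsOpen U) (hγU : γ ⊆ U)
    {Ξ : M → E2 × Circle}
    (hloc : ∀ p ∈ γ, IsLocalDiffeomorphAt (𝓡∂ 3) ((𝓡 2).prod (𝓡 1)) ∞ Ξ p)
    (hinj : InjOn Ξ γ) (himg : Ξ '' γ = {0} ×ˢ univ) :
    ∃ ε : ℝ, 0 < ε ∧ ε ≤ 1 ∧ ∃ Φ : OpenPartialHomeomorph M (EuclideanSpace ℝ (Fin 2) × Circle),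
      IsTubularDiffeo γ Φ ∧ Φ.source ⊆ U ∧
      ∀ p ∈ Φ.source, Ξ p = (ε • (Φ p).1, (Φ p).2) := by
  -- `Ξ` is injective near the compact set `γ`, being injective on it and locally injective
  obtain ⟨t, ht, htinj⟩ := hinj.exists_mem_nhdsSet hγ
    (fun p hp => (hloc p hp).contMDiffAt.continuousAt) fun p hp => by
      obtain ⟨Φ, hpΦ, he⟩ := hloc p hp
      refine ⟨Φ.source, Φ.open_source.mem_nhds hpΦ, fun x hx y hy hxy => ?_⟩
      rw [he hx, he hy] at hxy
      exact Φ.toPartialEquiv.injOn hx hy hxy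
  rw [mem_nhdsSet_iff_exists] at ht
  obtain ⟨t', ht'o, hγt', ht't⟩ := ht
  set O := t' ∩ U ∩ {p | IsLocalDiffeomorphAt (𝓡∂ 3) ((𝓡 2).prod (𝓡 1)) ∞ Ξ p}
  have hO : IsOpen O := (ht'o.inter hU).inter (isOpen_setOf_isLocalDiffeomorphAt Ξ)
  have hγO : γ ⊆ O := fun p hp => ⟨⟨hγt' hp, hγU hp⟩, hloc p hp⟩
  have hOinj : InjOn Ξ O := htinj.mono fun p hp => ht't hp.1.1
  -- the image of a neighbourhood of `γ` is open, hence contains a thin solid torus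
  have hOimg : IsOpen (Ξ '' O) := by
    rw [isOpen_iff_mem_nhds]
    rintro _ ⟨p, hp, rfl⟩
    have hl := hp.2
    have h1 : Filter.Tendsto hl.localInverse (𝓝 (Ξ p)) (𝓝 p) := by
      have := hl.localInverse_contMDiffAt.continuousAt.tendsto
      rwa [hl.localInverse_left_inv hl.localInverse_mem_target] at this
    filter_upwards [h1 (hO.mem_nhds hp), hl.localInverse_open_source.mem_nhds
      hl.localInverse_mem_source] with y hy hy'
    exact ⟨_, hy, hl.localInverse_right_inv hy'⟩
  obtain ⟨u, v, hu, -, h0u, hv, huv⟩ := generalized_tube_lemma (s := {(0 : E2)})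
    isCompact_singleton (t := (univ : Set Circle)) isCompact_univ hOimg
    (himg ▸ image_mono hγO)
  obtain ⟨ε', hε', hεu⟩ := Metric.isOpen_iff.1 hu 0 (h0u rfl)
  set ε := min ε' 1
  have hε : 0 < ε := lt_min hε' one_pos
  have hsub : ∀ w : E2 × Circle, ‖w.1‖ < ε → w ∈ Ξ '' O := fun w hw =>
    huv ⟨hεu (by simpa using hw.trans_le (min_le_left _ _)), hv (mem_univ _)⟩
  -- the preimage of this solid torus is the tubular neighbourhood
  set S := O ∩ {p | ‖(Ξ p).1‖ < ε}
  have hcO : ContinuousOn Ξ O := fun p hp => hp.2.contMDiffAt.continuousAt.continuousWithinAt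
  have hS : IsOpen S := hcO.isOpen_inter_preimage hO
    (isOpen_Iio.preimage (f := fun w : E2 × Circle => ‖w.1‖) (by fun_prop) :
      IsOpen {w : E2 × Circle | ‖w.1‖ < ε})
  have hSinj : InjOn Ξ S := hOinj.mono inter_subset_left
  let sc : E2 × Circle → E2 × Circle := fun w => (ε • w.1, w.2)
  have hsc : ContMDiff ((𝓡 2).prod (𝓡 1)) ((𝓡 2).prod (𝓡 1)) ∞ sc :=
    ((contDiff_const_smul ε).contMDiff.comp contMDiff_fst).prodMk contMDiff_snd
  have hscimg : ∀ w : E2 × Circle, ‖w.1‖ < 1 → sc w ∈ Ξ '' S := by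
    intro w hw
    have h1 : ‖(sc w).1‖ < ε := by
      simp only [sc, norm_smul, Real.norm_eq_abs, abs_of_pos hε]
      nlinarith
    obtain ⟨p, hp, he⟩ := hsub _ h1
    exact ⟨p, ⟨hp, by simpa only [mem_ofPred_eq, he] using h1⟩, he⟩
  have : Nonempty M := by
    obtain ⟨p, -, -⟩ := himg.symm ▸ (show ((0 : E2), (1 : Circle)) ∈ {(0 : E2)} ×ˢ univ from
      ⟨rfl, mem_univ _⟩)
    exact ⟨p⟩
  -- the inverse is chosen pointwise; near each point it agrees with a smooth local inverse
  choose! inv hinvS hinv using hscimg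
  have hscS : ∀ p ∈ S, sc (ε⁻¹ • (Ξ p).1, (Ξ p).2) = Ξ p := fun p _ => by
    simp [sc, smul_smul, hε.ne']
  have hnorm : ∀ p ∈ S, ‖ε⁻¹ • (Ξ p).1‖ < 1 := fun p hp => by
    rw [norm_smul, norm_inv, Real.norm_eq_abs, abs_of_pos hε, inv_mul_lt_iff₀ hε, mul_one]
    exact hp.2
  have hsm : ∀ p ∈ S, ContMDiffAt (𝓡∂ 3) ((𝓡 2).prod (𝓡 1)) ∞
      (fun p => (ε⁻¹ • (Ξ p).1, (Ξ p).2)) p := fun p hp => by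
    have h1 : ContMDiff ((𝓡 2).prod (𝓡 1)) ((𝓡 2).prod (𝓡 1)) ∞
        (fun w : E2 × Circle => (ε⁻¹ • w.1, w.2)) :=
      ((contDiff_const_smul ε⁻¹).contMDiff.comp contMDiff_fst).prodMk contMDiff_snd
    exact h1.contMDiffAt.comp p hp.1.2.contMDiffAt
  have hsminv : ∀ w : E2 × Circle, ‖w.1‖ < 1 →
      ContMDiffAt ((𝓡 2).prod (𝓡 1)) (𝓡∂ 3) ∞ inv w := by
    intro w hw
    have hl := (hinvS w hw).1.2
    have e1 : Ξ (inv w) = sc w := hinv w hw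
    have h1 := hl.localInverse_contMDiffAt
    have h2 : hl.localInverse (Ξ (inv w)) = inv w :=
      hl.localInverse_left_inv hl.localInverse_mem_target
    have h3 : hl.localInverse.source ∈ 𝓝 (Ξ (inv w)) :=
      hl.localInverse_open_source.mem_nhds hl.localInverse_mem_source
    have h4 : Filter.Tendsto hl.localInverse (𝓝 (Ξ (inv w))) (𝓝 (inv w)) := by
      have := h1.continuousAt.tendsto
      rwa [h2] at this
    rw [e1] at h1 h3 h4
    refine (h1.comp w hsc.contMDiffAt).congr_of_eventuallyEq ?_
    have hsct : Filter.Tendsto sc (𝓝 w) (𝓝 (sc w)) := hsc.continuous.continuousAt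
    have hw' : ∀ᶠ w' : E2 × Circle in 𝓝 w, ‖w'.1‖ < 1 :=
      (isOpen_Iio.preimage (f := fun w : E2 × Circle => ‖w.1‖) (by fun_prop)).mem_nhds hw
    filter_upwards [hsct h3, (h4.comp hsct) (hS.mem_nhds (hinvS w hw)), hw'] with w' h5 h6 h7
    refine hSinj (hinvS w' h7) h6 ?_
    rw [hinv w' h7]
    exact (hl.localInverse_right_inv h5).symm
  refine ⟨ε, hε, min_le_right _ _, {
    toFun := fun p => (ε⁻¹ • (Ξ p).1, (Ξ p).2)
    invFun := inv
    source := S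
    target := Metric.ball 0 1 ×ˢ univ
    map_source' := fun p hp => ⟨by simpa using hnorm p hp, mem_univ _⟩
    map_target' := fun w hw => hinvS w (by simpa using hw.1)
    left_inv' := fun p hp => by
      have h1 : ‖(ε⁻¹ • (Ξ p).1, (Ξ p).2).1‖ < 1 := hnorm p hp
      exact hSinj (hinvS _ h1) hp ((hinv _ h1).trans (hscS p hp))
    right_inv' := fun w hw => by
      have h1 : ‖w.1‖ < 1 := by simpa using hw.1
      simp [hinv w h1, sc, smul_smul, hε.ne']
    open_source := hS
    open_target := Metric.isOpen_ball.prod isOpen_univ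
    continuousOn_toFun := fun p hp => (hsm p hp).continuousAt.continuousWithinAt
    continuousOn_invFun := fun w hw =>
      (hsminv w (by simpa using hw.1)).continuousAt.continuousWithinAt }, ?_, ?_, ?_⟩
  · have hγS : γ ⊆ S := fun p hp => by
      refine ⟨hγO hp, ?_⟩
      have : Ξ p ∈ {(0 : E2)} ×ˢ (univ : Set Circle) := himg ▸ mem_image_of_mem Ξ hp
      have h0 : (Ξ p).1 = 0 := this.1
      simpa [h0] using hε
    refine ⟨hγS, rfl, fun p hp => (hsm p hp).contMDiffWithinAt,
      fun w hw => (hsminv w (by simpa using hw.1)).contMDiffWithinAt, fun p hp => ?_⟩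
    have e : ε⁻¹ • (Ξ p).1 = 0 ↔ (Ξ p).1 = 0 := by simp [hε.ne']
    refine Iff.trans ?_ e.symm
    constructor
    · intro hpγ
      have : Ξ p ∈ {(0 : E2)} ×ˢ (univ : Set Circle) := himg ▸ mem_image_of_mem Ξ hpγ
      exact this.1
    · intro h0
      have : Ξ p ∈ Ξ '' γ := himg ▸ ⟨h0, mem_univ _⟩
      obtain ⟨p', hp', he⟩ := this
      rwa [← hSinj (hγS hp') hp he]
  · exact fun p hp => hp.1.1.2
  · intro p hp
    exact (hscS p hp).symm

end

theorem _root_.IsLocalDiffeomorphAt.congr_of_eventuallyEq {E F H H' N : Type*}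
    [NormedAddCommGroup E] [NormedSpace ℝ E] [NormedAddCommGroup F] [NormedSpace ℝ F]
    [TopologicalSpace H] [TopologicalSpace H'] {I : ModelWithCorners ℝ E H}
    {I' : ModelWithCorners ℝ F H'} {M : Type*} [TopologicalSpace M] [ChartedSpace H M]
    [TopologicalSpace N] [ChartedSpace H' N] {f g : M → N} {x : M}
    (hf : IsLocalDiffeomorphAt I I' ∞ f x) (hfg : g =ᶠ[𝓝 x] f) :
    IsLocalDiffeomorphAt I I' ∞ g x := by
  obtain ⟨Φ, hx, he⟩ := hf
  obtain ⟨s, hs, hso, hxs⟩ := mem_nhds_iff.1 hfg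
  let e := Φ.toOpenPartialHomeomorph.restrOpen s hso
  refine ⟨{
    toPartialEquiv := e.toPartialEquiv
    open_source := e.open_source
    open_target := e.open_target
    contMDiffOn_toFun := Φ.contMDiffOn_toFun.mono inter_subset_left
    contMDiffOn_invFun := Φ.contMDiffOn_invFun.mono fun y hy => ?_ }, ⟨hx, hxs⟩, ?_⟩
  · exact hy.1
  · intro y hy
    exact (hs hy.2).trans (he hy.1)

/-- The inverse function theorem, in terms of `IsLocalDiffeomorphAt`. -/
theorem isLocalDiffeomorphAt_of_fderiv_injective {V V' : Type*} [NormedAddCommGroup V]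
    [NormedSpace ℝ V] [FiniteDimensional ℝ V] [NormedAddCommGroup V'] [NormedSpace ℝ V']
    [FiniteDimensional ℝ V'] (hfin : Module.finrank ℝ V = Module.finrank ℝ V') {k : V → V'}
    {O : Set V} (hO : IsOpen O) (hk : ContDiffOn ℝ ∞ k O) {x : V} (hx : x ∈ O)
    (hinj : ∀ v, fderiv ℝ k x v = 0 → v = 0) :
    IsLocalDiffeomorphAt 𝓘(ℝ, V) 𝓘(ℝ, V') ∞ k x := by
  have : CompleteSpace V := FiniteDimensional.complete ℝ V
  have hat : ∀ y ∈ O, ContDiffAt ℝ ∞ k y := fun y hy => hk.contDiffAt (hO.mem_nhds hy)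
  let L : V ≃L[ℝ] V' := (LinearEquiv.ofInjectiveOfFinrankEq (fderiv ℝ k x : V →ₗ[ℝ] V')
    ((injective_iff_map_eq_zero _).2 hinj) hfin).toContinuousLinearEquiv
  have hL : (L : V →L[ℝ] V') = fderiv ℝ k x := by ext; rfl
  have hd : HasFDerivAt k (L : V →L[ℝ] V') x := by
    rw [hL]; exact ((hat x hx).differentiableAt (by simp)).hasFDerivAt
  let e := (hat x hx).toOpenPartialHomeomorph k hd (by simp)
  have hxe : x ∈ e.source := (hat x hx).mem_toOpenPartialHomeomorph_source hd (by simp)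
  set O' : Set V := O ∩ (fderiv ℝ k) ⁻¹' range ((↑) : (V ≃L[ℝ] V') → V →L[ℝ] V')
  have hO' : IsOpen O' := (hk.continuousOn_fderiv_of_isOpen hO (by simp)).isOpen_inter_preimage hO
    (ContinuousLinearEquiv.isOpen)
  let e' := e.restrOpen O' hO'
  refine ⟨{
    toPartialEquiv := e'.toPartialEquiv
    open_source := e'.open_source
    open_target := e'.open_target
    contMDiffOn_toFun := (hk.mono fun y hy => hy.2.1).contMDiffOn
    contMDiffOn_invFun := fun y hy => ?_ }, ⟨hxe, hx, L, hL⟩, fun y _ => rfl⟩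
  have h1 : e'.symm y ∈ e'.source := e'.map_target hy
  obtain ⟨L', hL'⟩ := h1.2.2
  refine ContMDiffAt.contMDiffWithinAt (ContDiffAt.contMDiffAt ?_)
  refine e'.contDiffAt_symm hy (f₀' := L') ?_ (hat _ h1.2.1)
  rw [hL']
  exact ((hat _ h1.2.1).differentiableAt (by simp)).hasFDerivAt

section

variable {M : Type*} [TopologicalSpace M] [ChartedSpace (EuclideanHalfSpace 3) M]
  {γ : Set M} {Φ : OpenPartialHomeomorph M (EuclideanSpace ℝ (Fin 2) × Circle)}

theorem IsTubularDiffeo.pexp_mem (hΦ : IsTubularDiffeo γ Φ) {q : Cyl} (hq : q ∈ cyl 1) :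
    pexp q ∈ Φ.target := by
  rw [hΦ.target_eq]; exact ⟨hq.1, mem_univ _⟩

theorem IsTubularDiffeo.mem_source (hΦ : IsTubularDiffeo γ Φ) {q : Cyl} (hq : q ∈ cyl 1) :
    coordParam Φ q ∈ Φ.source := Φ.map_target (hΦ.pexp_mem hq)

theorem IsTubularDiffeo.apply_coordParam (hΦ : IsTubularDiffeo γ Φ) {q : Cyl} (hq : q ∈ cyl 1) :
    Φ (coordParam Φ q) = pexp q := Φ.right_inv (hΦ.pexp_mem hq)

theorem IsTubularDiffeo.norm_lt (hΦ : IsTubularDiffeo γ Φ) {p : M} (hp : p ∈ Φ.source) :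
    ‖(Φ p).1‖ < 1 := by
  have := Φ.map_source hp
  rw [hΦ.target_eq] at this
  simpa using this.1

omit [ChartedSpace (EuclideanHalfSpace 3) M] in
theorem coordParam_of_eq {p : M} (hp : p ∈ Φ.source) {φ : ℝ} (h : Circle.exp φ = (Φ p).2) :
    coordParam Φ ((Φ p).1, φ) = p := by
  simp only [coordParam, h]
  exact Φ.left_inv hp

omit [ChartedSpace (EuclideanHalfSpace 3) M] in
theorem coordParam_periodic (Φ : OpenPartialHomeomorph M (EuclideanSpace ℝ (Fin 2) × Circle))
    (q : Cyl) : coordParam Φ (q.1, q.2 + 2 * Real.pi) = coordParam Φ q := by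
  simp [coordParam]

theorem IsTubularDiffeo.coordParam_mem (hΦ : IsTubularDiffeo γ Φ) (φ : ℝ) :
    coordParam Φ (0, φ) ∈ γ := by
  have hq : ((0, φ) : Cyl) ∈ cyl 1 := by simp [mem_cyl]
  rw [hΦ.axis _ (hΦ.mem_source hq), hΦ.apply_coordParam hq]
  rfl

theorem IsTubularDiffeo.exists_coordParam_eq (hΦ : IsTubularDiffeo γ Φ) {p : M} (hp : p ∈ γ) :
    ∃ φ, coordParam Φ (0, φ) = p := by
  have h0 := (hΦ.axis p (hΦ.subset_source hp)).1 hp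
  refine ⟨Complex.arg (Φ p).2, ?_⟩
  rw [← h0]
  exact coordParam_of_eq (hΦ.subset_source hp) (Circle.exp_arg _)

theorem IsTubularDiffeo.isLocalDiffeomorphAt (hΦ : IsTubularDiffeo γ Φ) {q : Cyl}
    (hq : q ∈ cyl 1) : IsLocalDiffeomorphAt 𝓘(ℝ, Cyl) (𝓡∂ 3) ∞ (coordParam Φ) q := by
  let Ψ : PartialDiffeomorph ((𝓡 2).prod (𝓡 1)) (𝓡∂ 3) (E2 × Circle) M ∞ := {
    toPartialEquiv := Φ.symm.toPartialEquiv
    open_source := Φ.open_target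
    open_target := Φ.open_source
    contMDiffOn_toFun := hΦ.smooth_symm
    contMDiffOn_invFun := hΦ.smooth }
  exact (isLocalDiffeomorphAt_pexp q).comp _ _
    (Ψ.isLocalDiffeomorphAt _ _ _ (hΦ.pexp_mem hq))

theorem IsTubularDiffeo.isCompact (hΦ : IsTubularDiffeo γ Φ) : IsCompact γ := by
  have h1 : γ = Φ.symm '' ({0} ×ˢ univ) := by
    ext p
    constructor
    · intro hp
      refine ⟨Φ p, ⟨(hΦ.axis p (hΦ.subset_source hp)).1 hp, mem_univ _⟩,
        Φ.left_inv (hΦ.subset_source hp)⟩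
    · rintro ⟨⟨z, u⟩, ⟨hz, -⟩, rfl⟩
      have hz' : z = 0 := hz
      have ht : ((z, u) : E2 × Circle) ∈ Φ.target := by rw [hΦ.target_eq]; simp [hz']
      rw [hΦ.axis _ (Φ.map_target ht), Φ.right_inv ht]
      exact hz'
  rw [h1]
  refine (isCompact_singleton.prod isCompact_univ).image_of_continuousOn
    (Φ.continuousOn_symm.mono ?_)
  rintro ⟨z, u⟩ ⟨hz, -⟩
  rw [hΦ.target_eq]
  have hz' : z = 0 := hz
  simp [hz']

/-- A periodic change of the coordinates `(x, y)` which fixes the axis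
leads to new tubular coordinates. -/
theorem IsTubularDiffeo.exists_change (hΦ : IsTubularDiffeo γ Φ) {δ : ℝ} (hδ : 0 < δ)
    (hδ1 : δ ≤ 1) {g : Cyl → E2} (hg : ContDiffOn ℝ ∞ g (cyl δ))
    (hper : ∀ q : Cyl, g (q.1, q.2 + 2 * Real.pi) = g q) (h0 : ∀ φ, g (0, φ) = 0)
    (hinj : ∀ φ v, fderiv ℝ g (0, φ) (v, 0) = 0 → v = 0) :
    ∃ ε : ℝ, 0 < ε ∧ ε ≤ 1 ∧ ∃ Φ' : OpenPartialHomeomorph M (EuclideanSpace ℝ (Fin 2) × Circle),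
      IsTubularDiffeo γ Φ' ∧ ∀ q' ∈ cyl 1, ∃ q ∈ cyl δ, q.2 = q'.2 ∧ ε • q'.1 = g q ∧
        coordParam Φ' q' = coordParam Φ q ∧
        ∀ᶠ r in 𝓝 q, coordParam Φ' (ε⁻¹ • g r, r.2) = coordParam Φ r := by
  have hsub : cyl δ ⊆ cyl 1 := prod_mono (Metric.ball_subset_ball hδ1) le_rfl
  have hgper : ∀ z φ, g (z, Complex.arg (Circle.exp φ)) = g (z, φ) := by
    intro z φ
    have h1 : Function.Periodic (fun φ => g (z, φ)) (2 * Real.pi) := fun φ => hper (z, φ)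
    obtain ⟨m, hm⟩ := Circle.exp_eq_exp.1 (Circle.exp_arg (Circle.exp φ))
    rw [hm]
    exact h1.int_mul m φ
  -- the new coordinates as functions on `M`; any choice of the angle will do, as `g` is periodic
  let Ξ : M → E2 × Circle := fun p => (g ((Φ p).1, Complex.arg (Φ p).2), (Φ p).2)
  let G : Cyl → Cyl := fun r => (g r, r.2)
  have hΞP : ∀ r ∈ cyl 1, Ξ (coordParam Φ r) = pexp (G r) := by
    intro r hr
    simp only [Ξ, hΦ.apply_coordParam hr, pexp, G, hgper]
  set U : Set M := Φ.source ∩ Φ ⁻¹' {w | ‖w.1‖ < δ}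
  have hU : IsOpen U := Φ.isOpen_inter_preimage
    (isOpen_Iio.preimage (f := fun w : E2 × Circle => ‖w.1‖) (by fun_prop))
  have haxis : ∀ p ∈ γ, (Φ p).1 = 0 := fun p hp => (hΦ.axis p (hΦ.subset_source hp)).1 hp
  have hγU : γ ⊆ U := fun p hp => ⟨hΦ.subset_source hp, by simpa [haxis p hp] using hδ⟩
  have hΞγ : ∀ p ∈ γ, Ξ p = (0, (Φ p).2) := fun p hp => by simp [Ξ, haxis p hp, h0]
  have hloc : ∀ p ∈ γ, IsLocalDiffeomorphAt (𝓡∂ 3) ((𝓡 2).prod (𝓡 1)) ∞ Ξ p := by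
    intro p hp
    obtain ⟨φ, rfl⟩ := hΦ.exists_coordParam_eq hp
    have hq : ((0, φ) : Cyl) ∈ cyl δ := by simp [mem_cyl, hδ]
    have hP := hΦ.isLocalDiffeomorphAt (hsub hq)
    have hgd : DifferentiableAt ℝ g (0, φ) :=
      (hg.contDiffAt ((isOpen_cyl δ).mem_nhds hq)).differentiableAt (by simp)
    have hGd : HasFDerivAt G ((fderiv ℝ g (0, φ)).prod (ContinuousLinearMap.snd ℝ E2 ℝ)) (0, φ) :=
      hgd.hasFDerivAt.prodMk hasFDerivAt_snd
    have hG : IsLocalDiffeomorphAt 𝓘(ℝ, Cyl) 𝓘(ℝ, Cyl) ∞ G (0, φ) := by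
      refine isLocalDiffeomorphAt_of_fderiv_injective rfl (isOpen_cyl δ)
        (hg.prodMk contDiffOn_snd) hq fun v hv => ?_
      rw [hGd.fderiv] at hv
      have hv2 : v.2 = 0 := congrArg Prod.snd hv
      have hv' : v = (v.1, 0) := Prod.ext rfl hv2
      have hv1 : fderiv ℝ g (0, φ) v = 0 := congrArg Prod.fst hv
      rw [hv'] at hv1
      rw [hv', hinj φ _ hv1]
      rfl
    have hli : hP.localInverse (coordParam Φ (0, φ)) = (0, φ) :=
      hP.localInverse_left_inv hP.localInverse_mem_target
    have hcomp : IsLocalDiffeomorphAt (𝓡∂ 3) ((𝓡 2).prod (𝓡 1)) ∞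
        ((pexp ∘ G) ∘ hP.localInverse) (coordParam Φ (0, φ)) := by
      refine hP.localInverse_isLocalDiffeomorphAt.comp _ _ ?_
      rw [hli]
      exact hG.comp _ _ (isLocalDiffeomorphAt_pexp _)
    refine hcomp.congr_of_eventuallyEq ?_
    have hcont : Filter.Tendsto hP.localInverse (𝓝 (coordParam Φ (0, φ))) (𝓝 (0, φ)) := by
      have := hP.localInverse_contMDiffAt.continuousAt.tendsto
      rwa [hli] at this
    filter_upwards [hP.localInverse_open_source.mem_nhds hP.localInverse_mem_source,
      hcont ((isOpen_cyl 1).mem_nhds (hsub hq))] with p hp1 hp2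
    have := hΞP _ hp2
    rwa [hP.localInverse_right_inv hp1] at this
  have hinjγ : InjOn Ξ γ := by
    intro p hp p' hp' he
    rw [hΞγ p hp, hΞγ p' hp'] at he
    refine Φ.injOn (hΦ.subset_source hp) (hΦ.subset_source hp') (Prod.ext ?_ ?_)
    · rw [haxis p hp, haxis p' hp']
    · exact (Prod.mk.inj he).2
  have himg : Ξ '' γ = {0} ×ˢ univ := by
    ext ⟨z, u⟩
    constructor
    · rintro ⟨p, hp, he⟩
      rw [hΞγ p hp] at he
      exact ⟨(congrArg Prod.fst he).symm, mem_univ _⟩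
    · rintro ⟨hz, -⟩
      have hz' : z = 0 := hz
      refine ⟨coordParam Φ (0, Complex.arg u), hΦ.coordParam_mem _, ?_⟩
      rw [hΞP _ (by simp [mem_cyl]), hz']
      simp [pexp, G, h0]
  obtain ⟨ε, hε, hε1, Φ', hΦ', hsrc, hΦ'e⟩ :=
    exists_isTubularDiffeo hΦ.isCompact hU hγU hloc hinjγ himg
  refine ⟨ε, hε, hε1, Φ', hΦ', fun q' hq' => ?_⟩
  have hp := hΦ'.mem_source hq'
  have e1 := hΦ'e _ hp
  rw [hΦ'.apply_coordParam hq'] at e1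
  have e2 : (Φ (coordParam Φ' q')).2 = Circle.exp q'.2 := congrArg Prod.snd e1
  have e3 := congrArg Prod.fst e1
  simp only [Ξ, e2, hgper, pexp] at e3
  have hPq := coordParam_of_eq (hsrc hp).1 e2.symm
  have hq : (((Φ (coordParam Φ' q')).1, q'.2) : Cyl) ∈ cyl δ := mem_cyl.2 (hsrc hp).2
  refine ⟨((Φ (coordParam Φ' q')).1, q'.2), hq, rfl, e3.symm, hPq.symm, ?_⟩
  have hc := (hΦ.isLocalDiffeomorphAt (hsub hq)).contMDiffAt.continuousAt
  have : Φ'.source ∈ 𝓝 (coordParam Φ ((Φ (coordParam Φ' q')).1, q'.2)) := by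
    rw [hPq]; exact Φ'.open_source.mem_nhds hp
  filter_upwards [hc this, (isOpen_cyl δ).mem_nhds hq] with r hr hrδ
  have e4 := hΦ'e _ hr
  rw [hΞP r (hsub hrδ)] at e4
  have e5 : (Φ' (coordParam Φ r)).1 = ε⁻¹ • g r := by
    have := congrArg Prod.fst e4
    simp only [pexp, G] at this
    rw [this, smul_smul, inv_mul_cancel₀ hε.ne', one_smul]
  rw [← e5]
  exact coordParam_of_eq hr (congrArg Prod.snd e4)

end

/-! ### Charts at interior points -/

abbrev E3 : Type := EuclideanSpace ℝ (Fin 3)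

/-- A smooth family of alternating forms, evaluated at smooth vector fields, is a smooth function. -/
theorem contDiffWithinAt_alternating_apply {V W : Type*} [NormedAddCommGroup V] [NormedSpace ℝ V]
    [NormedAddCommGroup W] [NormedSpace ℝ W] {O : Set V} {x : V} {k : ℕ}
    {α : V → W [⋀^Fin k]→L[ℝ] ℝ} (hα : ContDiffWithinAt ℝ ∞ α O x) {X : V → Fin k → W}
    (hX : ∀ i, ContDiffWithinAt ℝ ∞ (fun y => X y i) O x) :
    ContDiffWithinAt ℝ ∞ (fun y => α y (X y)) O x := by
  induction k with
  | zero =>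
    have h : ∀ y, α y (X y) = ContinuousAlternatingMap.apply ℝ W ℝ (![] : Fin 0 → W) (α y) := by
      intro y
      rw [Subsingleton.elim (X y) ![]]
      rfl
    simp only [h]
    exact (ContinuousLinearMap.contDiff _).comp_contDiffWithinAt hα
  | succ k ih =>
    have h : ∀ y, α y (X y) =
        (ContinuousAlternatingMap.curryLeftLI : W [⋀^Fin (k + 1)]→L[ℝ] ℝ →ₗᵢ[ℝ] _) (α y) (X y 0)
          (fun i => X y i.succ) := by
      intro y
      exact congrArg (α y) (Fin.cons_self_tail (X y)).symm
    simp only [h]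
    refine ih ?_ fun i => hX i.succ
    exact ((LinearIsometry.contDiff _).comp_contDiffWithinAt hα).clm_apply (hX 0)

variable {M : Type*} [TopologicalSpace M] [ChartedSpace (EuclideanHalfSpace 3) M]
  [IsManifold (𝓡∂ 3) ∞ M]

omit [IsManifold (𝓡∂ 3) ∞ M] in
theorem isOpen_extChartAt_target_inter_interior (p : M) :
    IsOpen ((extChartAt (𝓡∂ 3) p).target ∩ interior (range (𝓡∂ 3))) := by
  have : (extChartAt (𝓡∂ 3) p).target ∩ interior (range (𝓡∂ 3)) =
      (𝓡∂ 3).symm ⁻¹' (chartAt (EuclideanHalfSpace 3) p).target ∩ interior (range (𝓡∂ 3)) := by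
    rw [extChartAt_target, inter_assoc, inter_eq_right.2 (interior_subset (s := range (𝓡∂ 3)))]
  rw [this]
  exact ((chartAt _ p).open_target.preimage (𝓡∂ 3).continuous_symm).inter isOpen_interior

theorem extChartAt_mem_interior_range_iff {p q : M} (hq : q ∈ (extChartAt (𝓡∂ 3) p).source) :
    extChartAt (𝓡∂ 3) p q ∈ interior (range (𝓡∂ 3)) ↔ q ∈ (𝓡∂ 3).interior M := by
  have h := (𝓡∂ 3).isInteriorPoint_iff_of_mem_atlas (n := ∞) (by simp)
    (chart_mem_atlas (EuclideanHalfSpace 3) p) (by simpa using hq)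
  refine ⟨fun hx => h.2 ?_, fun hx => interior_mono (extChartAt_target_subset_range p) (h.1 hx)⟩
  exact mem_interior.2 ⟨_, inter_subset_left, isOpen_extChartAt_target_inter_interior p,
    (extChartAt (𝓡∂ 3) p).map_source hq, hx⟩

/-- The chart around `p`, restricted to the interior of `M`. -/
def chartDiffeo (p : M) : PartialDiffeomorph (𝓡∂ 3) 𝓘(ℝ, E3) M E3 ∞ where
  toFun := extChartAt (𝓡∂ 3) p
  invFun := (extChartAt (𝓡∂ 3) p).symm
  source := (extChartAt (𝓡∂ 3) p).source ∩ (𝓡∂ 3).interior M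
  target := (extChartAt (𝓡∂ 3) p).target ∩ interior (range (𝓡∂ 3))
  map_source' := fun q hq => ⟨(extChartAt (𝓡∂ 3) p).map_source hq.1,
    (extChartAt_mem_interior_range_iff hq.1).2 hq.2⟩
  map_target' := fun x hx => by
    have h1 := (extChartAt (𝓡∂ 3) p).map_target hx.1
    refine ⟨h1, (extChartAt_mem_interior_range_iff h1).1 ?_⟩
    rw [(extChartAt (𝓡∂ 3) p).right_inv hx.1]
    exact hx.2
  left_inv' := fun q hq => (extChartAt (𝓡∂ 3) p).left_inv hq.1
  right_inv' := fun x hx => (extChartAt (𝓡∂ 3) p).right_inv hx.1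
  open_source := (isOpen_extChartAt_source p).inter ((𝓡∂ 3).isOpen_interior (n := ∞) (by simp))
  open_target := isOpen_extChartAt_target_inter_interior p
  contMDiffOn_toFun := (contMDiffOn_extChartAt (I := 𝓡∂ 3) (n := ∞) (x := p)).mono
    fun q hq => by simpa using hq.1
  contMDiffOn_invFun := (contMDiffOn_extChartAt_symm p).mono inter_subset_left

theorem mem_chartDiffeo_source {p : M} (hp : p ∈ (𝓡∂ 3).interior M) :
    p ∈ (chartDiffeo p).source := ⟨mem_extChartAt_source p, hp⟩

theorem mfderiv_chart_self (p : M) :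
    mfderiv (𝓡∂ 3) 𝓘(ℝ, E3) (extChartAt (𝓡∂ 3) p) p = ContinuousLinearMap.id ℝ E3 :=
  mfderiv_extChartAt_self

theorem hessianAt_eq (ψ : M → ℝ) (p : M) (v w : E3) : hessianAt ψ p v w =
    fderiv ℝ (fderiv ℝ (ψ ∘ (extChartAt (𝓡∂ 3) p).symm)) (extChartAt (𝓡∂ 3) p p) v w := by
  unfold hessianAt
  rw [mfderiv_chart_self]
  rfl

theorem extD_eq {k : ℕ} (α : Form M k) {p : M} (hp : p ∈ (𝓡∂ 3).interior M) :
    extD α p = extDeriv (chartRep α p) (extChartAt (𝓡∂ 3) p p) := by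
  unfold extD
  rw [mfderiv_chart_self]
  have h : range (𝓡∂ 3) ∈ 𝓝 (extChartAt (𝓡∂ 3) p p) := range_mem_nhds_isInteriorPoint hp
  have h2 : extDerivWithin (chartRep α p) (range (𝓡∂ 3)) (extChartAt (𝓡∂ 3) p p) =
      extDeriv (chartRep α p) (extChartAt (𝓡∂ 3) p p) := by
    rw [extDerivWithin, extDeriv, fderivWithin_of_mem_nhds h]
  rw [h2]
  ext v
  rfl

section Param

variable {V : Type*} [NormedAddCommGroup V] [NormedSpace ℝ V]

omit [IsManifold (𝓡∂ 3) ∞ M] in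
theorem pullback_apply {k : ℕ} (κ : V → M) (α : Form M k) (y : V) (v : Fin k → V) :
    pullback κ α y v = α (κ y) (fun i => mfderiv 𝓘(ℝ, V) (𝓡∂ 3) κ y (v i)) := by
  simp only [pullback, pullbackWithin, mfderivWithin_univ]
  rfl

/-- The pullback of a form, computed in the chart around a point. -/
theorem pullback_eq_chartRep {k : ℕ} {κ : V → M} {y : V}
    (hκ : MDifferentiableAt 𝓘(ℝ, V) (𝓡∂ 3) κ y) (α : Form M k) {p : M}
    (hp : κ y ∈ (chartDiffeo p).source) :
    pullback κ α y = (chartRep α p (extChartAt (𝓡∂ 3) p (κ y))).compContinuousLinearMap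
      (fderiv ℝ (extChartAt (𝓡∂ 3) p ∘ κ) y) := by
  have h1 : (extChartAt (𝓡∂ 3) p).symm (extChartAt (𝓡∂ 3) p (κ y)) = κ y :=
    (chartDiffeo p).left_inv hp
  have ht := (chartDiffeo p).map_source hp
  have hr : range (𝓡∂ 3) ∈ 𝓝 (extChartAt (𝓡∂ 3) p (κ y)) :=
    Filter.mem_of_superset (isOpen_interior.mem_nhds ht.2) interior_subset
  have hd : MDifferentiableAt 𝓘(ℝ, E3) (𝓡∂ 3) (extChartAt (𝓡∂ 3) p).symm
      (extChartAt (𝓡∂ 3) p (κ y)) :=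
    ((chartDiffeo p).symm.isLocalDiffeomorphAt _ _ _ ht).mdifferentiableAt (by simp)
  have he : MDifferentiableAt (𝓡∂ 3) 𝓘(ℝ, E3) (extChartAt (𝓡∂ 3) p) (κ y) :=
    ((chartDiffeo p).isLocalDiffeomorphAt _ _ _ hp).mdifferentiableAt (by simp)
  have hh : HasMFDerivAt 𝓘(ℝ, V) 𝓘(ℝ, E3) (extChartAt (𝓡∂ 3) p ∘ κ) y
      (fderiv ℝ (extChartAt (𝓡∂ 3) p ∘ κ) y) :=
    ((he.comp y hκ).differentiableAt.hasFDerivAt).hasMFDerivAt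
  have h3 : (extChartAt (𝓡∂ 3) p).symm ∘ (extChartAt (𝓡∂ 3) p ∘ κ) =ᶠ[𝓝 y] κ := by
    filter_upwards [hκ.continuousAt ((chartDiffeo p).open_source.mem_nhds hp)] with z hz
    exact (chartDiffeo p).left_inv hz
  have hcomp := ((hd.hasMFDerivAt.comp y hh).congr_of_eventuallyEq h3.symm).mfderiv
  have h : ∀ q, q = κ y → ((α q : E3 [⋀^Fin k]→L[ℝ] ℝ) = α (κ y)) := by rintro q rfl; rfl
  ext v
  rw [pullback_apply, hcomp]
  simp only [chartRep, pullbackWithin, mfderivWithin_of_mem_nhds hr]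
  rw [h _ h1]
  rfl

omit [IsManifold (𝓡∂ 3) ∞ M] in
theorem interior_of_isLocalDiffeomorphAt {κ : V → M} {x : V}
    (hκ : IsLocalDiffeomorphAt 𝓘(ℝ, V) (𝓡∂ 3) ∞ κ x) : κ x ∈ (𝓡∂ 3).interior M :=
  (hκ.isInteriorPoint_iff (by simp)).1 BoundarylessManifold.isInteriorPoint

theorem contDiffAt_chart_comp {κ : V → M} {x : V}
    (hκ : IsLocalDiffeomorphAt 𝓘(ℝ, V) (𝓡∂ 3) ∞ κ x) {p : M} (hp : κ x ∈ (chartDiffeo p).source) :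
    ContDiffAt ℝ ∞ (extChartAt (𝓡∂ 3) p ∘ κ) x :=
  ((((chartDiffeo p).isLocalDiffeomorphAt _ _ _ hp).contMDiffAt).comp x hκ.contMDiffAt).contDiffAt

theorem eventually_pullback_eq {k : ℕ} {κ : V → M} {x : V}
    (hκ : IsLocalDiffeomorphAt 𝓘(ℝ, V) (𝓡∂ 3) ∞ κ x) (α : Form M k) {p : M}
    (hp : κ x ∈ (chartDiffeo p).source) :
    pullback κ α =ᶠ[𝓝 x] fun y => (chartRep α p ((extChartAt (𝓡∂ 3) p ∘ κ) y)).compContinuousLinearMap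
      (fderiv ℝ (extChartAt (𝓡∂ 3) p ∘ κ) y) := by
  filter_upwards [hκ.contMDiffAt.continuousAt ((chartDiffeo p).open_source.mem_nhds hp),
    (isOpen_setOf_isLocalDiffeomorphAt κ).mem_nhds hκ] with y hy1 hy2
  exact pullback_eq_chartRep (IsLocalDiffeomorphAt.mdifferentiableAt hy2 (by simp)) α hy1

/-- Smoothness of a form in the interior of `M`. -/
def SmoothInterior {k : ℕ} (α : Form M k) : Prop :=
  ∀ p : M, ContDiffOn ℝ ∞ (chartRep α p) (chartDiffeo p).target

theorem SmoothInterior.contDiffAt {k : ℕ} {α : Form M k} (hα : SmoothInterior α) {p q : M}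
    (hq : q ∈ (chartDiffeo p).source) :
    ContDiffAt ℝ ∞ (chartRep α p) (extChartAt (𝓡∂ 3) p q) :=
  (hα p).contDiffAt ((chartDiffeo p).open_target.mem_nhds ((chartDiffeo p).map_source hq))

theorem SmoothInterior.contDiffAt_pullback {k : ℕ} {α : Form M k} (hα : SmoothInterior α)
    {κ : V → M} {x : V} (hκ : IsLocalDiffeomorphAt 𝓘(ℝ, V) (𝓡∂ 3) ∞ κ x) (v : Fin k → V) :
    ContDiffAt ℝ ∞ (fun y => pullback κ α y v) x := by
  have hp := mem_chartDiffeo_source (interior_of_isLocalDiffeomorphAt hκ)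
  have h1 := eventually_pullback_eq hκ α hp
  have h2 := contDiffAt_chart_comp hκ hp
  have h3 : ContDiffAt ℝ ∞ (fun y => chartRep α (κ x) ((extChartAt (𝓡∂ 3) (κ x) ∘ κ) y) fun i =>
      fderiv ℝ (extChartAt (𝓡∂ 3) (κ x) ∘ κ) y (v i)) x :=
    contDiffWithinAt_alternating_apply ((hα.contDiffAt hp).comp x h2) fun i =>
      (h2.fderiv_right (m := ∞) (by simp)).clm_apply contDiffAt_const
  exact h3.congr_of_eventuallyEq (h1.mono fun y hy => congrArg (fun f => f v) hy)

theorem SmoothInterior.extDeriv_pullback_eq_zero {k : ℕ} {α : Form M k} (hα : SmoothInterior α)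
    {κ : V → M} {x : V} (hκ : IsLocalDiffeomorphAt 𝓘(ℝ, V) (𝓡∂ 3) ∞ κ x)
    (hd : extD α (κ x) = 0) : extDeriv (pullback κ α) x = 0 := by
  have hi := interior_of_isLocalDiffeomorphAt hκ
  have hp := mem_chartDiffeo_source hi
  rw [extD_eq α hi] at hd
  rw [(eventually_pullback_eq hκ α hp).extDeriv_eq,
    extDeriv_pullback (f := extChartAt (𝓡∂ 3) (κ x) ∘ κ) (r := ∞) ((hα.contDiffAt hp).differentiableAt (by simp))
      (contDiffAt_chart_comp hκ hp) (by simpa using WithTop.coe_le_coe.2 (le_top (a := (2 : ℕ∞)))), Function.comp_apply, hd]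
  rfl

theorem SmoothInterior.pullback_differentiableAt {k : ℕ} {α : Form M k} (hα : SmoothInterior α)
    {κ : V → M} {x : V} (hκ : IsLocalDiffeomorphAt 𝓘(ℝ, V) (𝓡∂ 3) ∞ κ x) :
    DifferentiableAt ℝ (pullback κ α) x := by
  have hp := mem_chartDiffeo_source (interior_of_isLocalDiffeomorphAt hκ)
  have h2 := contDiffAt_chart_comp hκ hp
  refine DifferentiableAt.congr_of_eventuallyEq ?_ (eventually_pullback_eq hκ α hp)
  exact DifferentiableAt.continuousAlternatingMapCompContinuousLinearMap
    (((hα.contDiffAt hp).differentiableAt (by simp)).comp x (h2.differentiableAt (by simp)))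
    ((h2.fderiv_right (m := ∞) (by simp)).differentiableAt (by simp))

end Param

theorem SmoothForm.smoothInterior {k : ℕ} {α : Form M k} (hα : SmoothForm α) : SmoothInterior α :=
  fun p => (hα p).mono inter_subset_left

/-- A vector field in the chart around `p`. -/
def chartField (B : VField M) (p : M) (x : E3) : E3 :=
  mfderiv (𝓡∂ 3) 𝓘(ℝ, E3) (extChartAt (𝓡∂ 3) p) ((extChartAt (𝓡∂ 3) p).symm x)
    (B ((extChartAt (𝓡∂ 3) p).symm x))

theorem contDiffOn_chartField {B : VField M} (hB : SmoothField B) (p : M) :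
    ContDiffOn ℝ ∞ (chartField B p) (chartDiffeo p).target := by
  have hsrc : ∀ q ∈ (extChartAt (𝓡∂ 3) p).source, q ∈ (chartAt (EuclideanHalfSpace 3) p).source :=
    fun q hq => by simpa using hq
  have h1 := ((trivializationAt E3 (TangentSpace (𝓡∂ 3)) p).contMDiffOn_section_iff
    (IB := 𝓡∂ 3) (n := ∞) (s := B) (isOpen_extChartAt_source (I := 𝓡∂ 3) p) (fun q hq => by
      rw [TangentBundle.trivializationAt_baseSet]; exact hsrc q hq)).1 hB.contMDiffOn
  have h2 := (h1.comp (s := (chartDiffeo p).target)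
    ((contMDiffOn_extChartAt_symm (I := 𝓡∂ 3) (n := ∞) p).mono inter_subset_left) fun x hx => (extChartAt (𝓡∂ 3) p).map_target hx.1).contDiffOn
  refine h2.congr fun x hx => ?_
  have h3 := TangentBundle.continuousLinearMapAt_trivializationAt (I := 𝓡∂ 3)
    (hsrc _ ((extChartAt (𝓡∂ 3) p).map_target hx.1))
  have h4 : chartField B p x = (trivializationAt E3 (TangentSpace (𝓡∂ 3)) p).continuousLinearMapAt ℝ
      ((extChartAt (𝓡∂ 3) p).symm x) (B ((extChartAt (𝓡∂ 3) p).symm x)) := by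
    rw [h3]; rfl
  rw [h4, Bundle.Trivialization.continuousLinearMapAt_apply,
    Bundle.Trivialization.coe_linearMapAt_of_mem]
  · rfl
  · rw [TangentBundle.trivializationAt_baseSet]; exact hsrc _ ((extChartAt (𝓡∂ 3) p).map_target hx.1)

theorem SmoothInterior.iota {B : VField M} (hB : SmoothField B) {k : ℕ} {α : Form M (k + 1)}
    (hα : SmoothInterior α) : SmoothInterior (iota B α) := by
  intro p
  have h1 : ContDiffOn ℝ ∞ (fun x => (ContinuousAlternatingMap.curryLeftLI :
      E3 [⋀^Fin (k + 1)]→L[ℝ] ℝ →ₗᵢ[ℝ] _) (chartRep α p x) (chartField B p x))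
      (chartDiffeo p).target :=
    ((LinearIsometry.contDiff _).comp_contDiffOn (hα p)).clm_apply (contDiffOn_chartField hB p)
  refine h1.congr fun x hx => ?_
  have h2 := mfderivWithin_extChartAt_symm_comp_mfderiv_extChartAt (I := 𝓡∂ 3) hx.1
  have h3 : mfderivWithin 𝓘(ℝ, E3) (𝓡∂ 3) (extChartAt (𝓡∂ 3) p).symm (range (𝓡∂ 3)) x
      (chartField B p x) = B ((extChartAt (𝓡∂ 3) p).symm x) :=
    congrArg (fun f => f (B ((extChartAt (𝓡∂ 3) p).symm x))) h2
  ext v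
  change α _ (Fin.cons _ _) = α _ _
  congr 1
  ext i : 1
  refine Fin.cases ?_ (fun j => ?_) i
  · exact h3.symm
  · rfl

omit [IsManifold (𝓡∂ 3) ∞ M] in
theorem extD_eq_zero_of_top (α : Form M 3) {p : M} : extD α p = 0 := by
  have h : ∀ β : E3 [⋀^Fin 4]→L[ℝ] ℝ, β = 0 := by
    intro β
    ext v
    refine β.toAlternatingMap.map_linearDependent v fun hv => ?_
    have := hv.fintype_card_le_finrank
    simp at this
  exact h _

/-- In dimension 3, `L_B μ = d ι_B μ`, so the flux form is closed. -/
theorem extD_iota_eq_zero {B : VField M} {ν : Form M 1} {μ : Form M 3} (h : IsFluxSystem B ν μ)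
    (p : M) : extD (iota B μ) p = 0 := by
  have := h.div_free p
  unfold lieD at this
  have h0 : iota B (extD μ) p = 0 := by
    unfold FluxSystem.iota
    rw [extD_eq_zero_of_top μ]
    exact congrArg (fun f => f (B p)) (ContinuousAlternatingMap.curryLeft_zero (𝕜 := ℝ) (E := E3) (F := ℝ) (n := 3))
  rwa [h0, add_zero] at this

/-! ### Second derivatives at critical points -/

/-- The second derivative at a critical point transforms as a bilinear form. -/
theorem fderiv_fderiv_comp_of_critical {V W : Type*} [NormedAddCommGroup V] [NormedSpace ℝ V]
    [NormedAddCommGroup W] [NormedSpace ℝ W] {g : W → ℝ} {h : V → W} {x : V}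
    (hg : ContDiffAt ℝ ∞ g (h x)) (hh : ContDiffAt ℝ ∞ h x) (h0 : fderiv ℝ g (h x) = 0) (v w : V) :
    fderiv ℝ (fderiv ℝ (g ∘ h)) x v w =
      fderiv ℝ (fderiv ℝ g) (h x) (fderiv ℝ h x v) (fderiv ℝ h x w) := by
  have e1 : fderiv ℝ (g ∘ h) =ᶠ[𝓝 x] fun y => (fderiv ℝ g (h y)).comp (fderiv ℝ h y) := by
    have a1 : ∀ᶠ z in 𝓝 (h x), DifferentiableAt ℝ g z :=
      ((hg.of_le (m := 1) (by simp)).eventually (by simp)).mono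
        fun z hz => hz.differentiableAt (by simp)
    have a2 : ∀ᶠ y in 𝓝 x, DifferentiableAt ℝ h y :=
      ((hh.of_le (m := 1) (by simp)).eventually (by simp)).mono
        fun z hz => hz.differentiableAt (by simp)
    filter_upwards [hh.continuousAt a1, a2] with y hy1 hy2
    exact fderiv_comp y hy1 hy2
  have d1 : DifferentiableAt ℝ (fderiv ℝ g) (h x) :=
    (hg.fderiv_right (m := ∞) (by simp)).differentiableAt (by simp)
  have d2 : DifferentiableAt ℝ (fderiv ℝ h) x :=
    (hh.fderiv_right (m := ∞) (by simp)).differentiableAt (by simp)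
  have d3 : HasFDerivAt (fun y => (fderiv ℝ g (h y)).comp (fderiv ℝ h y)) _ x := (d1.hasFDerivAt.comp x (hh.differentiableAt (by simp)).hasFDerivAt).clm_comp
    d2.hasFDerivAt
  rw [e1.fderiv_eq, d3.fderiv]
  simp [h0]

section Potential

variable {M : Type*} [TopologicalSpace M] [ChartedSpace (EuclideanHalfSpace 3) M]
  [IsManifold (𝓡∂ 3) ∞ M] {V : Type*} [NormedAddCommGroup V] [NormedSpace ℝ V]
  {U : Set M} {ψ : M → ℝ}

/-- The derivative of a parametrization, as a linear map into the model space. -/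
def dpar (κ : V → M) (x : V) : V →L[ℝ] E3 := mfderiv 𝓘(ℝ, V) (𝓡∂ 3) κ x

/-- The derivative of a function on `M`, as a linear map on the model space. -/
def dfun {W : Type*} [NormedAddCommGroup W] [NormedSpace ℝ W] (f : M → W) (p : M) : E3 →L[ℝ] W :=
  mfderiv (𝓡∂ 3) 𝓘(ℝ, W) f p

variable {W : Type*} [NormedAddCommGroup W] [NormedSpace ℝ W] {f : M → W}

omit [IsManifold (𝓡∂ 3) ∞ M] in
/-- Functions on `M` in a local parametrization. -/
theorem contDiffAt_comp_param (hU : IsOpen U) (hf : ContMDiffOn (𝓡∂ 3) 𝓘(ℝ, W) ∞ f U) {κ : V → M}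
    {x : V} (hκ : IsLocalDiffeomorphAt 𝓘(ℝ, V) (𝓡∂ 3) ∞ κ x) (hx : κ x ∈ U) :
    ContDiffAt ℝ ∞ (f ∘ κ) x :=
  ((hf.contMDiffAt (hU.mem_nhds hx)).comp x hκ.contMDiffAt).contDiffAt

omit [IsManifold (𝓡∂ 3) ∞ M] in
theorem hasFDerivAt_comp_param {κ : V → M} {x : V} (hf : MDifferentiableAt (𝓡∂ 3) 𝓘(ℝ, W) f (κ x))
    (hκ : MDifferentiableAt 𝓘(ℝ, V) (𝓡∂ 3) κ x) :
    HasFDerivAt (f ∘ κ) ((dfun f (κ x)).comp (dpar κ x)) x :=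
  HasMFDerivAt.hasFDerivAt (hf.hasMFDerivAt.comp x hκ.hasMFDerivAt)

theorem dfun_chart_self (p : M) : dfun (extChartAt (𝓡∂ 3) p) p = ContinuousLinearMap.id ℝ E3 :=
  mfderiv_chart_self p

theorem fderiv_chart_comp {κ : V → M} {x : V} (hκ : MDifferentiableAt 𝓘(ℝ, V) (𝓡∂ 3) κ x) :
    fderiv ℝ (extChartAt (𝓡∂ 3) (κ x) ∘ κ) x = dpar κ x := by
  have h1 := mdifferentiableAt_extChartAt (I := 𝓡∂ 3) (mem_chart_source (EuclideanHalfSpace 3) (κ x))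
  rw [(hasFDerivAt_comp_param h1 hκ).fderiv, dfun_chart_self]
  rfl

/-- The Hessian at a critical point can be computed in any local parametrization. -/
theorem fderiv_fderiv_comp_param (hU : IsOpen U) (hψ : ContMDiffOn (𝓡∂ 3) 𝓘(ℝ, ℝ) ∞ ψ U) {κ : V → M}
    {x : V} (hκ : IsLocalDiffeomorphAt 𝓘(ℝ, V) (𝓡∂ 3) ∞ κ x) (hx : κ x ∈ U)
    (h0 : dfun ψ (κ x) = 0) (v w : V) :
    fderiv ℝ (fderiv ℝ (ψ ∘ κ)) x v w = hessianAt ψ (κ x) (dpar κ x v) (dpar κ x w) := by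
  have hp := mem_chartDiffeo_source (interior_of_isLocalDiffeomorphAt hκ)
  have hs : IsLocalDiffeomorphAt 𝓘(ℝ, E3) (𝓡∂ 3) ∞ (extChartAt (𝓡∂ 3) (κ x)).symm
      (extChartAt (𝓡∂ 3) (κ x) (κ x)) :=
    (chartDiffeo (κ x)).symm.isLocalDiffeomorphAt _ _ _ ((chartDiffeo (κ x)).map_source hp)
  have hinv : (extChartAt (𝓡∂ 3) (κ x)).symm (extChartAt (𝓡∂ 3) (κ x) (κ x)) = κ x :=
    extChartAt_to_inv (κ x)
  have e1 : ψ ∘ κ =ᶠ[𝓝 x] (ψ ∘ (extChartAt (𝓡∂ 3) (κ x)).symm) ∘ (extChartAt (𝓡∂ 3) (κ x) ∘ κ) := by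
    filter_upwards [hκ.contMDiffAt.continuousAt ((chartDiffeo (κ x)).open_source.mem_nhds hp)]
      with z hz
    exact congrArg ψ ((chartDiffeo (κ x)).left_inv hz).symm
  have h0' : fderiv ℝ (ψ ∘ (extChartAt (𝓡∂ 3) (κ x)).symm) ((extChartAt (𝓡∂ 3) (κ x) ∘ κ) x) = 0 := by
    have hd : MDifferentiableAt (𝓡∂ 3) 𝓘(ℝ, ℝ) ψ (κ x) :=
      (hψ.contMDiffAt (hU.mem_nhds hx)).mdifferentiableAt (by simp)
    rw [← hinv] at hd h0
    rw [Function.comp_apply, (hasFDerivAt_comp_param hd (hs.mdifferentiableAt (by simp))).fderiv, h0,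
      ContinuousLinearMap.zero_comp]
  have c1 : ContDiffAt ℝ ∞ (ψ ∘ (extChartAt (𝓡∂ 3) (κ x)).symm)
      ((extChartAt (𝓡∂ 3) (κ x) ∘ κ) x) :=
    contDiffAt_comp_param hU hψ hs (by rw [Function.comp_apply, hinv]; exact hx)
  rw [(e1.fderiv).fderiv_eq, fderiv_fderiv_comp_of_critical c1 (contDiffAt_chart_comp hκ hp) h0',
    fderiv_chart_comp (hκ.mdifferentiableAt (by simp))]
  exact (hessianAt_eq ψ (κ x) _ _).symm

end Potential

/-! ### The periodic orbit -/

section Orbit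

variable {M : Type*} [TopologicalSpace M] [T2Space M] [ChartedSpace (EuclideanHalfSpace 3) M]
  [IsManifold (𝓡∂ 3) ∞ M] {B : VField M} {c : ℝ → M}

omit [T2Space M] in
theorem hasDerivAt_chart_curve (hc : IsMIntegralCurve (I := 𝓡∂ 3) c B) {p : M} {t : ℝ}
    (ht : c t ∈ (chartDiffeo p).source) :
    HasDerivAt (extChartAt (𝓡∂ 3) p ∘ c) (chartField B p (extChartAt (𝓡∂ 3) p (c t))) t := by
  have h1 : MDifferentiableAt (𝓡∂ 3) 𝓘(ℝ, E3) (extChartAt (𝓡∂ 3) p) (c t) :=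
    ((chartDiffeo p).isLocalDiffeomorphAt _ _ _ ht).mdifferentiableAt (by simp)
  have h2 : HasFDerivAt (extChartAt (𝓡∂ 3) p ∘ c) ((dfun (extChartAt (𝓡∂ 3) p) (c t)).comp
      (ContinuousLinearMap.smulRight (1 : ℝ →L[ℝ] ℝ) (B (c t) : E3))) t :=
    HasMFDerivAt.hasFDerivAt (h1.hasMFDerivAt.comp t (hc t))
  have h3 : ∀ q, q = c t → (dfun (extChartAt (𝓡∂ 3) p) q (B q) : E3) =
      dfun (extChartAt (𝓡∂ 3) p) (c t) (B (c t)) := by rintro q rfl; rfl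
  have h4 : chartField B p (extChartAt (𝓡∂ 3) p (c t)) =
      dfun (extChartAt (𝓡∂ 3) p) (c t) (B (c t)) := h3 _ ((chartDiffeo p).left_inv ht)
  rw [h4]
  have h5 : ∀ (L : E3 →L[ℝ] E3) (b : E3),
      L.comp (ContinuousLinearMap.smulRight (1 : ℝ →L[ℝ] ℝ) b) 1 = L b := by simp
  exact h2.hasDerivAt.congr_deriv (h5 _ _)

omit [T2Space M] in
/-- Integral curves of smooth vector fields are smooth. -/
theorem contDiffOn_chart_curve (hB : SmoothField B) (hc : IsMIntegralCurve (I := 𝓡∂ 3) c B) (p : M) :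
    ContDiffOn ℝ ∞ (extChartAt (𝓡∂ 3) p ∘ c) (c ⁻¹' (chartDiffeo p).source) := by
  have hO : IsOpen (c ⁻¹' (chartDiffeo p).source) :=
    (chartDiffeo p).open_source.preimage hc.continuous
  have key : ∀ n : ℕ, ContDiffOn ℝ n (extChartAt (𝓡∂ 3) p ∘ c) (c ⁻¹' (chartDiffeo p).source) := by
    intro n
    induction n with
    | zero =>
      rw [Nat.cast_zero, contDiffOn_zero]
      exact fun t ht => (hasDerivAt_chart_curve hc ht).continuousAt.continuousWithinAt
    | succ n ih =>
      rw [Nat.cast_succ, contDiffOn_succ_iff_deriv_of_isOpen hO]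
      refine ⟨fun t ht => (hasDerivAt_chart_curve hc ht).differentiableAt.differentiableWithinAt,
        by simp, ?_⟩
      refine (((contDiffOn_chartField hB p).of_le (by exact_mod_cast le_top)).comp ih
        fun t ht => (chartDiffeo p).map_source ht).congr fun t ht => ?_
      exact (hasDerivAt_chart_curve hc ht).deriv
  exact contDiffOn_infty.2 key

/-- A nonconstant periodic integral curve has a minimal period: the group of its periods is closed, and it
is neither trivial nor all of `ℝ`. -/
theorem exists_minimal_period (hB : SmoothField B) (hc : IsMIntegralCurve (I := 𝓡∂ 3) c B)
    {T₀ : ℝ} (hT₀ : 0 < T₀) (hper : Function.Periodic c T₀) (hi : ∀ t, c t ∈ (𝓡∂ 3).interior M)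
    (hne : B (c 0) ≠ 0) :
    ∃ T : ℝ, 0 < T ∧ Function.Periodic c T ∧ ∀ s t, c s = c t → ∃ n : ℤ, s = t + n * T := by
  let H : AddSubgroup ℝ := {
    carrier := {τ | Function.Periodic c τ}
    zero_mem' := fun t => by simp
    add_mem' := fun ha hb => ha.add_period hb
    neg_mem' := fun ha => ha.neg }
  have hmem : ∀ s t, c s = c t → s - t ∈ H := by
    intro s t hst
    have := isMIntegralCurve_eq_of_contMDiff (t₀ := t) (γ := c) (γ' := c ∘ (· + (s - t))) hi
      (hB.of_le (by simp)) hc (hc.comp_add _) (by simp [hst])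
    intro u
    exact (congrFun this u).symm
  have hcl : IsClosed (H : Set ℝ) := by
    have : (H : Set ℝ) = ⋂ t, {τ | c (t + τ) = c t} := by ext τ; simp [H, Function.Periodic]
    rw [this]
    exact isClosed_iInter fun t => isClosed_eq (hc.continuous.comp (by fun_prop)) continuous_const
  -- if the periods were dense, the curve would be constant
  rcases H.dense_or_cyclic with hd | ⟨a, ha⟩
  · exfalso
    have huniv : (H : Set ℝ) = univ := by rw [← hcl.closure_eq]; exact hd.closure_eq
    have hconst : ∀ t, c t = c 0 := fun t => by
      have : t ∈ (H : Set ℝ) := by rw [huniv]; trivial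
      simpa using (show Function.Periodic c t from this) 0
    have hp := mem_chartDiffeo_source (hi 0)
    have h1 := hasDerivAt_chart_curve hc hp
    have h2 : extChartAt (𝓡∂ 3) (c 0) ∘ c = fun _ => extChartAt (𝓡∂ 3) (c 0) (c 0) := by
      ext1 t; simp [hconst t]
    rw [h2] at h1
    have h3 := h1.unique (hasDerivAt_const 0 _)
    have h4 : ∀ q, q = c 0 → (dfun (extChartAt (𝓡∂ 3) (c 0)) q (B q) : E3) = B (c 0) := by
      rintro q rfl
      rw [dfun_chart_self]; rfl
    exact hne ((h4 _ (extChartAt_to_inv (c 0))).symm.trans h3)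
  · rw [← AddSubgroup.zmultiples_eq_closure] at ha
    have ha0 : a ≠ 0 := by
      rintro rfl
      have : T₀ ∈ H := hper
      rw [ha] at this
      simp at this
      exact hT₀.ne' this
    have haH : Function.Periodic c a := by
      have : a ∈ H := by rw [ha]; exact AddSubgroup.mem_zmultiples a
      exact this
    have hz : ∀ s t, c s = c t → ∃ n : ℤ, s = t + n * a := by
      intro s t hst
      have := hmem s t hst
      rw [ha, AddSubgroup.mem_zmultiples_iff] at this
      obtain ⟨n, hn⟩ := this
      exact ⟨n, by rw [← zsmul_eq_mul, hn]; ring⟩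
    rcases ha0.lt_or_gt with h | h
    · refine ⟨-a, by linarith, haH.neg, fun s t hst => ?_⟩
      obtain ⟨n, hn⟩ := hz s t hst
      exact ⟨-n, by rw [hn]; push_cast; ring⟩
    · exact ⟨a, h, haH, hz⟩

/-- Points of a simple closed curve close to `c t₀` have parameters close to `t₀`. -/
theorem exists_nhds_param_close {N : Type*} [TopologicalSpace N] [T2Space N] {c : ℝ → N} {T : ℝ}
    (hT : 0 < T) (hc : Continuous c) (hper : Function.Periodic c T)
    (hinj : ∀ s t, c s = c t → ∃ n : ℤ, s = t + n * T) (t₀ : ℝ) {O : Set ℝ} (hO : O ∈ 𝓝 t₀) :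
    ∃ G ∈ 𝓝 (c t₀), ∀ t, c t ∈ G → ∃ n : ℤ, t - n * T ∈ O := by
  obtain ⟨O', hO'O, hO', ht₀⟩ := mem_nhds_iff.1 hO
  -- the part of a fundamental domain outside `O`; its image is compact and does not contain `c t₀`
  set K : Set ℝ := Icc (t₀ - T / 2) (t₀ + T / 2) \ O'
  have hK : IsCompact K := isCompact_Icc.diff hO'
  have hcK : c t₀ ∉ c '' K := by
    rintro ⟨t, ht, he⟩
    obtain ⟨n, hn⟩ := hinj _ _ he
    have h1 : |(n : ℝ)| < 1 := by
      have h2 : |n * T| ≤ T / 2 := by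
        rw [abs_le]; constructor <;> linarith [ht.1.1, ht.1.2]
      rw [abs_mul, abs_of_pos hT] at h2
      nlinarith
    have h3 : n = 0 := by
      have : |n| < 1 := by exact_mod_cast h1
      exact Int.abs_lt_one_iff.1 this
    rw [h3] at hn
    apply ht.2
    rw [hn]
    simpa using ht₀
  refine ⟨(c '' K)ᶜ, (hK.image hc).isClosed.isOpen_compl.mem_nhds hcK, fun t ht => ?_⟩
  refine ⟨round ((t - t₀) / T), ?_⟩
  by_contra hcon
  apply ht
  refine ⟨t - round ((t - t₀) / T) * T, ⟨?_, fun h => hcon (hO'O h)⟩, ?_⟩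
  · have h1 := abs_sub_round ((t - t₀) / T)
    have h2 : t - t₀ = (t - t₀) / T * T := by field_simp
    rw [abs_le] at h1
    constructor <;> nlinarith
  · exact hper.sub_int_mul_eq _

end Orbit

section Orbit

variable {M : Type*} [TopologicalSpace M] [T2Space M] [ChartedSpace (EuclideanHalfSpace 3) M]
  [IsManifold (𝓡∂ 3) ∞ M] {B : VField M} {c : ℝ → M}

omit [T2Space M] in
theorem chartField_self (B : VField M) (p : M) :
    chartField B p (extChartAt (𝓡∂ 3) p p) = B p := by
  have h : ∀ q, q = p → (dfun (extChartAt (𝓡∂ 3) p) q (B q) : E3) = B p := by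
    rintro q rfl
    rw [dfun_chart_self]; rfl
  exact h _ (extChartAt_to_inv p)

omit [T2Space M] in
/-- Near each point of an integral curve, time extends to a smooth function. -/
theorem exists_local_time (hB : SmoothField B) (hc : IsMIntegralCurve (I := 𝓡∂ 3) c B) {t₀ : ℝ}
    (hi : c t₀ ∈ (𝓡∂ 3).interior M) (hne : B (c t₀) ≠ 0) :
    ∃ O, IsOpen O ∧ c t₀ ∈ O ∧ ∃ τ : M → ℝ, ContMDiffOn (𝓡∂ 3) 𝓘(ℝ, ℝ) ∞ τ O ∧
      ∀ᶠ t in 𝓝 t₀, τ (c t) = t := by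
  have hp := mem_chartDiffeo_source hi
  set p := c t₀ with hpdef
  have hO : IsOpen (c ⁻¹' (chartDiffeo p).source) :=
    (chartDiffeo p).open_source.preimage hc.continuous
  obtain ⟨b, hb⟩ : ∃ b : E3, b = B p := ⟨_, rfl⟩
  have hb0 : b ≠ 0 := by rw [hb]; exact hne
  -- a linear function which is increasing along the curve in the chart, composed with the inverse of
  -- its restriction to the curve
  obtain ⟨ℓ, hℓ⟩ : ∃ ℓ : E3 →L[ℝ] ℝ, ℓ b ≠ 0 := SeparatingDual.exists_ne_zero hb0
  have h1 : ContDiffOn ℝ ∞ (fun t => ℓ (extChartAt (𝓡∂ 3) p (c t))) (c ⁻¹' (chartDiffeo p).source) :=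
    ℓ.contDiff.comp_contDiffOn (contDiffOn_chart_curve hB hc p)
  have h2 : HasDerivAt (fun t => ℓ (extChartAt (𝓡∂ 3) p (c t))) (ℓ b) t₀ := by
    have := hasDerivAt_chart_curve hc hp
    rw [chartField_self, ← hb] at this
    exact ℓ.hasFDerivAt.comp_hasDerivAt t₀ this
  have h3 : IsLocalDiffeomorphAt 𝓘(ℝ, ℝ) 𝓘(ℝ, ℝ) ∞ (fun t => ℓ (extChartAt (𝓡∂ 3) p (c t))) t₀ := by
    refine isLocalDiffeomorphAt_of_fderiv_injective rfl hO h1 hp fun v hv => ?_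
    rw [h2.hasFDerivAt.fderiv] at hv
    simpa [hℓ] using hv
  have h4 : IsOpen ((chartDiffeo p).source ∩
      (fun q => ℓ (extChartAt (𝓡∂ 3) p q)) ⁻¹' h3.localInverse.source) :=
    (ℓ.continuous.comp_continuousOn (chartDiffeo p).contMDiffOn.continuousOn).isOpen_inter_preimage
      (chartDiffeo p).open_source h3.localInverse_open_source
  refine ⟨_, h4, ⟨hp, h3.localInverse_mem_source⟩,
    fun q => h3.localInverse (ℓ (extChartAt (𝓡∂ 3) p q)), ?_, ?_⟩
  · exact h3.localInverse_contMDiffOn.comp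
      ((ℓ.contMDiff.contMDiffOn (s := univ)).comp ((chartDiffeo p).contMDiffOn.mono inter_subset_left)
        fun q _ => mem_univ _) fun q hq => hq.2
  · exact h3.localInverse_eventuallyEq_left

/-- A smooth function which measures time along the orbit, as an angle. -/
theorem exists_angle [SigmaCompactSpace M] (hB : SmoothField B) (hc : IsMIntegralCurve (I := 𝓡∂ 3) c B) {T : ℝ}
    (hT : 0 < T) (hper : Function.Periodic c T) (hinj : ∀ s t, c s = c t → ∃ n : ℤ, s = t + n * T)
    (hi : ∀ t, c t ∈ (𝓡∂ 3).interior M) (hne : ∀ t, B (c t) ≠ 0) :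
    ∃ W : M → ℂ, ContMDiff (𝓡∂ 3) 𝓘(ℝ, ℂ) ∞ W ∧ ∀ t, W (c t) = Circle.exp (2 * Real.pi / T * t) := by
  have hexp : ∀ (t : ℝ) (n : ℤ), Circle.exp (2 * Real.pi / T * (t - n * T)) =
      Circle.exp (2 * Real.pi / T * t) := by
    intro t n
    have : 2 * Real.pi / T * (t - n * T) = 2 * Real.pi / T * t - n * (2 * Real.pi) := by
      field_simp
    rw [this]
    exact Circle.periodic_exp.sub_int_mul_eq n
  have hγ : IsClosed (range c) := by
    have : range c = c '' Icc 0 T := by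
      refine subset_antisymm ?_ (image_subset_range _ _)
      rintro _ ⟨t, rfl⟩
      obtain ⟨y, hy, he⟩ := hper.exists_mem_Ico₀ hT t
      exact ⟨y, Ico_subset_Icc_self hy, he.symm⟩
    rw [this]
    exact (isCompact_Icc.image hc.continuous).isClosed
  -- The values are prescribed on the orbit only, and hence lie in convex sets; local solutions can be
  -- patched by a partition of unity.
  let S : M → Set ℂ := fun q => {w | ∀ t, c t = q → w = Circle.exp (2 * Real.pi / T * t)}
  have hconv : ∀ q, Convex ℝ (S q) := by
    intro q w hw w' hw' a b _ _ hab t ht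
    rw [hw t ht, hw' t ht, ← add_smul, hab, one_smul]
  have hloc : ∀ q, ∃ O ∈ 𝓝 q, ∃ g : M → ℂ, ContMDiffOn (𝓡∂ 3) 𝓘(ℝ, ℂ) ∞ g O ∧ ∀ y ∈ O, g y ∈ S y := by
    intro q
    by_cases hq : q ∈ range c
    · obtain ⟨t₀, rfl⟩ := hq
      obtain ⟨O, hO, hpO, τ, hτ, hev⟩ := exists_local_time hB hc (hi t₀) (hne t₀)
      obtain ⟨G, hG, hGt⟩ := exists_nhds_param_close hT hc.continuous hper hinj t₀ hev
      refine ⟨O ∩ G, Filter.inter_mem (hO.mem_nhds hpO) hG,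
        fun q => Circle.exp (2 * Real.pi / T * τ q), ?_, ?_⟩
      · have h1 : ContDiff ℝ ∞ fun s : ℝ => (Circle.exp (2 * Real.pi / T * s) : ℂ) := by
          simp only [Circle.coe_exp]
          exact Complex.contDiff_exp.comp ((Complex.ofRealCLM.contDiff.comp
            (contDiff_const.mul contDiff_id)).mul contDiff_const)
        exact h1.contMDiff.comp_contMDiffOn (hτ.mono inter_subset_left)
      · rintro _ ⟨-, hy⟩ t rfl
        obtain ⟨n, hn⟩ := hGt t hy
        have hn' : τ (c (t - n * T)) = t - n * T := hn
        rw [hper.sub_int_mul_eq n] at hn'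
        have : (Circle.exp (2 * Real.pi / T * τ (c t)) : ℂ) = Circle.exp (2 * Real.pi / T * t) := by
          rw [hn', hexp]
        exact this
    · refine ⟨(range c)ᶜ, hγ.isOpen_compl.mem_nhds hq, fun _ => 0, contMDiffOn_const, ?_⟩
      intro y hy t ht
      exact absurd ⟨t, ht⟩ hy
  obtain ⟨W, hW⟩ := exists_contMDiffMap_forall_mem_convex_of_local (n := ⊤) (𝓡∂ 3) hconv hloc
  exact ⟨W, W.contMDiff, fun t => hW (c t) t rfl⟩

end Orbit

/-! ### Functions vanishing on the axis -/

/-- A symmetric bilinear form with kernel spanned by `b` represents all covectors which vanish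
at `b`. -/
theorem exists_bilin_eq {V : Type*} [NormedAddCommGroup V] [NormedSpace ℝ V] [FiniteDimensional ℝ V]
    {h : V →L[ℝ] V →L[ℝ] ℝ} (hsymm : ∀ v w, h v w = h w v) {b : V}
    (hker : ∀ v, (∀ w, h v w = 0) ↔ v ∈ Submodule.span ℝ {b}) {θ : V →L[ℝ] ℝ} (hθ : θ b = 0) :
    ∃ u, ∀ v, h v u = θ v := by
  let H : V →ₗ[ℝ] Module.Dual ℝ V := (ContinuousLinearMap.coeLM ℝ).comp h.toLinearMap
  have hH : ∀ v w, H v w = h v w := fun _ _ => rfl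
  have hk : LinearMap.ker H = Submodule.span ℝ {b} := by
    ext v
    rw [← hker v, LinearMap.mem_ker, LinearMap.ext_iff]
    rfl
  have hle : LinearMap.range H ≤ (Submodule.span ℝ {b}).dualAnnihilator := by
    rintro _ ⟨v, rfl⟩
    rw [Submodule.mem_dualAnnihilator]
    intro w hw
    rw [hH, hsymm]
    exact (hker w).2 hw v
  have h1 := LinearMap.finrank_range_add_finrank_ker H
  have h2 := Subspace.finrank_add_finrank_dualAnnihilator_eq (Submodule.span ℝ {b})
  rw [hk] at h1
  have heq := Submodule.eq_of_le_of_finrank_eq hle (by omega)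
  have hmem : (θ : V →ₗ[ℝ] ℝ) ∈ (Submodule.span ℝ {b}).dualAnnihilator := by
    rw [Submodule.mem_dualAnnihilator]
    intro w hw
    obtain ⟨r, rfl⟩ := Submodule.mem_span_singleton.1 hw
    simp [hθ]
  rw [← heq] at hmem
  obtain ⟨u, hu⟩ := hmem
  refine ⟨u, fun v => ?_⟩
  rw [hsymm, ← hH, hu]
  rfl

section Potential

variable {M : Type*} [TopologicalSpace M] [T2Space M] [ChartedSpace (EuclideanHalfSpace 3) M]
  [IsManifold (𝓡∂ 3) ∞ M] {b : M → E3} {γ U : Set M} {ψ : M → ℝ}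

omit [T2Space M] in
theorem isLocalDiffeomorphAt_chart_symm {p q : M} (hq : q ∈ (chartDiffeo p).source) :
    IsLocalDiffeomorphAt 𝓘(ℝ, E3) (𝓡∂ 3) ∞ (extChartAt (𝓡∂ 3) p).symm (extChartAt (𝓡∂ 3) p q) :=
  (chartDiffeo p).symm.isLocalDiffeomorphAt _ _ _ ((chartDiffeo p).map_source hq)

omit [T2Space M] in
theorem hasMFDerivAt_chart {p q : M} (hq : q ∈ (chartDiffeo p).source) :
    HasMFDerivAt (𝓡∂ 3) 𝓘(ℝ, E3) (extChartAt (𝓡∂ 3) p) q (dfun (extChartAt (𝓡∂ 3) p) q) :=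
  (((chartDiffeo p).isLocalDiffeomorphAt _ _ _ hq).mdifferentiableAt (by simp)).hasMFDerivAt

omit [T2Space M] in
theorem dpar_chart_symm_comp {p q : M} (hq : q ∈ (chartDiffeo p).source) :
    (dpar (extChartAt (𝓡∂ 3) p).symm (extChartAt (𝓡∂ 3) p q)).comp (dfun (extChartAt (𝓡∂ 3) p) q) =
      ContinuousLinearMap.id ℝ E3 ∧
    (dfun (extChartAt (𝓡∂ 3) p) q).comp (dpar (extChartAt (𝓡∂ 3) p).symm (extChartAt (𝓡∂ 3) p q)) =
      ContinuousLinearMap.id ℝ E3 := by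
  have hr : range (𝓡∂ 3) ∈ 𝓝 (extChartAt (𝓡∂ 3) p q) :=
    Filter.mem_of_superset (isOpen_interior.mem_nhds ((chartDiffeo p).map_source hq).2)
      interior_subset
  have h1 := mfderivWithin_extChartAt_symm_comp_mfderiv_extChartAt' (I := 𝓡∂ 3) hq.1
  have h2 := mfderiv_extChartAt_comp_mfderivWithin_extChartAt_symm' (I := 𝓡∂ 3) hq.1
  rw [mfderivWithin_of_mem_nhds hr] at h1 h2
  exact ⟨h1, h2⟩

omit [T2Space M] in
/-- The derivative of a function on `M` whose expression in a chart is the derivative of `ψ`. -/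
theorem dfun_fderiv_chart (hU : IsOpen U) (hψ : ContMDiffOn (𝓡∂ 3) 𝓘(ℝ, ℝ) ∞ ψ U)
    {p q : M} (hq : q ∈ (chartDiffeo p).source) (hqU : q ∈ U) (h0 : dfun ψ q = 0) (v a : E3) :
    dfun (fun q' => fderiv ℝ (ψ ∘ (extChartAt (𝓡∂ 3) p).symm) (extChartAt (𝓡∂ 3) p q')) q v a =
      hessianAt ψ q v (dpar (extChartAt (𝓡∂ 3) p).symm (extChartAt (𝓡∂ 3) p q) a) := by
  have hs := isLocalDiffeomorphAt_chart_symm hq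
  have hinv : (extChartAt (𝓡∂ 3) p).symm (extChartAt (𝓡∂ 3) p q) = q := (chartDiffeo p).left_inv hq
  have hg : ContDiffAt ℝ ∞ (ψ ∘ (extChartAt (𝓡∂ 3) p).symm) (extChartAt (𝓡∂ 3) p q) :=
    contDiffAt_comp_param hU hψ hs (by rw [hinv]; exact hqU)
  have hd : DifferentiableAt ℝ (fderiv ℝ (ψ ∘ (extChartAt (𝓡∂ 3) p).symm)) (extChartAt (𝓡∂ 3) p q) :=
    (hg.fderiv_right (m := ∞) (by simp)).differentiableAt (by simp)
  have h1 : dfun (fun q' => fderiv ℝ (ψ ∘ (extChartAt (𝓡∂ 3) p).symm) (extChartAt (𝓡∂ 3) p q')) q =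
      (fderiv ℝ (fderiv ℝ (ψ ∘ (extChartAt (𝓡∂ 3) p).symm)) (extChartAt (𝓡∂ 3) p q)).comp
        (dfun (extChartAt (𝓡∂ 3) p) q) :=
    (hd.hasFDerivAt.hasMFDerivAt.comp q (hasMFDerivAt_chart hq)).mfderiv
  have h2 := fderiv_fderiv_comp_param hU hψ hs (by rw [hinv]; exact hqU) (by rw [hinv]; exact h0)
    (dfun (extChartAt (𝓡∂ 3) p) q v) a
  have h3 : ∀ q', q' = q → ∀ u w : E3, hessianAt ψ q' u w = hessianAt ψ q u w := by
    rintro q' rfl u w; rfl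
  rw [h1, ContinuousLinearMap.comp_apply, h2]
  refine (h3 _ hinv _ _).trans ?_
  have h4 := congrArg (fun f => f v) (dpar_chart_symm_comp hq).1
  rw [ContinuousLinearMap.comp_apply] at h4
  rw [h4]
  rfl

omit [T2Space M] [IsManifold (𝓡∂ 3) ∞ M] in
/-- Leibniz rule at a zero of `g`, where the derivative of `χ` does not contribute. -/
theorem hasMFDerivAt_smul_of_eq_zero {W : Type*} [NormedAddCommGroup W] [NormedSpace ℝ W]
    {χ : M → ℝ} {g : M → W} {p : M} (hχ : MDifferentiableAt (𝓡∂ 3) 𝓘(ℝ, ℝ) χ p)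
    (hg : MDifferentiableAt (𝓡∂ 3) 𝓘(ℝ, W) g p) (h0 : g p = 0) :
    HasMFDerivAt (𝓡∂ 3) 𝓘(ℝ, W) (fun q => χ q • g q) p (χ p • dfun g p) := by
  have h1 : HasMFDerivAt (𝓡∂ 3) 𝓘(ℝ, ℝ × W) (fun q => (χ q, g q)) p
      ((dfun χ p).prod (dfun g p)) :=
    ⟨hχ.hasMFDerivAt.1.prodMk hg.hasMFDerivAt.1, hχ.hasMFDerivAt.2.prodMk hg.hasMFDerivAt.2⟩
  have h2 : HasFDerivAt (fun y : ℝ × W => y.1 • y.2)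
      ((χ p) • ContinuousLinearMap.snd ℝ ℝ W) ((χ p, g p) : ℝ × W) := by
    have := (hasFDerivAt_fst (𝕜 := ℝ) (p := (χ p, g p))).smul
      (hasFDerivAt_snd (𝕜 := ℝ) (p := (χ p, g p)))
    refine this.congr_fderiv ?_
    ext <;> simp [h0]
  refine (h2.hasMFDerivAt.comp p h1).congr_mfderiv ?_
  ext v
  rfl

omit [T2Space M] [IsManifold (𝓡∂ 3) ∞ M] in
theorem hasMFDerivAt_finset_sum {W ι : Type*} [NormedAddCommGroup W] [NormedSpace ℝ W]
    (t : Finset ι) {f : ι → M → W} {f' : ι → E3 →L[ℝ] W} {p : M}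
    (hf : ∀ i, HasMFDerivAt (𝓡∂ 3) 𝓘(ℝ, W) (f i) p (f' i)) :
    HasMFDerivAt (𝓡∂ 3) 𝓘(ℝ, W) (fun q => ∑ i ∈ t, f i q) p (∑ i ∈ t, f' i) := by
  classical
  induction t using Finset.induction_on with
  | empty => simpa using! hasMFDerivAt_const ..
  | insert i t hi ih =>
    have h1 : (fun q => ∑ j ∈ insert i t, f j q) = f i + fun q => ∑ j ∈ t, f j q :=
      funext fun q => Finset.sum_insert hi
    have h2 : ∑ j ∈ insert i t, f' j = f' i + ∑ j ∈ t, f' j := Finset.sum_insert hi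
    have h3 : ∀ L : E3 →L[ℝ] W, L = f' i + ∑ j ∈ t, f' j →
        HasMFDerivAt (𝓡∂ 3) 𝓘(ℝ, W) (fun q => ∑ j ∈ insert i t, f j q) p L := by
      rintro _ rfl
      rw [h1]
      exact (hf i).add ih
    exact h3 _ h2

/-- The Hessian of `ψ` identifies the normal bundle of `γ` with its dual; hence there is a family
of functions vanishing on `γ`, depending linearly on finitely many parameters, whose derivatives at
each point of `γ` fill the conormal space. -/
theorem exists_conormal_family (hU : IsOpen U) (hγU : γ ⊆ U) (hψ : ContMDiffOn (𝓡∂ 3) 𝓘(ℝ, ℝ) ∞ ψ U)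
    (hγ : IsCompact γ) (hi : γ ⊆ (𝓡∂ 3).interior M) (h0 : ∀ p ∈ γ, dfun ψ p = 0)
    (hess : ∀ p ∈ γ, ∀ v : E3, (∀ w : E3, hessianAt ψ p v w = 0) ↔
      v ∈ Submodule.span ℝ {b p}) :
    ∃ (J : Finset M) (𝓛 : M → (J → E3) →L[ℝ] ℝ), ContMDiff (𝓡∂ 3) 𝓘(ℝ, (J → E3) →L[ℝ] ℝ) ∞ 𝓛 ∧
      (∀ p ∈ γ, 𝓛 p = 0) ∧ (∀ p ∈ γ, dfun 𝓛 p (b p) = 0) ∧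
      ∀ p ∈ γ, ∀ θ : E3 →L[ℝ] ℝ, θ (b p) = 0 → ∃ a, ∀ v, dfun 𝓛 p v a = θ v := by
  classical
  -- the derivative of `ψ` in the chart around `p`; it vanishes on `γ`, and its derivative is the Hessian
  let g : M → M → E3 →L[ℝ] ℝ := fun p q =>
    fderiv ℝ (ψ ∘ (extChartAt (𝓡∂ 3) p).symm) (extChartAt (𝓡∂ 3) p q)
  let O : M → Set M := fun p => (chartDiffeo p).source ∩ U
  have hO : ∀ p, IsOpen (O p) := fun p => (chartDiffeo p).open_source.inter hU
  have hg : ∀ p, ∀ q ∈ O p, ContMDiffAt (𝓡∂ 3) 𝓘(ℝ, E3 →L[ℝ] ℝ) ∞ (g p) q := by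
    intro p q hq
    have h1 : ContDiffAt ℝ ∞ (ψ ∘ (extChartAt (𝓡∂ 3) p).symm) (extChartAt (𝓡∂ 3) p q) :=
      contDiffAt_comp_param hU hψ (isLocalDiffeomorphAt_chart_symm hq.1)
        (by rw [show (extChartAt (𝓡∂ 3) p).symm (extChartAt (𝓡∂ 3) p q) = q from
          (chartDiffeo p).left_inv hq.1]; exact hq.2)
    exact (h1.fderiv_right (m := ∞) (by simp)).contMDiffAt.comp q
      ((chartDiffeo p).isLocalDiffeomorphAt _ _ _ hq.1).contMDiffAt
  have hg0 : ∀ p, ∀ q ∈ O p, q ∈ γ → g p q = 0 := by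
    intro p q hq hqγ
    have hinv : (extChartAt (𝓡∂ 3) p).symm (extChartAt (𝓡∂ 3) p q) = q :=
      (chartDiffeo p).left_inv hq.1
    have hd : MDifferentiableAt (𝓡∂ 3) 𝓘(ℝ, ℝ) ψ q :=
      (hψ.contMDiffAt (hU.mem_nhds hq.2)).mdifferentiableAt (by simp)
    have h2 := h0 q hqγ
    rw [← hinv] at hd h2
    have := hasFDerivAt_comp_param hd
      ((isLocalDiffeomorphAt_chart_symm hq.1).mdifferentiableAt (by simp))
    rw [h2, ContinuousLinearMap.zero_comp] at this
    exact this.fderiv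
  have hγO : ∀ p ∈ γ, O p ∈ 𝓝 p := fun p hp =>
    (hO p).mem_nhds ⟨mem_chartDiffeo_source (hi hp), hγU hp⟩
  have hχ : ∀ p : M, ∃ χ : SmoothBumpFunction (𝓡∂ 3) p, p ∈ γ → tsupport χ ⊆ O p := by
    intro p
    by_cases hp : p ∈ γ
    · obtain ⟨χ, -, h⟩ := (SmoothBumpFunction.nhds_basis_tsupport (I := 𝓡∂ 3) p).mem_iff.1 (hγO p hp)
      exact ⟨χ, fun _ => h⟩
    · exact ⟨Classical.arbitrary _, fun h => absurd h hp⟩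
  choose χ hχO using hχ
  obtain ⟨J, hJγ, hJ⟩ := hγ.elim_nhds_subcover (fun p => Function.support (χ p))
    fun p _ => (χ p).support_mem_nhds
  -- cut off by bump functions, finitely many of which cover `γ`
  let G : M → M → E3 →L[ℝ] ℝ := fun p q => χ p q • g p q
  have hGs : ∀ p ∈ γ, ContMDiff (𝓡∂ 3) 𝓘(ℝ, E3 →L[ℝ] ℝ) ∞ (G p) := by
    intro p hp
    refine contMDiff_of_tsupport fun q hq => ?_
    exact (χ p).contMDiffAt.smul (hg p q (hχO p hp (tsupport_smul_subset_left _ _ hq)))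
  have hGγ : ∀ p ∈ γ, ∀ q ∈ γ, G p q = 0 := by
    intro p hp q hq
    by_cases h : q ∈ tsupport (χ p)
    · simp only [G, hg0 p q (hχO p hp h) hq, smul_zero]
    · simp only [G, image_eq_zero_of_notMem_tsupport h, zero_smul]
  have hGd : ∀ p ∈ γ, ∀ q ∈ γ, ∀ v a, dfun (G p) q v a = χ p q *
      hessianAt ψ q v (dpar (extChartAt (𝓡∂ 3) p).symm (extChartAt (𝓡∂ 3) p q) a) := by
    intro p hp q hq v a
    by_cases h : q ∈ tsupport (χ p)
    · have hqO := hχO p hp h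
      have h1 : dfun (G p) q = χ p q • dfun (g p) q :=
        (hasMFDerivAt_smul_of_eq_zero ((χ p).contMDiffAt.mdifferentiableAt (by simp))
          ((hg p q hqO).mdifferentiableAt (by simp)) (hg0 p q hqO hq)).mfderiv
      rw [h1]
      exact congrArg (χ p q * ·) (dfun_fderiv_chart hU hψ hqO.1 hqO.2 (h0 q hq) v a)
    · rw [image_eq_zero_of_notMem_tsupport h, zero_mul]
      have h1 : G p =ᶠ[𝓝 q] fun _ => 0 := by
        filter_upwards [(isClosed_tsupport (χ p)).isOpen_compl.mem_nhds h] with y hy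
        simp only [G, image_eq_zero_of_notMem_tsupport hy, zero_smul]
      have h2 : dfun (G p) q = 0 := by
        unfold dfun
        rw [h1.mfderiv_eq, mfderiv_const]
        rfl
      rw [h2]
      rfl
  let Λ : J → (E3 →L[ℝ] ℝ) →L[ℝ] ((J → E3) →L[ℝ] ℝ) := fun j =>
    (ContinuousLinearMap.compL ℝ (J → E3) E3 ℝ).flip (ContinuousLinearMap.proj j)
  let 𝓛 : M → (J → E3) →L[ℝ] ℝ := fun q => ∑ j : J, Λ j (G j q)
  have hLs : ContMDiff (𝓡∂ 3) 𝓘(ℝ, (J → E3) →L[ℝ] ℝ) ∞ 𝓛 :=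
    contMDiff_finsetSum fun j _ => (Λ j).contMDiff.comp (hGs j (hJγ j j.2))
  have hLd : ∀ q ∈ γ, ∀ v a, dfun 𝓛 q v a = ∑ j : J, dfun (G j) q v (a j) := by
    intro q hq v a
    have h1 : HasMFDerivAt (𝓡∂ 3) 𝓘(ℝ, (J → E3) →L[ℝ] ℝ) 𝓛 q
        (∑ j : J, (Λ j).comp (dfun (G j) q)) := by
      have hj : ∀ j : J, HasMFDerivAt (𝓡∂ 3) 𝓘(ℝ, (J → E3) →L[ℝ] ℝ) (fun q => Λ j (G j q)) q
          ((Λ j).comp (dfun (G j) q)) := fun j =>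
        HasMFDerivAt.comp q (Λ j).hasMFDerivAt
          ((hGs j (hJγ j j.2)).contMDiffAt.mdifferentiableAt (by simp)).hasMFDerivAt
      exact hasMFDerivAt_finset_sum Finset.univ hj
    have h2 : dfun 𝓛 q = ∑ j : J, (Λ j).comp (dfun (G j) q) := h1.mfderiv
    rw [h2]
    simp [Λ]
  refine ⟨J, 𝓛, hLs, fun q hq => ?_, fun q hq => ?_, fun q hq θ hθ => ?_⟩
  · simp only [𝓛]
    exact Finset.sum_eq_zero fun j _ => by rw [hGγ j (hJγ j j.2) q hq, map_zero]
  · ext1 a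
    refine (hLd q hq _ a).trans (Finset.sum_eq_zero fun j _ => ?_)
    rw [hGd j (hJγ j j.2) q hq, ((hess q hq (b q)).2 (Submodule.mem_span_singleton_self _)),
      mul_zero]
  · obtain ⟨j, hj, hqj⟩ := mem_iUnion₂.1 (hJ hq)
    have hqO : q ∈ O j := hχO j (hJγ j hj) (subset_tsupport _ hqj)
    have hqs := mem_chartDiffeo_source (hi hq)
    have hg2 : ContDiffAt ℝ ∞ (ψ ∘ (extChartAt (𝓡∂ 3) q).symm) (extChartAt (𝓡∂ 3) q q) :=
      contDiffAt_comp_param hU hψ (isLocalDiffeomorphAt_chart_symm hqs)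
        (by rw [extChartAt_to_inv]; exact hγU hq)
    obtain ⟨u, hu⟩ := exists_bilin_eq
      (h := fderiv ℝ (fderiv ℝ (ψ ∘ (extChartAt (𝓡∂ 3) q).symm)) (extChartAt (𝓡∂ 3) q q))
      (fun v w => hg2.isSymmSndFDerivAt (by simpa using WithTop.coe_le_coe.2 (le_top (a := (2 : ℕ∞)))) v w)
      (fun v => by
        rw [← hess q hq v]
        exact forall_congr' fun w => by rw [hessianAt_eq]) hθ
    -- only the component of a chart whose bump function does not vanish at `q` is used
    refine ⟨Pi.single ⟨j, hj⟩ ((χ j q)⁻¹ • dfun (extChartAt (𝓡∂ 3) j) q u), fun v => ?_⟩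
    rw [hLd q hq, Finset.sum_eq_single ⟨j, hj⟩]
    · rw [Pi.single_eq_same, map_smul, hGd j (hJγ j hj) q hq, smul_eq_mul,
        inv_mul_cancel_left₀ hqj]
      have h4 := congrArg (fun f => f u) (dpar_chart_symm_comp hqO.1).1
      rw [ContinuousLinearMap.comp_apply] at h4
      rw [h4, ← hu v, hessianAt_eq]
      rfl
    · intro i _ hi
      rw [Pi.single_eq_of_ne hi, map_zero]
    · simp

end Potential

/-! ### A generic choice of parameters -/

open Module in
/-- In a one-parameter family of pairs of linear equations, the parameters for which a pair is solved
at some time have codimension one. -/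
theorem exists_nhds_dimH_le {A : Type*} [NormedAddCommGroup A] [NormedSpace ℝ A]
    [FiniteDimensional ℝ A] {R : ℝ → A →L[ℝ] ℝ × ℝ} {t₀ : ℝ} (hR : ContDiffAt ℝ ∞ R t₀)
    (hsurj : Function.Surjective (R t₀)) :
    ∃ I ∈ 𝓝 t₀, dimH {a | ∃ t ∈ I, R t a = 0} ≤ ((finrank ℝ A - 1 : ℕ) : ENNReal) ∧
      1 ≤ finrank ℝ A := by
  obtain ⟨S₀, hS₀⟩ := (R t₀ : A →ₗ[ℝ] ℝ × ℝ).exists_rightInverse_of_surjective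
    (LinearMap.range_eq_top.2 hsurj)
  let S : ℝ × ℝ →L[ℝ] A := LinearMap.toContinuousLinearMap S₀
  have hS : (R t₀).comp S = 1 := ContinuousLinearMap.ext fun x => LinearMap.congr_fun hS₀ x
  have hR1 : ContDiffAt ℝ 1 R t₀ := hR.of_le (by simp)
  have hN : ContDiffAt ℝ 1 (fun t => (R t).comp S) t₀ := hR1.clm_comp contDiffAt_const
  have hinv : ContDiffAt ℝ 1 (fun t => Ring.inverse ((R t).comp S)) t₀ := by
    have := contDiffAt_ringInverse (n := 1) ℝ (1 : (ℝ × ℝ →L[ℝ] ℝ × ℝ)ˣ)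
    rw [Units.val_one, ← hS] at this
    exact this.comp t₀ hN
  have hunit : ∀ᶠ t in 𝓝 t₀, IsUnit ((R t).comp S) := by
    refine hN.continuousAt (Units.isOpen.mem_nhds ?_)
    rw [hS]; exact isUnit_one
  have hQ : ContDiffAt ℝ 1 (fun t => S.comp ((Ring.inverse ((R t).comp S)).comp (R t))) t₀ :=
    contDiffAt_const.clm_comp (hinv.clm_comp hR1)
  obtain ⟨u, hu, hQu⟩ := hQ.contDiffOn le_rfl (by simp)
  obtain ⟨r, hr, hball⟩ := Metric.mem_nhds_iff.1 (Filter.inter_mem hu hunit)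
  have hk1 := LinearMap.finrank_range_add_finrank_ker (R t₀ : A →ₗ[ℝ] ℝ × ℝ)
  rw [LinearMap.range_eq_top.2 hsurj, finrank_top] at hk1
  have hk2 : finrank ℝ (ℝ × ℝ) = 2 := by simp
  set K := LinearMap.ker (R t₀ : A →ₗ[ℝ] ℝ × ℝ)
  refine ⟨Metric.ball t₀ r, Metric.ball_mem_nhds _ hr, ?_, by omega⟩
  -- The kernels of `R t`, for `t` near `t₀`, are parametrized by the kernel `K` of `R t₀`, which has
  -- codimension two; with the parameter `t` the union of the kernels has codimension at least one.
  let F : ℝ × K → A := fun z => (z.2 : A) -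
    S.comp ((Ring.inverse ((R z.1).comp S)).comp (R z.1)) (z.2 : A)
  have hF : ContDiffOn ℝ 1 F (Metric.ball t₀ r ×ˢ univ) := by
    have h2 : ContDiff ℝ 1 fun z : ℝ × K => (z.2 : A) := K.subtypeL.contDiff.comp contDiff_snd
    refine h2.contDiffOn.sub (ContDiffOn.clm_apply ?_ h2.contDiffOn)
    exact hQu.comp contDiffOn_fst fun z hz => by
      have := (hball hz.1).1
      simpa using this
  have hsub : {a | ∃ t ∈ Metric.ball t₀ r, R t a = 0} ⊆ F '' (Metric.ball t₀ r ×ˢ univ) := by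
    rintro a ⟨t, ht, hta⟩
    have hb : a - S (R t₀ a) ∈ K := by
      rw [LinearMap.mem_ker]
      have := congrArg (fun f => f (R t₀ a)) hS
      simp only [ContinuousLinearMap.comp_apply] at this
      simp [this]
    refine ⟨(t, ⟨a - S (R t₀ a), hb⟩), ⟨ht, mem_univ _⟩, ?_⟩
    have hN : (Ring.inverse ((R t).comp S)).comp ((R t).comp S) = 1 :=
      Ring.inverse_mul_cancel _ (hball ht).2
    have := congrArg (fun f => f (R t₀ a)) hN
    simp only [ContinuousLinearMap.comp_apply] at this
    simp [F, hta, this]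
  calc dimH _ ≤ dimH (F '' (Metric.ball t₀ r ×ˢ univ)) := dimH_mono hsub
    _ ≤ dimH (Metric.ball t₀ r ×ˢ (univ : Set K)) :=
      hF.dimH_image_le ((convex_ball t₀ r).prod convex_univ) le_rfl
    _ ≤ dimH (univ : Set (ℝ × K)) := dimH_mono (subset_univ _)
    _ = finrank ℝ (ℝ × K) := Real.dimH_univ_eq_finrank _
    _ ≤ _ := by
      have : finrank ℝ (ℝ × K) = finrank ℝ A - 1 := by
        rw [finrank_prod, finrank_self]
        omega
      rw [this]

open Module in
/-- Countably many sets of codimension one do not cover the space of parameters. -/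
theorem exists_forall_notMem_of_dimH_le {A : Type*} [NormedAddCommGroup A] [NormedSpace ℝ A]
    [FiniteDimensional ℝ A] {Z : ℝ → Set A}
    (h : ∀ t₀, ∃ I ∈ 𝓝 t₀, dimH {a | ∃ t ∈ I, a ∈ Z t} ≤ ((finrank ℝ A - 1 : ℕ) : ENNReal) ∧
      1 ≤ finrank ℝ A) : ∃ a, ∀ t, a ∉ Z t := by
  choose I hI hdim hA using h
  obtain ⟨s, hs, hcov⟩ := TopologicalSpace.countable_cover_nhds hI
  have h1 : dimH (⋃ t₀ ∈ s, {a | ∃ t ∈ I t₀, a ∈ Z t}) < finrank ℝ A := by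
    rw [dimH_bUnion hs]
    refine (iSup₂_le fun t₀ _ => hdim t₀).trans_lt ?_
    have := hA 0
    exact_mod_cast (by omega : finrank ℝ A - 1 < finrank ℝ A)
  obtain ⟨a, ha⟩ := (dense_compl_of_dimH_lt_finrank h1).nonempty
  refine ⟨a, fun t hat => ha ?_⟩
  have ht : t ∈ ⋃ x ∈ s, I x := by rw [hcov]; trivial
  obtain ⟨t₀, ht₀, htI⟩ := mem_iUnion₂.1 ht
  exact mem_iUnion₂.2 ⟨t₀, ht₀, t, htI, hat⟩

/-- If `β` is a 2-form on a 3-dimensional space with kernel spanned by `b`, two vectors on which it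
does not vanish span a complement of `b`. -/
theorem exists_eq_of_two_form {b n₁ n₂ : E3} (hb : b ≠ 0) {β : E3 → E3 →ₗ[ℝ] ℝ}
    (h1 : β n₁ n₁ = 0) (h2 : β n₂ n₂ = 0) (hb1 : β n₁ b = 0) (hb2 : β n₂ b = 0)
    (h12 : β n₁ n₂ ≠ 0) (h21 : β n₂ n₁ ≠ 0) (v : E3) : ∃ r s t : ℝ, v = r • b + s • n₁ + t • n₂ := by
  have hli : LinearIndependent ℝ ![b, n₁, n₂] := by
    rw [Fintype.linearIndependent_iff]
    intro g hg
    replace hg : g 0 • b + g 1 • n₁ + g 2 • n₂ = 0 := by simpa [Fin.sum_univ_three] using hg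
    have e1 := congrArg (β n₁) hg
    have e2 := congrArg (β n₂) hg
    simp only [map_add, map_smul, smul_eq_mul, map_zero, h1, h2, hb1, hb2, mul_zero, zero_add,
      add_zero] at e1 e2
    have g2 : g 2 = 0 := (mul_eq_zero.1 e1).resolve_right h12
    have g1 : g 1 = 0 := (mul_eq_zero.1 e2).resolve_right h21
    rw [g1, g2] at hg
    have g0 : g 0 = 0 := by simpa [hb] using hg
    intro i
    fin_cases i <;> assumption
  have hspan := hli.span_eq_top_of_card_eq_finrank' (by simp)
  have hv : v ∈ Submodule.span ℝ (range ![b, n₁, n₂]) := by rw [hspan]; trivial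
  obtain ⟨c, hc⟩ := (Submodule.mem_span_range_iff_exists_fun ℝ).1 hv
  exact ⟨c 0, c 1, c 2, by rw [← hc]; simp [Fin.sum_univ_three]⟩

/-! ### A global frame of the conormal bundle of the axis -/

section Two

variable {V : Type*} [NormedAddCommGroup V] [NormedSpace ℝ V]

/-- The covector `α(v, ·)` of a 2-form `α`. -/
def two (α : V [⋀^Fin 2]→L[ℝ] ℝ) (v : V) : V →ₗ[ℝ] ℝ where
  toFun w := α ![v, w]
  map_add' w w' := by
    have h := α.map_update_add ![v, 0] 1 w w'
    have hu : ∀ u : V, Function.update ![v, 0] 1 u = ![v, u] := fun u => by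
      ext i; fin_cases i <;> rfl
    rwa [hu, hu, hu] at h
  map_smul' r w := by
    have h := α.map_update_smul ![v, 0] 1 r w
    have hu : ∀ u : V, Function.update ![v, 0] 1 u = ![v, u] := fun u => by
      ext i; fin_cases i <;> rfl
    rwa [hu, hu] at h

theorem two_apply (α : V [⋀^Fin 2]→L[ℝ] ℝ) (v w : V) : two α v w = α ![v, w] := rfl

theorem two_self (α : V [⋀^Fin 2]→L[ℝ] ℝ) (v : V) : two α v v = 0 :=
  α.map_eq_zero_of_eq ![v, v] (i := 0) (j := 1) rfl (by simp)

theorem two_swap (α : V [⋀^Fin 2]→L[ℝ] ℝ) (v w : V) : two α v w = -two α w v := by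
  have h1 : α ![w, v] = -α ![v, w] := by
    have := α.toAlternatingMap.map_swap ![v, w] (i := 0) (j := 1) (by simp)
    rw [← show ![v, w] ∘ Equiv.swap 0 1 = ![w, v] by ext i; fin_cases i <;> rfl]
    exact this
  rw [two_apply, two_apply, h1, neg_neg]

theorem exists_basis_cons {b : E3} (hb : b ≠ 0) :
    ∃ n₁ n₂ : E3, ∃ e : Module.Basis (Fin 3) ℝ E3, ⇑e = ![b, n₁, n₂] := by
  have h0 : LinearIndependent ℝ ![b] := by
    rw [linearIndependent_unique_iff]; exact hb
  obtain ⟨n₁, h1⟩ := exists_linearIndependent_snoc_of_lt_finrank h0 (by simp)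
  obtain ⟨n₂, h2⟩ := exists_linearIndependent_snoc_of_lt_finrank h1 (by simp)
  refine ⟨n₁, n₂, basisOfLinearIndependentOfCardEqFinrank h2 (by simp), ?_⟩
  rw [coe_basisOfLinearIndependentOfCardEqFinrank]
  ext i j
  fin_cases i <;> rfl

/-- A nonzero 3-form on a 3-dimensional space stays nonzero when contracted with a nonzero vector. -/
theorem exists_volume_ne_zero {m : E3 [⋀^Fin 3]→L[ℝ] ℝ} (hm : m ≠ 0) {b : E3} (hb : b ≠ 0) :
    ∃ n₁ n₂, m ![b, n₁, n₂] ≠ 0 := by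
  obtain ⟨n₁, n₂, e, he⟩ := exists_basis_cons hb
  refine ⟨n₁, n₂, fun h => hm ?_⟩
  have h1 : m.toAlternatingMap = 0 := by
    rw [← m.toAlternatingMap.map_basis_eq_zero_iff e, he]
    exact h
  exact ContinuousAlternatingMap.toAlternatingMap_injective h1

/-- There are covectors vanishing at `b` with prescribed values on a complementary pair. -/
theorem exists_dual_pair {b : E3} (hb : b ≠ 0) : ∃ n₁ n₂ : E3, ∀ r s : ℝ, ∃ θ : E3 →L[ℝ] ℝ,
    θ b = 0 ∧ θ n₁ = r ∧ θ n₂ = s := by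
  obtain ⟨n₁, n₂, e, he⟩ := exists_basis_cons hb
  refine ⟨n₁, n₂, fun r s => ⟨LinearMap.toContinuousLinearMap (e.constr ℝ ![0, r, s]), ?_, ?_, ?_⟩⟩
  · rw [← show e 0 = b by rw [he]; rfl]; simp
  · rw [← show e 1 = n₁ by rw [he]; rfl]; simp
  · rw [← show e 2 = n₂ by rw [he]; rfl]; simp

end Two

section Frame

variable {M : Type*} [TopologicalSpace M] [T2Space M] [ChartedSpace (EuclideanHalfSpace 3) M]
  [IsManifold (𝓡∂ 3) ∞ M] {B : VField M} {c : ℝ → M} {b : M → E3} {γ : Set M}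

section Family

variable {A : Type*} [NormedAddCommGroup A] [NormedSpace ℝ A] {𝓛 : M → A →L[ℝ] ℝ}

omit [T2Space M] in
/-- The derivative of a function on `M` at points near `p`, in the chart around `p`. -/
theorem fderiv_comp_chart_symm {W : Type*} [NormedAddCommGroup W] [NormedSpace ℝ W] {f : M → W}
    (hf : ContMDiff (𝓡∂ 3) 𝓘(ℝ, W) ∞ f) {p q : M} (hq : q ∈ (chartDiffeo p).source) :
    fderiv ℝ (f ∘ (extChartAt (𝓡∂ 3) p).symm) (extChartAt (𝓡∂ 3) p q) =
      (dfun f q).comp (dpar (extChartAt (𝓡∂ 3) p).symm (extChartAt (𝓡∂ 3) p q)) := by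
  have h : ∀ q', q' = q → dfun f q' = dfun f q := by rintro q' rfl; rfl
  rw [(hasFDerivAt_comp_param (hf.contMDiffAt.mdifferentiableAt (by simp))
    ((isLocalDiffeomorphAt_chart_symm hq).mdifferentiableAt (by simp))).fderiv,
    h _ (show (extChartAt (𝓡∂ 3) p).symm (extChartAt (𝓡∂ 3) p q) = q from
      (chartDiffeo p).left_inv hq)]

omit [T2Space M] in
theorem contDiffAt_fderiv_chart_symm {W : Type*} [NormedAddCommGroup W] [NormedSpace ℝ W] {f : M → W}
    (hf : ContMDiff (𝓡∂ 3) 𝓘(ℝ, W) ∞ f) {p q : M} (hq : q ∈ (chartDiffeo p).source) :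
    ContDiffAt ℝ ∞ (fderiv ℝ (f ∘ (extChartAt (𝓡∂ 3) p).symm)) (extChartAt (𝓡∂ 3) p q) :=
  (contDiffAt_comp_param isOpen_univ hf.contMDiffOn (isLocalDiffeomorphAt_chart_symm hq)
    (mem_univ _)).fderiv_right (m := ∞) (by simp)

omit [T2Space M] in
theorem dpar_chart_symm_self {p : M} (hp : p ∈ (𝓡∂ 3).interior M) :
    dpar (extChartAt (𝓡∂ 3) p).symm (extChartAt (𝓡∂ 3) p p) = ContinuousLinearMap.id ℝ E3 := by
  have h := (dpar_chart_symm_comp (mem_chartDiffeo_source hp)).1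
  rwa [dfun_chart_self, ContinuousLinearMap.comp_id] at h

omit [T2Space M] in
/-- For a generic parameter, the corresponding function has nonzero derivative all along the
orbit, by counting dimensions: its vanishing at a given point is two conditions. -/
theorem exists_forall_dfun_ne_zero [FiniteDimensional ℝ A] (hB : SmoothField B)
    (hc : IsMIntegralCurve (I := 𝓡∂ 3) c B) (hi : ∀ t, c t ∈ (𝓡∂ 3).interior M)
    (hb : ∀ t, b (c t) ≠ 0) (hL : ContMDiff (𝓡∂ 3) 𝓘(ℝ, A →L[ℝ] ℝ) ∞ 𝓛)
    (hfill : ∀ t, ∀ θ : E3 →L[ℝ] ℝ, θ (b (c t)) = 0 → ∃ a, ∀ v, dfun 𝓛 (c t) v a = θ v) :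
    ∃ a, ∀ t, ∃ v, dfun 𝓛 (c t) v a ≠ 0 := by
  obtain ⟨a, ha⟩ := exists_forall_notMem_of_dimH_le
    (Z := fun t => {a | ∀ v, dfun 𝓛 (c t) v a = 0}) fun t₀ => by
    obtain ⟨n₁, n₂, hn⟩ := exists_dual_pair (hb t₀)
    set p := c t₀ with hpdef
    have hp := mem_chartDiffeo_source (hi t₀)
    have hO : IsOpen (c ⁻¹' (chartDiffeo p).source) :=
      (chartDiffeo p).open_source.preimage hc.continuous
    let D : ℝ → E3 →L[ℝ] A →L[ℝ] ℝ := fun t =>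
      fderiv ℝ (𝓛 ∘ (extChartAt (𝓡∂ 3) p).symm) (extChartAt (𝓡∂ 3) p (c t))
    have hD : ContDiffAt ℝ ∞ D t₀ :=
      (contDiffAt_fderiv_chart_symm hL hp).comp t₀
        ((contDiffOn_chart_curve hB hc p).contDiffAt (hO.mem_nhds hp))
    have hD0 : D t₀ = dfun 𝓛 p := by
      have := fderiv_comp_chart_symm hL hp
      rwa [dpar_chart_symm_self (hi t₀), ContinuousLinearMap.comp_id] at this
    -- the derivative annihilates the orbit direction, so it vanishes at `c t` iff it vanishes at the two
    -- vectors `n₁`, `n₂` (in the chart)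
    obtain ⟨I, hI, h1, h2⟩ := exists_nhds_dimH_le (R := fun t => (D t n₁).prod (D t n₂)) (t₀ := t₀)
      (by
        have h := (ContinuousLinearMap.prodₗᵢ ℝ :
          ((A →L[ℝ] ℝ) × (A →L[ℝ] ℝ)) ≃ₗᵢ[ℝ] (A →L[ℝ] ℝ × ℝ)).contDiff (n := ∞)
        exact h.contDiffAt.comp t₀
          ((hD.clm_apply contDiffAt_const).prodMk (hD.clm_apply contDiffAt_const)))
      (by
        rintro ⟨r, s⟩
        obtain ⟨θ, hθ, rfl, rfl⟩ := hn r s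
        obtain ⟨a, ha⟩ := hfill t₀ θ hθ
        refine ⟨a, ?_⟩
        simp only [hD0]
        exact Prod.ext (ha n₁) (ha n₂))
    refine ⟨I ∩ c ⁻¹' (chartDiffeo p).source, Filter.inter_mem hI (hO.mem_nhds hp), ?_, h2⟩
    refine (dimH_mono ?_).trans h1
    rintro a ⟨t, ⟨htI, ht⟩, hta⟩
    refine ⟨t, htI, ?_⟩
    have h3 : ∀ v, D t v a = 0 := fun v => by
      have := fderiv_comp_chart_symm hL ht
      change (fderiv ℝ (𝓛 ∘ (extChartAt (𝓡∂ 3) p).symm) (extChartAt (𝓡∂ 3) p (c t))) v a = 0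
      rw [this]
      exact hta _
    exact Prod.ext (h3 n₁) (h3 n₂)
  refine ⟨a, fun t => ?_⟩
  by_contra! h
  exact ha t h

omit [T2Space M] [IsManifold (𝓡∂ 3) ∞ M] in
/-- Leibniz rule at a zero of `𝓛`, where the derivative of the parameters `w` does not contribute. -/
theorem hasMFDerivAt_apply_of_eq_zero {w : M → A} {p : M}
    (hL : MDifferentiableAt (𝓡∂ 3) 𝓘(ℝ, A →L[ℝ] ℝ) 𝓛 p)
    (hw : MDifferentiableAt (𝓡∂ 3) 𝓘(ℝ, A) w p) (h0 : 𝓛 p = 0) :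
    HasMFDerivAt (𝓡∂ 3) 𝓘(ℝ, ℝ) (fun q => 𝓛 q (w q)) p ((dfun 𝓛 p).flip (w p)) := by
  have h1 : HasMFDerivAt (𝓡∂ 3) 𝓘(ℝ, (A →L[ℝ] ℝ) × A) (fun q => (𝓛 q, w q)) p
      ((dfun 𝓛 p).prod (dfun w p)) :=
    ⟨hL.hasMFDerivAt.1.prodMk hw.hasMFDerivAt.1, hL.hasMFDerivAt.2.prodMk hw.hasMFDerivAt.2⟩
  have h2 := (isBoundedBilinearMap_apply (𝕜 := ℝ) (E := A) (F := ℝ)).hasFDerivAt (𝓛 p, w p)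
  refine (h2.hasMFDerivAt.comp p h1).congr_mfderiv ?_
  ext v
  have h3 : ∀ (z : (A →L[ℝ] ℝ) × A), isBoundedBilinearMap_apply.deriv (𝕜 := ℝ) (𝓛 p, w p) z =
      z.1 (w p) := fun z => by simp [h0]
  exact h3 (dfun 𝓛 p v, dfun w p v)

/-- Two functions, vanishing on the orbit, whose derivatives span the conormal space at each of its
points. Given the first one, the derivative of the second one is required to be on the positive
side of it with respect to the orientation of the normal planes by a 2-form; this is a convex
condition, so that local solutions can be patched. -/
theorem exists_conormal_frame [SigmaCompactSpace M] [FiniteDimensional ℝ A] (hB : SmoothField B)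
    (hc : IsMIntegralCurve (I := 𝓡∂ 3) c B) (hγ : γ = range c) (hγc : IsCompact γ)
    (hi : γ ⊆ (𝓡∂ 3).interior M) (hb : ∀ p ∈ γ, b p ≠ 0)
    (hL : ContMDiff (𝓡∂ 3) 𝓘(ℝ, A →L[ℝ] ℝ) ∞ 𝓛) (hL0 : ∀ p ∈ γ, 𝓛 p = 0)
    (hLb : ∀ p ∈ γ, dfun 𝓛 p (b p) = 0)
    (hfill : ∀ p ∈ γ, ∀ θ : E3 →L[ℝ] ℝ, θ (b p) = 0 → ∃ a, ∀ v, dfun 𝓛 p v a = θ v)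
    {α : Form M 2} (hα : SmoothInterior α) {β : M → E3 → E3 →ₗ[ℝ] ℝ}
    (hβ : ∀ p, β p = two (V := E3) (α p)) (hβb : ∀ p ∈ γ, ∀ v, β p v (b p) = 0)
    (hβ0 : ∀ p ∈ γ, ∃ n₁ n₂, β p n₁ n₂ ≠ 0) :
    ∃ x y : M → ℝ, ContMDiff (𝓡∂ 3) 𝓘(ℝ, ℝ) ∞ x ∧ ContMDiff (𝓡∂ 3) 𝓘(ℝ, ℝ) ∞ y ∧
      (∀ p ∈ γ, x p = 0 ∧ y p = 0) ∧
      ∀ p ∈ γ, ∀ v, dfun x p v = 0 → dfun y p v = 0 → v ∈ Submodule.span ℝ {b p} := by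
  obtain ⟨a, ha⟩ := exists_forall_dfun_ne_zero (b := b) hB hc (fun t => hi (hγ ▸ mem_range_self t))
    (fun t => hb _ (hγ ▸ mem_range_self t)) hL fun t => hfill _ (hγ ▸ mem_range_self t)
  replace ha : ∀ p ∈ γ, ∃ v, dfun 𝓛 p v a ≠ 0 := by
    rw [hγ]; rintro _ ⟨t, rfl⟩; exact ha t
  have hself : ∀ p v, β p v v = 0 := fun p v => by rw [hβ]; exact two_self _ _
  have hswap : ∀ p v w, β p v w = -β p w v := fun p v w => by rw [hβ]; exact two_swap _ _ _
  have hdec : ∀ p ∈ γ, ∀ n₁ n₂, β p n₁ n₂ ≠ 0 → ∀ v, ∃ r s t : ℝ,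
      v = r • b p + s • n₁ + t • n₂ := fun p hp n₁ n₂ h =>
    exists_eq_of_two_form (hb p hp) (hself p _) (hself p _) (hβb p hp _) (hβb p hp _) h
      (by rw [hswap]; exact neg_ne_zero.2 h)
  have hLb' : ∀ p ∈ γ, ∀ w, dfun 𝓛 p (b p) w = 0 := fun p hp w => by rw [hLb p hp]; rfl
  -- `β p` is, up to a factor, the determinant on the normal plane with basis `n₁`, `n₂`
  have hdet : ∀ p ∈ γ, ∀ n₁ n₂ : E3, ∀ r₁ s₁ t₁ r₂ s₂ t₂ : ℝ,
      β p (r₁ • b p + s₁ • n₁ + t₁ • n₂) (r₂ • b p + s₂ • n₁ + t₂ • n₂) =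
        (s₁ * t₂ - t₁ * s₂) * β p n₁ n₂ := by
    intro p hp n₁ n₂ r₁ s₁ t₁ r₂ s₂ t₂
    have e : ∀ v, β p (r₁ • b p + s₁ • n₁ + t₁ • n₂) v = s₁ * β p n₁ v + t₁ * β p n₂ v := by
      intro v
      rw [hswap, map_add, map_add, map_smul, map_smul, map_smul, hβb p hp, hswap p v n₁,
        hswap p v n₂]
      simp only [smul_eq_mul]
      ring
    rw [e]
    simp only [map_add, map_smul, smul_eq_mul, hβb p hp, hself, hswap p n₂ n₁]
    ring
  -- `w` is admissible at `q` if the pair of derivatives with parameters `a` and `w` is a positively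
  -- oriented basis of the conormal space
  let C : M → Set A := fun q => {w | q ∈ γ → ∀ v₁ v₂, 0 < β q v₁ v₂ →
    0 < dfun 𝓛 q v₁ a * dfun 𝓛 q v₂ w - dfun 𝓛 q v₂ a * dfun 𝓛 q v₁ w}
  obtain ⟨w, hw⟩ := exists_contMDiffMap_forall_mem_convex_of_local_const (n := ⊤) (t := C) (𝓡∂ 3)
    (fun q w₁ h₁ w₂ h₂ s t hs ht hst hq v₁ v₂ hv => by
      have := convex_Ioi (0 : ℝ) (h₁ hq v₁ v₂ hv) (h₂ hq v₁ v₂ hv) hs ht hst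
      simp only [smul_eq_mul, mem_Ioi] at this
      simp only [map_add, map_smul, smul_eq_mul]
      linarith)
    (fun p => by
      by_cases hp : p ∈ γ
      swap
      · refine ⟨0, ?_⟩
        filter_upwards [hγc.isClosed.isOpen_compl.mem_nhds hp] with q hq hq'
        exact absurd hq' hq
      obtain ⟨n₁, n₂, hn⟩ := hβ0 p hp
      obtain ⟨u, hu⟩ := ha p hp
      have hps := mem_chartDiffeo_source (hi hp)
      have hh : 0 < (dfun 𝓛 p n₁ a) ^ 2 + (dfun 𝓛 p n₂ a) ^ 2 := by
        by_contra! h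
        have e1 : dfun 𝓛 p n₁ a = 0 := by nlinarith [sq_nonneg (dfun 𝓛 p n₁ a), sq_nonneg (dfun 𝓛 p n₂ a)]
        have e2 : dfun 𝓛 p n₂ a = 0 := by nlinarith [sq_nonneg (dfun 𝓛 p n₁ a), sq_nonneg (dfun 𝓛 p n₂ a)]
        obtain ⟨r, s, t, hv⟩ := hdec p hp n₁ n₂ hn u
        apply hu
        rw [hv]
        simp [hLb' p hp, e1, e2]
      set N := (dfun 𝓛 p n₁ a) ^ 2 + (dfun 𝓛 p n₂ a) ^ 2 with hN
      -- The first derivative, turned by a right angle with respect to the basis `n₁`, `n₂`, gives an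
      -- admissible second derivative at `p`; its parameter `w₀` stays admissible near `p` by continuity.
      obtain ⟨w₀, hw₀⟩ := hfill p hp (LinearMap.toContinuousLinearMap
        ((dfun 𝓛 p n₁ a / N) • β p n₁ + (dfun 𝓛 p n₂ a / N) • β p n₂)) (by
          simp [hβb p hp])
      have e1 : dfun 𝓛 p n₁ w₀ = -(dfun 𝓛 p n₂ a / N) * β p n₁ n₂ := by
        rw [hw₀]; simp [hself, hswap p n₂ n₁]
      have e2 : dfun 𝓛 p n₂ w₀ = (dfun 𝓛 p n₁ a / N) * β p n₁ n₂ := by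
        rw [hw₀]; simp [hself]
      -- To compare different points near `p`, use the moving basis of the normal planes given by the images
      -- of `n₁` and `n₂` under the derivative of `κ`. In it `D` represents the derivative of `𝓛`, `g` the
      -- form `β`, and `k` the determinant of the two derivatives.
      let κ := (extChartAt (𝓡∂ 3) p).symm
      let D : M → E3 →L[ℝ] A →L[ℝ] ℝ := fun q => fderiv ℝ (𝓛 ∘ κ) (extChartAt (𝓡∂ 3) p q)
      have hec : ContinuousAt (extChartAt (𝓡∂ 3) p) p := continuousAt_extChartAt p
      have hD : ContinuousAt D p := (contDiffAt_fderiv_chart_symm hL hps).continuousAt.comp hec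
      have hDn : ∀ n a', ContinuousAt (fun q => D q n a') p := fun n a' =>
        (hD.clm_apply continuousAt_const).clm_apply continuousAt_const
      let g : M → ℝ := fun q => pullback κ α (extChartAt (𝓡∂ 3) p q) ![n₁, n₂]
      have hg : ContinuousAt g p :=
        ContinuousAt.comp (g := fun z => pullback κ α z ![n₁, n₂]) (hα.contDiffAt_pullback
          (isLocalDiffeomorphAt_chart_symm hps) _).continuousAt hec
      have hgeq : ∀ q ∈ (chartDiffeo p).source, g q =
          β q (dpar κ (extChartAt (𝓡∂ 3) p q) n₁) (dpar κ (extChartAt (𝓡∂ 3) p q) n₂) := by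
        intro q hq
        have h : ∀ q', q' = q → ∀ z, two (V := E3) (α q') (dpar κ z n₁) (dpar κ z n₂) =
            β q (dpar κ z n₁) (dpar κ z n₂) := by rintro q' rfl z; rw [hβ]
        rw [← h _ (show κ (extChartAt (𝓡∂ 3) p q) = q from (chartDiffeo p).left_inv hq)]
        refine (pullback_apply _ _ _ _).trans (congrArg (α _) ?_)
        ext i : 1
        fin_cases i <;> rfl
      have hDeq : ∀ q ∈ (chartDiffeo p).source, ∀ n a', D q n a' =
          dfun 𝓛 q (dpar κ (extChartAt (𝓡∂ 3) p q) n) a' := fun q hq n a' =>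
        congrArg (fun L => L n a') (fderiv_comp_chart_symm hL hq)
      let k : M → ℝ := fun q => D q n₁ a * D q n₂ w₀ - D q n₂ a * D q n₁ w₀
      have hk : ContinuousAt k p := ((hDn _ _).mul (hDn _ _)).sub ((hDn _ _).mul (hDn _ _))
      have hid : ∀ n, dpar κ (extChartAt (𝓡∂ 3) p p) n = n := fun n =>
        congrArg (fun L => L n) (dpar_chart_symm_self (hi hp))
      have hgp : g p = β p n₁ n₂ := by rw [hgeq p hps, hid, hid]
      have hkp : k p = β p n₁ n₂ := by
        simp only [k, hDeq p hps, hid, e1, e2]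
        field_simp
        rw [hN]
        ring
      refine ⟨w₀, ?_⟩
      have hpos : ∀ᶠ q in 𝓝 p, 0 < g q * k q :=
        (hg.mul hk).eventually (lt_mem_nhds (by rw [Pi.mul_apply, hgp, hkp]; exact mul_self_pos.2 hn))
      filter_upwards [hpos, (chartDiffeo p).open_source.mem_nhds hps] with q hq hqs hqγ v₁ v₂ hv
      have hg0 : g q ≠ 0 := fun h => by simp [h] at hq
      have hkq : k q = dfun 𝓛 q (dpar κ (extChartAt (𝓡∂ 3) p q) n₁) a *
            dfun 𝓛 q (dpar κ (extChartAt (𝓡∂ 3) p q) n₂) w₀ -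
          dfun 𝓛 q (dpar κ (extChartAt (𝓡∂ 3) p q) n₂) a *
            dfun 𝓛 q (dpar κ (extChartAt (𝓡∂ 3) p q) n₁) w₀ := by simp only [k, hDeq q hqs]
      have hgq := hgeq q hqs
      rw [hgq] at hg0
      obtain ⟨r₁, s₁, t₁, rfl⟩ := hdec q hqγ _ _ hg0 v₁
      obtain ⟨r₂, s₂, t₂, rfl⟩ := hdec q hqγ _ _ hg0 v₂
      rw [hdet q hqγ, ← hgq] at hv
      have h1 : 0 < (s₁ * t₂ - t₁ * s₂) * k q := by
        have h2 : 0 < g q ^ 2 * ((s₁ * t₂ - t₁ * s₂) * k q) := by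
          have := mul_pos hv hq
          nlinarith
        exact pos_of_mul_pos_right h2 (sq_nonneg _)
      have h3 : dfun 𝓛 q (b q) a = 0 ∧ dfun 𝓛 q (b q) w₀ = 0 := ⟨hLb' q hqγ a, hLb' q hqγ w₀⟩
      rw [hkq] at h1
      simp only [map_add, map_smul, add_apply, smul_apply, smul_eq_mul,
        h3.1, h3.2]
      linarith)
  have hx : ∀ p v, dfun (fun q => 𝓛 q a) p v = dfun 𝓛 p v a := fun p v => by
    have h := HasMFDerivAt.comp p (ContinuousLinearMap.apply ℝ ℝ a).hasMFDerivAt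
      (hL.contMDiffAt (x := p).mdifferentiableAt (by simp)).hasMFDerivAt
    exact congrArg (fun L : E3 →L[ℝ] ℝ => L v) h.mfderiv
  have hy : ∀ p ∈ γ, ∀ v, dfun (fun q => 𝓛 q (w q)) p v = dfun 𝓛 p v (w p) := fun p hp v => by
    have h := hasMFDerivAt_apply_of_eq_zero (hL.contMDiffAt.mdifferentiableAt (by simp))
      (w.contMDiff.contMDiffAt.mdifferentiableAt (by simp)) (hL0 p hp)
    exact congrArg (fun L : E3 →L[ℝ] ℝ => L v) h.mfderiv
  refine ⟨fun q => 𝓛 q a, fun q => 𝓛 q (w q), hL.clm_apply contMDiff_const,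
    hL.clm_apply w.contMDiff, fun p hp => by simp [hL0 p hp], fun p hp v hv₁ hv₂ => ?_⟩
  rw [hx] at hv₁
  rw [hy p hp] at hv₂
  obtain ⟨n₁, n₂, hn⟩ : ∃ n₁ n₂, 0 < β p n₁ n₂ := by
    obtain ⟨n₁, n₂, hn⟩ := hβ0 p hp
    rcases hn.lt_or_gt with h | h
    · exact ⟨n₂, n₁, by rw [hswap]; exact neg_pos.2 h⟩
    · exact ⟨n₁, n₂, h⟩
  have hpos := hw p hp n₁ n₂ hn
  obtain ⟨r, s, t, rfl⟩ := hdec p hp n₁ n₂ hn.ne' v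
  simp only [map_add, map_smul, add_apply, smul_apply, smul_eq_mul, hLb' p hp, mul_zero,
    zero_add] at hv₁ hv₂
  have hs : s = 0 := by
    refine (mul_eq_zero.1 ?_).resolve_right hpos.ne'
    linear_combination dfun 𝓛 p n₂ (w p) * hv₁ - dfun 𝓛 p n₂ a * hv₂
  have ht : t = 0 := by
    refine (mul_eq_zero.1 ?_).resolve_right hpos.ne'
    linear_combination dfun 𝓛 p n₁ a * hv₂ - dfun 𝓛 p n₁ (w p) * hv₁
  rw [hs, ht]
  simp only [zero_smul, add_zero]
  exact Submodule.smul_mem _ _ (Submodule.mem_span_singleton_self _)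

end Family

end Frame

/-! ### Tubular coordinates around the axis -/

section Axis

variable {M : Type*} [TopologicalSpace M] [T2Space M] [ChartedSpace (EuclideanHalfSpace 3) M]
  [IsManifold (𝓡∂ 3) ∞ M] {B : VField M} {c : ℝ → M} {γ : Set M}

omit [T2Space M] in
/-- The inverse function theorem at interior points. -/
theorem isLocalDiffeomorphAt_of_dfun_injective {V : Type*} [NormedAddCommGroup V] [NormedSpace ℝ V]
    [FiniteDimensional ℝ V] (hV : Module.finrank ℝ V = 3) {h : M → V} {O : Set M} (hO : IsOpen O)
    (hh : ContMDiffOn (𝓡∂ 3) 𝓘(ℝ, V) ∞ h O) {p : M} (hp : p ∈ O) (hi : p ∈ (𝓡∂ 3).interior M)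
    (hinj : ∀ v, dfun h p v = 0 → v = 0) : IsLocalDiffeomorphAt (𝓡∂ 3) 𝓘(ℝ, V) ∞ h p := by
  have hps := mem_chartDiffeo_source hi
  have hsub : IsOpen ((chartDiffeo p).target ∩ (chartDiffeo p).symm ⁻¹' O) :=
    (chartDiffeo p).toOpenPartialHomeomorph.isOpen_inter_preimage_symm hO
  have hmem : extChartAt (𝓡∂ 3) p p ∈ (chartDiffeo p).target ∩ (chartDiffeo p).symm ⁻¹' O :=
    ⟨(chartDiffeo p).map_source hps, by
      rw [mem_preimage, show (chartDiffeo p).symm (extChartAt (𝓡∂ 3) p p) = p from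
        (chartDiffeo p).left_inv hps]
      exact hp⟩
  have hk : ContDiffOn ℝ ∞ (h ∘ (extChartAt (𝓡∂ 3) p).symm)
      ((chartDiffeo p).target ∩ (chartDiffeo p).symm ⁻¹' O) := fun z hz =>
    (contDiffAt_comp_param hO hh ((chartDiffeo p).symm.isLocalDiffeomorphAt _ _ _ hz.1)
      hz.2).contDiffWithinAt
  have hd : fderiv ℝ (h ∘ (extChartAt (𝓡∂ 3) p).symm) (extChartAt (𝓡∂ 3) p p) = dfun h p := by
    have h1 : ∀ q, q = p → MDifferentiableAt (𝓡∂ 3) 𝓘(ℝ, V) h q := by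
      rintro q rfl
      exact (hh.contMDiffAt (hO.mem_nhds hp)).mdifferentiableAt (by simp)
    have h2 : ∀ q, q = p → dfun h q = dfun h p := by rintro q rfl; rfl
    rw [(hasFDerivAt_comp_param (h1 _ (extChartAt_to_inv p))
      ((isLocalDiffeomorphAt_chart_symm hps).mdifferentiableAt (by simp))).fderiv,
      h2 _ (extChartAt_to_inv p), dpar_chart_symm_self hi, ContinuousLinearMap.comp_id]
  have hloc := isLocalDiffeomorphAt_of_fderiv_injective (by rw [hV]; simp) hsub hk hmem
    (fun v hv => hinj v (by rwa [hd] at hv))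
  refine IsLocalDiffeomorphAt.congr_of_eventuallyEq
    (IsLocalDiffeomorphAt.comp _ _ ((chartDiffeo p).isLocalDiffeomorphAt _ _ _ hps) hloc) ?_
  filter_upwards [(chartDiffeo p).open_source.mem_nhds hps] with q hq
  exact congrArg h ((chartDiffeo p).left_inv hq).symm

/-- The angle depends only on the direction of `w`. -/
theorem exp_angleNear_of_ne_zero (φ₀ : ℝ) {w : ℂ} (hw : w ≠ 0) :
    Circle.exp (angleNear φ₀ w) = Circle.exp w.arg := by
  have h : angleNear φ₀ w = angleNear φ₀ (Circle.exp w.arg) := by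
    have h1 : w / Circle.exp φ₀ = ‖w‖ * ((Circle.exp w.arg : ℂ) / Circle.exp φ₀) := by
      have h2 : (‖w‖ : ℂ) * (Circle.exp w.arg : ℂ) = w := by
        rw [Circle.coe_exp, Complex.norm_mul_exp_arg_mul_I]
      rw [← mul_div_assoc, h2]
    rw [angleNear, angleNear, Complex.log_im, Complex.log_im, h1,
      Complex.arg_real_mul _ (norm_pos_iff.2 hw)]
  rw [h, exp_angleNear]

omit [T2Space M] in
/-- Tubular coordinates from functions `x`, `y` whose derivatives span the conormal space of the
periodic orbit, and a function `W` whose argument is the angle along the orbit. -/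
theorem exists_isTubularDiffeo_of_frame (hc : IsMIntegralCurve (I := 𝓡∂ 3) c B) {T : ℝ} (hT : 0 < T)
    (hper : Function.Periodic c T) (hγ : γ = range c) (hi : γ ⊆ (𝓡∂ 3).interior M) {b : M → E3}
    (hb : ∀ p, b p = B p) {W : M → ℂ} (hW : ContMDiff (𝓡∂ 3) 𝓘(ℝ, ℂ) ∞ W)
    (hWc : ∀ t, W (c t) = Circle.exp (2 * Real.pi / T * t)) {x y : M → ℝ}
    (hx : ContMDiff (𝓡∂ 3) 𝓘(ℝ, ℝ) ∞ x) (hy : ContMDiff (𝓡∂ 3) 𝓘(ℝ, ℝ) ∞ y)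
    (hxy : ∀ p ∈ γ, x p = 0 ∧ y p = 0)
    (hspan : ∀ p ∈ γ, ∀ v, dfun x p v = 0 → dfun y p v = 0 → v ∈ Submodule.span ℝ {b p})
    {U : Set M} (hU : IsOpen U) (hγU : γ ⊆ U) :
    ∃ Φ : OpenPartialHomeomorph M (EuclideanSpace ℝ (Fin 2) × Circle),
      IsTubularDiffeo γ Φ ∧ Φ.source ⊆ U := by
  have hγc : IsCompact γ := by
    rw [hγ, ← image_univ]
    have : c '' univ = c '' Icc 0 T := by
      refine subset_antisymm ?_ (image_mono (subset_univ _))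
      rintro _ ⟨t, -, rfl⟩
      obtain ⟨s, hs, he⟩ := hper.exists_mem_Ico₀ hT t
      exact ⟨s, Ico_subset_Icc_self hs, he.symm⟩
    rw [this]
    exact isCompact_Icc.image hc.continuous
  have hne : ∀ t, W (c t) ≠ 0 := fun t => by rw [hWc]; exact Circle.coe_ne_zero _
  have harg : ∀ t, Circle.exp (W (c t)).arg = Circle.exp (2 * Real.pi / T * t) := fun t => by
    rw [hWc, Circle.exp_arg]
  -- this is a local diffeomorphism along `γ` and maps `γ` bijectively to the central circle
  let Ξ : M → E2 × Circle := fun p => (!₂[x p, y p], Circle.exp (W p).arg)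
  have hΞ : ∀ t, Ξ (c t) = (0, Circle.exp (2 * Real.pi / T * t)) := fun t => by
    have := hxy (c t) (hγ ▸ mem_range_self t)
    simp only [Ξ, this.1, this.2, harg]
    exact Prod.ext (by ext i; fin_cases i <;> rfl) rfl
  suffices h : (∀ p ∈ γ, IsLocalDiffeomorphAt (𝓡∂ 3) ((𝓡 2).prod (𝓡 1)) ∞ Ξ p) ∧ InjOn Ξ γ ∧
      Ξ '' γ = {0} ×ˢ univ by
    obtain ⟨ε, -, -, Φ, h1, h2, -⟩ := exists_isTubularDiffeo hγc hU hγU h.1 h.2.1 h.2.2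
    exact ⟨Φ, h1, h2⟩
  refine ⟨fun p hp => ?_, fun p hp q hq hpq => ?_, ?_⟩
  · obtain ⟨t, rfl⟩ : p ∈ range c := hγ ▸ hp
    set φ₀ := 2 * Real.pi / T * t with hφ
    let O : Set M := {q | W q / Circle.exp φ₀ ∈ Complex.slitPlane}
    have hO : IsOpen O := Complex.isOpen_slitPlane.preimage (hW.continuous.div_const _)
    have hpO : c t ∈ O := by
      simp only [O, mem_ofPred_eq]
      rw [hWc, div_self (Circle.coe_ne_zero _)]
      exact Complex.one_mem_slitPlane
    let h : M → Cyl := fun q => (!₂[x q, y q], angleNear φ₀ (W q))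
    have hang : ContMDiffOn (𝓡∂ 3) 𝓘(ℝ, ℝ) ∞ (fun q => angleNear φ₀ (W q)) O := fun q hq =>
      ((contDiffAt_angleNear hq).contMDiffAt.comp q hW.contMDiffAt).contMDiffWithinAt
    have hpl : ContDiff ℝ ∞ fun z : ℝ × ℝ => (!₂[z.1, z.2] : E2) := by
      rw [contDiff_euclidean]
      intro i; fin_cases i
      · exact contDiff_fst
      · exact contDiff_snd
    have hxy' : ContMDiff (𝓡∂ 3) 𝓘(ℝ, E2) ∞ (fun q => !₂[x q, y q]) :=
      hpl.contMDiff.comp (hx.prodMk_space hy)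
    have hh : ContMDiffOn (𝓡∂ 3) 𝓘(ℝ, Cyl) ∞ h O := hxy'.contMDiffOn.prodMk_space hang
    have hloc : IsLocalDiffeomorphAt (𝓡∂ 3) 𝓘(ℝ, Cyl) ∞ h (c t) := by
      refine isLocalDiffeomorphAt_of_dfun_injective (by simp) hO hh hpO (hi hp) fun v hv => ?_
      have hhd : MDifferentiableAt (𝓡∂ 3) 𝓘(ℝ, Cyl) h (c t) :=
        (hh.contMDiffAt (hO.mem_nhds hpO)).mdifferentiableAt (by simp)
      have hcomp : ∀ L : Cyl →L[ℝ] ℝ, dfun (fun q => L (h q)) (c t) = L.comp (dfun h (c t)) :=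
        fun L => (HasMFDerivAt.comp (c t) L.hasMFDerivAt hhd.hasMFDerivAt).mfderiv
      have e1 : dfun x (c t) v = 0 := by
        rw [show x = fun q => dx (h q) from rfl, hcomp, ContinuousLinearMap.comp_apply, hv, map_zero]
      have e2 : dfun y (c t) v = 0 := by
        rw [show y = fun q => dy (h q) from rfl, hcomp, ContinuousLinearMap.comp_apply, hv, map_zero]
      obtain ⟨r, rfl⟩ := Submodule.mem_span_singleton.1 (hspan _ hp v e1 e2)
      have e3 : dfun (fun q => angleNear φ₀ (W q)) (c t) (r • b (c t)) = 0 := by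
        rw [show (fun q => angleNear φ₀ (W q)) = fun q => dphi (h q) from rfl, hcomp,
          ContinuousLinearMap.comp_apply, hv, map_zero]
      -- the angle increases along the orbit at the constant rate `2π / T`
      have e4 : dfun (fun q => angleNear φ₀ (W q)) (c t) (b (c t)) = 2 * Real.pi / T := by
        have h5 : HasFDerivAt ((fun q => angleNear φ₀ (W q)) ∘ c)
            ((dfun (fun q => angleNear φ₀ (W q)) (c t)).comp
            (ContinuousLinearMap.smulRight (1 : ℝ →L[ℝ] ℝ) (b (c t)))) t := by
          rw [hb]
          exact HasMFDerivAt.hasFDerivAt ((((hang.contMDiffAt (hO.mem_nhds hpO)).mdifferentiableAt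
            (by simp)).hasMFDerivAt).comp t (hc t))
        have h6 : HasDerivAt (fun s : ℝ => 2 * Real.pi / T * s) (2 * Real.pi / T) t := by
          simpa using (hasDerivAt_id t).const_mul (2 * Real.pi / T)
        have h7 : (fun q => angleNear φ₀ (W q)) ∘ c =ᶠ[𝓝 t] fun s => 2 * Real.pi / T * s := by
          have hcont : ContinuousAt (fun s : ℝ => 2 * Real.pi / T * s) t := by fun_prop
          filter_upwards [hcont.eventually (Ioo_mem_nhds (a := φ₀ - Real.pi) (b := φ₀ + Real.pi)
            (by linarith [Real.pi_pos]) (by linarith [Real.pi_pos]))] with s hs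
          rw [Function.comp_apply, hWc, angleNear_exp hs]
        have h8 := h5.hasDerivAt.unique (h6.congr_of_eventuallyEq h7)
        simpa using h8
      have e5 : r = 0 := by
        rw [map_smul, e4, smul_eq_mul] at e3
        exact (mul_eq_zero.1 e3).resolve_right (by positivity)
      rw [e5, zero_smul]
    refine IsLocalDiffeomorphAt.congr_of_eventuallyEq
      (IsLocalDiffeomorphAt.comp _ _ hloc (isLocalDiffeomorphAt_pexp _)) ?_
    filter_upwards [hW.continuous.continuousAt.eventually_ne (hne t)] with q hq
    exact Prod.ext rfl (exp_angleNear_of_ne_zero φ₀ hq).symm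
  · obtain ⟨s, rfl⟩ : p ∈ range c := hγ ▸ hp
    obtain ⟨t, rfl⟩ : q ∈ range c := hγ ▸ hq
    rw [hΞ, hΞ] at hpq
    obtain ⟨n, hn⟩ := Circle.exp_eq_exp.1 (congrArg Prod.snd hpq)
    have : s = t + n * T := by
      have h2π := Real.pi_pos
      field_simp at hn
      linarith
    rw [this]
    exact hper.int_mul n t
  · ext ⟨z, u⟩
    constructor
    · rintro ⟨p, hp, he⟩
      obtain ⟨t, rfl⟩ : p ∈ range c := hγ ▸ hp
      rw [hΞ] at he
      exact ⟨(congrArg Prod.fst he).symm, trivial⟩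
    · rintro ⟨hz, -⟩
      replace hz : z = 0 := hz
      refine ⟨c (T / (2 * Real.pi) * (u : ℂ).arg), hγ ▸ mem_range_self _, ?_⟩
      rw [hΞ, hz]
      congr 1
      have : 2 * Real.pi / T * (T / (2 * Real.pi) * (u : ℂ).arg) = (u : ℂ).arg := by
        field_simp
      rw [this, Circle.exp_arg]

omit [T2Space M] [IsManifold (𝓡∂ 3) ∞ M] in
theorem iota_apply {μ : Form M 3} (p : M) (v w : E3) :
    two (V := E3) (iota B μ p) v w = (μ p : E3 [⋀^Fin 3]→L[ℝ] ℝ) ![(B p : E3), v, w] := rfl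

/-- A nondegenerate axis has arbitrarily small tubular neighbourhoods. -/
theorem IsNondegenerateAxis.exists_isTubularDiffeo [SecondCountableTopology M] {ν : Form M 1}
    {μ : Form M 3} (h : IsFluxSystem B ν μ) (hγ : IsNondegenerateAxis B ν γ) {U' : Set M}
    (hU' : IsOpen U') (hγU' : γ ⊆ U') :
    ∃ Φ : OpenPartialHomeomorph M (EuclideanSpace ℝ (Fin 2) × Circle),
      IsTubularDiffeo γ Φ ∧ Φ.source ⊆ U' := by
  have : LocallyCompactSpace M := Manifold.locallyCompact_of_finiteDimensional (𝓡∂ 3)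
  obtain ⟨hax, U, ψ, hU, hγU, hψ, hdψ, hess⟩ := hγ
  obtain ⟨c, T₀, hT₀, hc, hper₀, hγc⟩ := hax.periodic_orbit
  have hmem : ∀ t, c t ∈ γ := fun t => hγc ▸ mem_range_self t
  have hi := hax.subset_interior
  obtain ⟨b, hb⟩ : ∃ b : M → E3, ∀ p, b p = B p := ⟨B, fun _ => rfl⟩
  have hb0 : ∀ p ∈ γ, b p ≠ 0 := fun p hp => by rw [hb]; exact hax.one_dimensional p hp
  obtain ⟨T, hT, hper, hinj⟩ := exists_minimal_period h.smooth_B hc hT₀ hper₀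
    (fun t => hi (hmem t)) (hax.one_dimensional _ (hmem 0))
  obtain ⟨W, hW, hWc⟩ := exists_angle h.smooth_B hc hT hper hinj (fun t => hi (hmem t))
    fun t => hax.one_dimensional _ (hmem t)
  have hcomp : IsCompact γ := by
    have : γ = c '' Icc 0 T := by
      rw [hγc]
      refine subset_antisymm ?_ (image_subset_range _ _)
      rintro _ ⟨t, rfl⟩
      obtain ⟨s, hs, he⟩ := hper.exists_mem_Ico₀ hT t
      exact ⟨s, Ico_subset_Icc_self hs, he.symm⟩
    rw [this]
    exact isCompact_Icc.image hc.continuous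
  obtain ⟨J, 𝓛, hL, hL0, hLb, hfill⟩ := exists_conormal_family (b := b) hU hγU hψ hcomp hi
    (fun p hp => by
      ext1 v
      refine (hdψ p (hγU hp) v).trans ?_
      rw [hax.critical p hp]
      rfl)
    (fun p hp v => by rw [hb]; exact hess p hp v)
  obtain ⟨x, y, hx, hy, hxy, hspan⟩ := exists_conormal_frame (b := b) h.smooth_B hc hγc hcomp hi hb0
    hL hL0 hLb hfill (h.smooth_mu.smoothInterior.iota h.smooth_B)
    (β := fun p => two (V := E3) (iota B μ p)) (fun _ => rfl)
    (fun p _ v => by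
      simp only [iota_apply, ← hb]
      exact (μ p : E3 [⋀^Fin 3]→L[ℝ] ℝ).map_eq_zero_of_eq ![b p, v, b p] (i := 0) (j := 2) rfl
        (by decide))
    (fun p hp => by
      simp only [iota_apply, ← hb]
      exact exists_volume_ne_zero (h.volume p) (hb0 p hp))
  exact exists_isTubularDiffeo_of_frame hc hT hper hγc hi hb hW hWc hx hy hxy hspan hU' hγU'

end Axis

/-! ### Leaves are locally level sets of the potential -/

section Leaf

variable {M : Type*} [TopologicalSpace M] [ChartedSpace (EuclideanHalfSpace 3) M]
  {ν : Form M 1} {S U : Set M} {ψ : M → ℝ}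

/-- If `ν = dψ` near a point `p` of an integral surface of `ν`, then near `p` the level set of `ψ`
through `p` is contained in the surface. -/
theorem IsIntegralSurface.eventually_mem_of_eq (hS : IsIntegralSurface ν S) (hU : IsOpen U)
    (hψ : ContMDiffOn (𝓡∂ 3) 𝓘(ℝ, ℝ) ∞ ψ U)
    (hdψ : ∀ p ∈ U, ∀ v : TangentSpace (𝓡∂ 3) p, mfderiv (𝓡∂ 3) 𝓘(ℝ, ℝ) ψ p v = ν p (fun _ => v))
    {p : M} (hp : p ∈ S) (hpU : p ∈ U) : ∀ᶠ q in 𝓝 p, ψ q = ψ p → q ∈ S := by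
  obtain ⟨e, hpe, he, hes, heS, hν⟩ := hS p hp
  let O : Set E3 := e.target ∩ e.symm ⁻¹' U
  have hO : IsOpen O := e.isOpen_inter_preimage_symm hU
  let D : E3 → E3 →L[ℝ] ℝ := fun z => (dfun ψ (e.symm z)).comp (dpar e.symm z)
  have hsm : ∀ z ∈ O, ContDiffAt ℝ ∞ (ψ ∘ e.symm) z := fun z hz =>
    ((hψ.contMDiffAt (hU.mem_nhds hz.2)).comp z
      (hes.contMDiffAt (e.open_target.mem_nhds hz.1))).contDiffAt
  have hsd : ∀ z ∈ O, MDifferentiableAt 𝓘(ℝ, E3) (𝓡∂ 3) e.symm z := fun z hz =>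
    (hes.contMDiffAt (e.open_target.mem_nhds hz.1)).mdifferentiableAt (by simp)
  have hD : ∀ z ∈ O, HasFDerivAt (ψ ∘ e.symm) (D z) z := fun z hz =>
    hasFDerivAt_comp_param ((hψ.contMDiffAt (hU.mem_nhds hz.2)).mdifferentiableAt (by simp))
      (hsd z hz)
  -- in the straightened coordinates, `dψ` is a nonzero multiple of `dz₂` on the surface `z₂ = 0`
  have hker : ∀ z ∈ O, z 2 = 0 → ∀ v, D z v = 0 ↔ v 2 = 0 := by
    intro z hz hz2 v
    have h1 := e.map_target hz.1
    have h2 : e.symm z ∈ S := by rw [heS _ h1, e.right_inv hz.1]; exact hz2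
    have h3 := hν _ h1 h2 (dpar e.symm z v)
    have hd := hdψ _ hz.2 (dpar e.symm z v)
    refine Iff.trans ⟨fun h => h3.1 (hd.symm.trans h), fun h => hd.trans (h3.2 h)⟩ ?_
    have h4 : HasFDerivAt (e ∘ e.symm) ((dfun e (e.symm z)).comp (dpar e.symm z)) z :=
      hasFDerivAt_comp_param ((he.contMDiffAt (e.open_source.mem_nhds h1)).mdifferentiableAt
        (by simp)) (hsd z hz)
    have h5 : HasFDerivAt (e ∘ e.symm) (ContinuousLinearMap.id ℝ E3) z :=
      (hasFDerivAt_id z).congr_of_eventuallyEq (by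
        filter_upwards [e.open_target.mem_nhds hz.1] with w hw using e.right_inv hw)
    have h6 : dfun e (e.symm z) (dpar e.symm z v) = v := congrArg (fun L => L v) (h4.unique h5)
    have h7 : ∀ w : E3, w = v → (w 2 = 0 ↔ v 2 = 0) := by rintro w rfl; rfl
    exact h7 _ h6
  let u : E3 := EuclideanSpace.single 2 1
  have hz0 : e p ∈ O := ⟨e.map_source hpe, by rw [mem_preimage, e.left_inv hpe]; exact hpU⟩
  have hz2 : e p 2 = 0 := (heS p hpe).1 hp
  have hDu : ∀ᶠ z in 𝓝 (e p), D z u ≠ 0 := by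
    have h1 : ContinuousAt (fun z => fderiv ℝ (ψ ∘ e.symm) z u) (e p) :=
      (((hsm _ hz0).fderiv_right (m := ∞) (by simp)).continuousAt).clm_apply continuousAt_const
    have h2 : fderiv ℝ (ψ ∘ e.symm) (e p) u ≠ 0 := by
      rw [(hD _ hz0).fderiv, Ne, hker _ hz0 hz2]
      simp [u]
    filter_upwards [h1.eventually_ne h2, hO.mem_nhds hz0] with z hz hzO
    rwa [(hD z hzO).fderiv] at hz
  obtain ⟨r, hr, hball⟩ := Metric.mem_nhds_iff.1 (Filter.inter_mem (hO.mem_nhds hz0) hDu)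
  have hpr : ContinuousAt (fun q => e q - (e q 2) • u) p := by
    have h1 := e.continuousAt hpe
    have h2 : ContinuousAt (fun q => e q 2) p :=
      (EuclideanSpace.proj (𝕜 := ℝ) (2 : Fin 3)).continuous.continuousAt.comp h1
    exact h1.sub (h2.smul continuousAt_const)
  have hmem : ∀ᶠ q in 𝓝 p, e q - (e q 2) • u ∈ Metric.ball (e p) r :=
    hpr (by simpa [hz2] using Metric.ball_mem_nhds (e p) hr)
  filter_upwards [hmem, e.continuousAt hpe (Metric.ball_mem_nhds (e p) hr),
    e.open_source.mem_nhds hpe] with q hq1 hq2 hqe hψq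
  set z := e q with hz
  set z' := z - (z 2) • u with hz'
  have hz'2 : z' 2 = 0 := by simp [hz', u]
  have hconv := convex_ball (e p) r
  have hDw : ∀ w ∈ Metric.ball (e p) r,
      HasFDerivWithinAt (ψ ∘ e.symm) (D w) (Metric.ball (e p) r) w := fun w hw =>
    (hD w (hball hw).1).hasFDerivWithinAt
  -- `ψ` is constant on the surface, so `ψ(z') = ψ(p)` for the projection `z'` of `z` to the surface
  obtain ⟨ξ, hξ, hξe⟩ := domain_mvt hDw hconv (Metric.mem_ball_self hr) hq1
  have hξb := hconv.segment_subset (Metric.mem_ball_self hr) hq1 hξ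
  have hξ2 : ξ 2 = 0 := by
    obtain ⟨s, t, -, -, -, rfl⟩ := hξ
    simp [hz2, hz'2]
  rw [(hker ξ (hball hξb).1 hξ2 _).2 (by simp [hz2, hz'2])] at hξe
  -- `ψ` is strictly monotone in the direction of `z₂`, so `ψ(z) = ψ(z')` only if `z = z'`
  obtain ⟨ζ, hζ, hζe⟩ := domain_mvt hDw hconv hq1 hq2
  have hζb := hconv.segment_subset hq1 hq2 hζ
  have h8 : (ψ ∘ e.symm) z = (ψ ∘ e.symm) (e p) := by
    simp only [Function.comp_apply, hz, e.left_inv hqe, e.left_inv hpe, hψq]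
  rw [show z - z' = (z 2) • u by simp [hz'], map_smul, smul_eq_mul] at hζe
  have h9 : z 2 * D ζ u = 0 := by linarith
  exact (heS q hqe).2 ((mul_eq_zero.1 h9).resolve_right (hball hζb).2)

theorem IsIntegralSurface.ne_zero (hS : IsIntegralSurface ν S) {p : M} (hp : p ∈ S) : ν p ≠ 0 := by
  intro h0
  obtain ⟨e, hpe, he, hes, heS, hν⟩ := hS p hp
  have hz := e.map_source hpe
  have h4 : HasFDerivAt (e ∘ e.symm) ((dfun e (e.symm (e p))).comp (dpar e.symm (e p))) (e p) :=
    hasFDerivAt_comp_param ((he.contMDiffAt (e.open_source.mem_nhds (e.map_target hz))).mdifferentiableAt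
      (by simp)) ((hes.contMDiffAt (e.open_target.mem_nhds hz)).mdifferentiableAt (by simp))
  have h5 : HasFDerivAt (e ∘ e.symm) (ContinuousLinearMap.id ℝ E3) (e p) :=
    (hasFDerivAt_id _).congr_of_eventuallyEq (by
      filter_upwards [e.open_target.mem_nhds hz] with w hw using e.right_inv hw)
  let u : E3 := EuclideanSpace.single 2 1
  have h6 : dfun e (e.symm (e p)) (dpar e.symm (e p) u) = u := congrArg (fun L => L u) (h4.unique h5)
  have h7 : ∀ q, q = p → ∀ v : E3, (dfun e q v) 2 = 0 := by
    rintro q rfl v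
    exact (hν q hpe hp v).1 (by rw [h0]; rfl)
  have h8 := h7 _ (e.left_inv hpe) (dpar e.symm (e p) u)
  rw [h6] at h8
  simp [u] at h8

/-- A curve in the level set of the potential which starts at a zero of `ν` does not meet any
compact integral surface. -/
theorem IsIntegralSurface.notMem_of_level_curve [T2Space M] (hS : IsIntegralSurface ν S)
    (hSc : IsCompact S) (hU : IsOpen U) (hψ : ContMDiffOn (𝓡∂ 3) 𝓘(ℝ, ℝ) ∞ ψ U)
    (hdψ : ∀ p ∈ U, ∀ v : TangentSpace (𝓡∂ 3) p, mfderiv (𝓡∂ 3) 𝓘(ℝ, ℝ) ψ p v = ν p (fun _ => v))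
    {η : ℝ → M} {r : ℝ} (hr : 0 ≤ r) (hη : ContinuousOn η (Icc 0 r)) (hηU : ∀ t ∈ Icc 0 r, η t ∈ U)
    (hlev : ∀ t ∈ Icc 0 r, ψ (η t) = ψ (η 0)) (h0 : ν (η 0) = 0) : η r ∉ S := by
  intro hmem
  have : PreconnectedSpace (Icc 0 r) := Subtype.preconnectedSpace isPreconnected_Icc
  have hc : Continuous ((Icc 0 r).domRestrict η) := continuousOn_iff_continuous_domRestrict.1 hη
  -- the set of parameters at which the curve is on the surface is open and closed
  have hclopen : IsClopen ((Icc 0 r).domRestrict η ⁻¹' S) := by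
    refine ⟨hSc.isClosed.preimage hc, isOpen_iff_mem_nhds.2 fun t ht => ?_⟩
    filter_upwards [hc.continuousAt (hS.eventually_mem_of_eq hU hψ hdψ ht (hηU t t.2))] with u hu
    exact hu ((hlev u u.2).trans (hlev t t.2).symm)
  have huniv := hclopen.eq_univ ⟨⟨r, right_mem_Icc.2 hr⟩, hmem⟩
  have h1 : (⟨0, left_mem_Icc.2 hr⟩ : Icc 0 r) ∈ (Icc 0 r).domRestrict η ⁻¹' S := by
    rw [huniv]; trivial
  exact hS.ne_zero (p := η 0) h1 h0

end Leaf

/-! ### Morse–Bott normal form of the potential -/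

section Morse

variable {M : Type*} [TopologicalSpace M] [T2Space M] [ChartedSpace (EuclideanHalfSpace 3) M]
  [IsManifold (𝓡∂ 3) ∞ M] {B : VField M} {ν : Form M 1} {γ U : Set M} {ψ : M → ℝ}
  {Φ : OpenPartialHomeomorph M (EuclideanSpace ℝ (Fin 2) × Circle)}

theorem cyl_zero_mem (φ : ℝ) : ((0, φ) : Cyl) ∈ cyl 1 := by simp [mem_cyl]

omit [T2Space M] [IsManifold (𝓡∂ 3) ∞ M] in
theorem IsTubularDiffeo.contDiffOn_comp (hΦ : IsTubularDiffeo γ Φ) {W : Type*}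
    [NormedAddCommGroup W] [NormedSpace ℝ W] {f : M → W} (hU : IsOpen U)
    (hf : ContMDiffOn (𝓡∂ 3) 𝓘(ℝ, W) ∞ f U) (hΦU : Φ.source ⊆ U) :
    ContDiffOn ℝ ∞ (f ∘ coordParam Φ) (cyl 1) := fun _ hq =>
  (contDiffAt_comp_param hU hf (hΦ.isLocalDiffeomorphAt hq)
    (hΦU (hΦ.mem_source hq))).contDiffWithinAt

omit [T2Space M] [IsManifold (𝓡∂ 3) ∞ M] in
theorem IsTubularDiffeo.fderiv_comp (hΦ : IsTubularDiffeo γ Φ) {W : Type*}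
    [NormedAddCommGroup W] [NormedSpace ℝ W] {f : M → W} (hU : IsOpen U)
    (hf : ContMDiffOn (𝓡∂ 3) 𝓘(ℝ, W) ∞ f U) (hΦU : Φ.source ⊆ U) {q : Cyl} (hq : q ∈ cyl 1) :
    fderiv ℝ (f ∘ coordParam Φ) q = (dfun f (coordParam Φ q)).comp (dpar (coordParam Φ) q) :=
  (hasFDerivAt_comp_param ((hf.contMDiffAt (hU.mem_nhds (hΦU (hΦ.mem_source hq)))).mdifferentiableAt
    (by simp)) ((hΦ.isLocalDiffeomorphAt hq).mdifferentiableAt (by simp))).fderiv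

omit [T2Space M] [IsManifold (𝓡∂ 3) ∞ M] in
theorem dpar_bijective {V : Type*} [NormedAddCommGroup V] [NormedSpace ℝ V] {κ : V → M} {x : V}
    (hκ : IsLocalDiffeomorphAt 𝓘(ℝ, V) (𝓡∂ 3) ∞ κ x) : Function.Bijective (dpar κ x) :=
  (hκ.mfderivToContinuousLinearEquiv (by simp)).bijective

omit [T2Space M] in
/-- The Hessian of the potential on the axis, in tubular coordinates, is nondegenerate transversally
to the axis. -/
theorem IsTubularDiffeo.hessian_det_ne_zero (hΦ : IsTubularDiffeo γ Φ) (hU : IsOpen U)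
    (hψ : ContMDiffOn (𝓡∂ 3) 𝓘(ℝ, ℝ) ∞ ψ U) (hΦU : Φ.source ⊆ U)
    (h0 : ∀ p ∈ γ, dfun ψ p = 0) {b₀ : M → E3}
    (hess : ∀ p ∈ γ, ∀ v : E3, (∀ w : E3, hessianAt ψ p v w = 0) ↔ v ∈ Submodule.span ℝ {b₀ p})
    (φ : ℝ) {a b c : ℝ} (ha : 2 * a = fderiv ℝ (fderiv ℝ (ψ ∘ coordParam Φ)) (0, φ) ex ex)
    (hb : 2 * b = fderiv ℝ (fderiv ℝ (ψ ∘ coordParam Φ)) (0, φ) ex ey)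
    (hc : 2 * c = fderiv ℝ (fderiv ℝ (ψ ∘ coordParam Φ)) (0, φ) ey ey) :
    a * c - b ^ 2 ≠ 0 := by
  have hq := cyl_zero_mem φ
  have hloc := hΦ.isLocalDiffeomorphAt hq
  have hbij := dpar_bijective hloc
  have hpγ := hΦ.coordParam_mem φ
  set p := coordParam Φ (0, φ) with hp
  set H := fderiv ℝ (fderiv ℝ (ψ ∘ coordParam Φ)) (0, φ) with hH
  have hsm : ContDiffAt ℝ ∞ (ψ ∘ coordParam Φ) (0, φ) :=
    contDiffAt_comp_param hU hψ hloc (hΦU (hΦ.mem_source hq))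
  have hsymm : ∀ v w, H v w = H w v := fun v w =>
    (hsm.isSymmSndFDerivAt (by simpa using WithTop.coe_le_coe.2 (le_top (a := (2 : ℕ∞))))) v w
  have hHess : ∀ v w, H v w = hessianAt ψ p (dpar (coordParam Φ) (0, φ) v)
      (dpar (coordParam Φ) (0, φ) w) := fun v w =>
    fderiv_fderiv_comp_param hU hψ hloc (hΦU (hΦ.mem_source hq)) (h0 _ hpγ) v w
  have hker : ∀ v, (∀ w, H v w = 0) ↔ dpar (coordParam Φ) (0, φ) v ∈ Submodule.span ℝ {b₀ p} := by
    intro v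
    rw [← hess p hpγ]
    constructor
    · intro h w
      obtain ⟨w, rfl⟩ := hbij.2 w
      rw [← hHess, h]
    · intro h w
      rw [hHess, h]
  -- `∂_φ` is in the kernel, because `dψ = 0` along the axis; so the kernel is spanned by it
  have hphi : ∀ w, H ephi w = 0 := by
    have h1 : HasFDerivAt (fderiv ℝ (ψ ∘ coordParam Φ)) H (0, φ) :=
      ((hsm.fderiv_right (m := ∞) (by simp)).differentiableAt (by simp)).hasFDerivAt
    have h2 : HasDerivAt (fun t : ℝ => ((0, t) : Cyl)) ephi φ :=
      (hasDerivAt_const φ (0 : E2)).prodMk (hasDerivAt_id φ)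
    have h3 := h1.comp_hasDerivAt φ h2
    have h4 : fderiv ℝ (ψ ∘ coordParam Φ) ∘ (fun t : ℝ => ((0, t) : Cyl)) = fun _ => 0 := by
      ext1 t
      rw [Function.comp_apply, hΦ.fderiv_comp hU hψ hΦU (cyl_zero_mem t), h0 _ (hΦ.coordParam_mem t),
        ContinuousLinearMap.zero_comp]
    rw [h4] at h3
    have h5 := h3.unique (hasDerivAt_const φ _)
    intro w
    rw [h5]; rfl
  obtain ⟨r, hr⟩ := Submodule.mem_span_singleton.1 ((hker ephi).1 hphi)
  have hr0 : r ≠ 0 := by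
    rintro rfl
    rw [zero_smul] at hr
    have := hbij.1 (hr.symm.trans (map_zero _).symm)
    simp [ephi] at this
  intro hdet
  -- a degenerate transversal Hessian would have a vector `x ∂_x + y ∂_y` in the kernel
  obtain ⟨x, y, hxy, e1, e2⟩ : ∃ x y : ℝ, (x ≠ 0 ∨ y ≠ 0) ∧ a * x + b * y = 0 ∧
      b * x + c * y = 0 := by
    by_cases h1 : b = 0 ∧ a = 0
    · exact ⟨1, 0, Or.inl one_ne_zero, by simp [h1.2], by simp [h1.1]⟩
    · refine ⟨b, -a, ?_, by ring, by linear_combination -hdet⟩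
      by_contra! h2
      exact h1 ⟨h2.1, neg_eq_zero.1 h2.2⟩
  have hv : ∀ w, H (x • ex + y • ey) w = 0 := by
    intro w
    rw [cyl_eq_sum w]
    simp only [map_add, map_smul, add_apply, smul_apply, smul_eq_mul, hsymm _ ephi, hphi]
    rw [hsymm ey ex, ← ha, ← hb, ← hc]
    linear_combination 2 * w.1 0 * e1 + 2 * w.1 1 * e2
  obtain ⟨s, hs⟩ := Submodule.mem_span_singleton.1 ((hker _).1 hv)
  have h6 : x • ex + y • ey = (s / r) • ephi := by
    apply hbij.1
    rw [map_smul, ← hr, ← hs, smul_smul, div_mul_cancel₀ _ hr0]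
  have h7 := congrArg (fun q : Cyl => q.1 0) h6
  have h8 := congrArg (fun q : Cyl => q.1 1) h6
  simp [ex, ey, ephi] at h7 h8
  exact hxy.elim (· h7) (· h8)

theorem contDiffOn_linMap {k11 k12 k21 k22 : Cyl → ℝ} {O : Set Cyl} (h11 : ContDiffOn ℝ ∞ k11 O)
    (h12 : ContDiffOn ℝ ∞ k12 O) (h21 : ContDiffOn ℝ ∞ k21 O) (h22 : ContDiffOn ℝ ∞ k22 O) :
    ContDiffOn ℝ ∞ (linMap k11 k12 k21 k22) O := by
  have h0 : ContDiffOn ℝ ∞ (fun q : Cyl => q.1 0) O := dx.contDiff.contDiffOn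
  have h1 : ContDiffOn ℝ ∞ (fun q : Cyl => q.1 1) O := dy.contDiff.contDiffOn
  rw [contDiffOn_euclidean]
  intro i
  fin_cases i
  · exact (h11.mul h0).add (h12.mul h1)
  · exact (h21.mul h0).add (h22.mul h1)

theorem eq_zero_of_fderiv_linMap_eq_zero {k11 k12 k21 k22 : Cyl → ℝ} {φ : ℝ}
    (h11 : DifferentiableAt ℝ k11 (0, φ)) (h12 : DifferentiableAt ℝ k12 (0, φ))
    (h21 : DifferentiableAt ℝ k21 (0, φ)) (h22 : DifferentiableAt ℝ k22 (0, φ))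
    (hdet : k11 (0, φ) * k22 (0, φ) - k12 (0, φ) * k21 (0, φ) ≠ 0) {v : E2}
    (hv : fderiv ℝ (linMap k11 k12 k21 k22) (0, φ) (v, 0) = 0) : v = 0 := by
  have key : ∀ {k l : Cyl → ℝ}, DifferentiableAt ℝ k (0, φ) → DifferentiableAt ℝ l (0, φ) →
      HasFDerivAt (fun q : Cyl => k q * q.1 0 + l q * q.1 1) (k (0, φ) • dx + l (0, φ) • dy)
        (0, φ) := by
    intro k l hk hl
    refine ((hk.hasFDerivAt.mul dx.hasFDerivAt).add
      (hl.hasFDerivAt.mul dy.hasFDerivAt)).congr_fderiv ?_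
    ext <;> simp [dx, dy]
  have h : HasFDerivAt (linMap k11 k12 k21 k22) (fderiv ℝ (linMap k11 k12 k21 k22) (0, φ)) (0, φ) := by
    refine DifferentiableAt.hasFDerivAt ?_
    rw [differentiableAt_euclidean]
    intro i
    fin_cases i
    · exact (key h11 h12).differentiableAt
    · exact (key h21 h22).differentiableAt
  have hcomp : ∀ i, HasFDerivAt (fun q => linMap k11 k12 k21 k22 q i)
      ((EuclideanSpace.proj i).comp (fderiv ℝ (linMap k11 k12 k21 k22) (0, φ))) (0, φ) := fun i =>
    (EuclideanSpace.proj (𝕜 := ℝ) i).hasFDerivAt.comp _ h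
  have e0 := congrArg (fun L => L ((v, 0) : Cyl)) ((hcomp 0).unique (key h11 h12))
  have e1 := congrArg (fun L => L ((v, 0) : Cyl)) ((hcomp 1).unique (key h21 h22))
  simp [hv, dx, dy] at e0 e1
  have v0 : v 0 = 0 := by
    refine (mul_eq_zero.1 ?_).resolve_left hdet
    linear_combination k12 (0, φ) * e1 - k22 (0, φ) * e0
  have v1 : v 1 = 0 := by
    refine (mul_eq_zero.1 ?_).resolve_left hdet
    linear_combination k21 (0, φ) * e0 - k11 (0, φ) * e1
  ext i
  fin_cases i
  · exact v0
  · exact v1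

theorem hasFDerivAt_sFun (q : Cyl) : HasFDerivAt sFun (q.1 0 • dx + q.1 1 • dy) q := by
  have h0 : HasFDerivAt (fun q : Cyl => q.1 0) dx q := dx.hasFDerivAt
  have h1 : HasFDerivAt (fun q : Cyl => q.1 1) dy q := dy.hasFDerivAt
  have := ((h0.pow 2).add (h1.pow 2)).mul_const (1 / 2)
  refine (this.congr_of_eventuallyEq (.of_forall fun z => ?_)).congr_fderiv ?_
  · simp [sFun]; ring
  · ext <;> simp <;> ring

/-- The potential of a nondegenerate axis is `c₀ + κ s` in suitable tubular coordinates. The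
Hessian is definite, since otherwise a level curve of the potential would connect the axis to a
regular closed leaf. -/
theorem IsNondegenerateAxis.exists_morse_coords [SecondCountableTopology M]
    {μ : Form M 3} (h : IsFluxSystem B ν μ) (hγ : IsNondegenerateAxis B ν γ) :
    ∃ Φ : OpenPartialHomeomorph M (EuclideanSpace ℝ (Fin 2) × Circle), IsTubularDiffeo γ Φ ∧
      ∃ κ : ℝ, κ ≠ 0 ∧ ∀ q ∈ cyl 1, ∀ v : Cyl,
        (ν (coordParam Φ q) : E3 [⋀^Fin 1]→L[ℝ] ℝ) (fun _ => dpar (coordParam Φ) q v) =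
          κ * (q.1 0 * v.1 0 + q.1 1 * v.1 1) := by
  obtain ⟨hax, U, ψ, hU, hγU, hψ, hdψ, hess⟩ := id hγ
  obtain ⟨U₂, hU₂, hγU₂, hleaf⟩ := hax.nearby_leaves
  obtain ⟨Φ, hΦ, hΦU⟩ := hγ.exists_isTubularDiffeo h (hU.inter hU₂) (subset_inter hγU hγU₂)
  have hΦU₁ : Φ.source ⊆ U := hΦU.trans inter_subset_left
  have h0 : ∀ p ∈ γ, dfun ψ p = 0 := fun p hp => by
    ext1 v
    refine (hdψ p (hγU hp) v).trans ?_
    rw [hax.critical p hp]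
    rfl
  obtain ⟨b₀, hb₀⟩ : ∃ b : M → E3, ∀ p, b p = B p := ⟨B, fun _ => rfl⟩
  set f := ψ ∘ coordParam Φ with hf
  have hfs : ContDiffOn ℝ ∞ f (cyl 1) := hΦ.contDiffOn_comp hU hψ hΦU₁
  have hfd : ∀ φ, fderiv ℝ f (0, φ) = 0 := fun φ => by
    rw [hΦ.fderiv_comp hU hψ hΦU₁ (cyl_zero_mem φ), h0 _ (hΦ.coordParam_mem φ),
      ContinuousLinearMap.zero_comp]
  have hper : ∀ q : Cyl, f (q.1, q.2 + 2 * Real.pi) = f q := fun q =>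
    congrArg ψ (coordParam_periodic Φ q)
  have hconst : ∀ φ, f (0, φ) = f (0, 0) := by
    have hder : ∀ φ, HasDerivAt (fun t : ℝ => f (0, t)) 0 φ := fun φ => by
      have h1 : HasFDerivAt f (0 : Cyl →L[ℝ] ℝ) (0, φ) := by
        rw [← hfd φ]
        exact ((hfs.contDiffAt ((isOpen_cyl 1).mem_nhds (cyl_zero_mem φ))).differentiableAt
          (by simp)).hasFDerivAt
      have h2 : HasDerivAt (fun t : ℝ => ((0, t) : Cyl)) ephi φ :=
        (hasDerivAt_const φ (0 : E2)).prodMk (hasDerivAt_id φ)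
      exact h1.comp_hasDerivAt φ h2
    exact fun φ => is_const_of_deriv_eq_zero (fun t => (hder t).differentiableAt)
      (fun t => (hder t).deriv) φ 0
  obtain ⟨a, b, c, ⟨ha, hb, hc⟩, ⟨hap, hbp, hcp⟩, hquad, hD2⟩ :=
    exists_quadratic_form hfs hper hconst hfd
  have hcont : ∀ {k : Cyl → ℝ}, ContDiffOn ℝ ∞ k (cyl 1) → Continuous fun φ : ℝ => k (0, φ) :=
    fun hk => hk.continuousOn.comp_continuous (by fun_prop) cyl_zero_mem
  have hdet : ∀ φ, 0 < a (0, φ) * c (0, φ) - b (0, φ) ^ 2 := by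
    intro φ
    have hne := hΦ.hessian_det_ne_zero hU hψ hΦU₁ h0 (b₀ := b₀)
      (fun p hp v => by rw [hb₀]; exact hess p hp v) φ (hD2 φ).1 (hD2 φ).2.1 (hD2 φ).2.2
    refine lt_of_le_of_ne ?_ hne.symm
    -- If the Hessian were indefinite, a level curve of `ψ` would lead from the axis to a nearby point,
    -- which lies on a compact leaf.
    by_contra! hneg
    have hin : ∀ {k : Cyl → ℝ}, ContDiffOn ℝ ∞ k (cyl 1) →
        ContDiffOn ℝ ∞ (fun z : E2 => k (z, φ)) (Metric.ball 0 1) := fun hk =>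
      hk.comp (contDiff_id.prodMk contDiff_const).contDiffOn fun z hz => ⟨hz, trivial⟩
    obtain ⟨σ, r, hr, hσ, hσ0, hσr⟩ := exists_null_curve (hin ha) (hin hb) (hin hc) hneg
    have hσmem : ∀ t ∈ Icc 0 r, ((σ t, φ) : Cyl) ∈ cyl 1 := by
      intro t ht
      rcases ht.1.eq_or_lt with rfl | h1
      · rw [hσ0]; exact cyl_zero_mem φ
      · exact mem_cyl.2 (hσr t ⟨h1, ht.2⟩).2.1
    have hend := hσmem r (right_mem_Icc.2 hr.le)
    have hnot : coordParam Φ (σ r, φ) ∉ γ := by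
      rw [hΦ.axis _ (hΦ.mem_source hend), hΦ.apply_coordParam hend]
      exact (hσr r (right_mem_Ioc.2 hr)).1
    obtain ⟨S, hS, hpS⟩ := hleaf ⟨(hΦU (hΦ.mem_source hend)).2, hnot⟩
    refine hS.integral.notMem_of_level_curve hS.compact hU hψ hdψ (η := fun t => coordParam Φ (σ t, φ))
      hr.le ?_ (fun t ht => hΦU₁ (hΦ.mem_source (hσmem t ht))) (fun t ht => ?_) ?_ hpS
    · intro t ht
      exact ContinuousAt.comp_continuousWithinAt
        (g := coordParam Φ) (f := fun t => ((σ t, φ) : Cyl))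
        ((hΦ.isLocalDiffeomorphAt (hσmem t ht)).contMDiffAt.continuousAt)
        ((hσ t ht).prodMk continuousWithinAt_const)
    · change f (σ t, φ) = f (σ 0, φ)
      rw [hσ0, hconst]
      rcases ht.1.eq_or_lt with rfl | h1
      · rw [hσ0, hconst]
      · rw [hquad _ (hσmem t ht)]
        simp only [(hσr t ⟨h1, ht.2⟩).2.2, add_zero]
    · exact hax.critical _ (by simp only [hσ0]; exact hΦ.coordParam_mem φ)
  have ha0 : ∀ φ, a (0, φ) ≠ 0 := fun φ h1 => by
    have := hdet φ
    rw [h1] at this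
    nlinarith [sq_nonneg (b (0, φ))]
  -- the sign of the Hessian is constant along the axis
  obtain ⟨s, hs2, hsa⟩ : ∃ s : ℝ, s * s = 1 ∧ ∀ φ, 0 < s * a (0, φ) := by
    rcases (ha0 0).lt_or_gt with h1 | h1
    · refine ⟨-1, by norm_num, fun φ => ?_⟩
      by_contra! h2
      obtain ⟨t, ht⟩ := mem_range_of_exists_le_of_exists_ge (hcont ha) (c := 0) ⟨0, h1.le⟩
        ⟨φ, by linarith⟩
      exact ha0 t ht
    · refine ⟨1, by norm_num, fun φ => ?_⟩
      by_contra! h2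
      obtain ⟨t, ht⟩ := mem_range_of_exists_le_of_exists_ge (hcont ha) (c := 0)
        ⟨φ, by linarith⟩ ⟨0, h1.le⟩
      exact ha0 t ht
  -- in the new coordinates `s (ψ - c₀)` is the square of the distance from the axis
  obtain ⟨k11, k12, k21, k22, δ, hδ, hδ1, ⟨h11, h12, h21, h22⟩, ⟨p11, p12, p21, p22⟩, hk, hform⟩ :=
    exists_diagonalization (a := fun q => s * a q) (b := fun q => s * b q) (c := fun q => s * c q)
      (contDiffOn_const.mul ha) (contDiffOn_const.mul hb) (contDiffOn_const.mul hc)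
      (fun q => by rw [hap]) (fun q => by rw [hbp]) (fun q => by rw [hcp]) hsa
      (fun φ => by
        have := hdet φ
        linear_combination (exp := 1) this - (a (0, φ) * c (0, φ) - b (0, φ) ^ 2) * hs2)
  have hat : ∀ {k : Cyl → ℝ}, ContDiffOn ℝ ∞ k (cyl δ) → ∀ φ, DifferentiableAt ℝ k (0, φ) :=
    fun hk φ => (hk.contDiffAt ((isOpen_cyl δ).mem_nhds (by simpa [mem_cyl] using hδ))).differentiableAt
      (by simp)
  obtain ⟨ε, hε, hε1, Φ', hΦ', hch⟩ := hΦ.exists_change hδ hδ1 (contDiffOn_linMap h11 h12 h21 h22)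
    (fun q => by simp only [linMap, p11, p12, p21, p22])
    (fun φ => by ext i; fin_cases i <;> simp [linMap])
    (fun φ v hv => eq_zero_of_fderiv_linMap_eq_zero (hat h11 φ) (hat h12 φ) (hat h21 φ) (hat h22 φ)
      (hk φ) hv)
  have hval : ∀ q ∈ cyl 1, coordParam Φ' q ∈ U ∧
      ψ (coordParam Φ' q) = f (0, 0) + 2 * s * ε ^ 2 * sFun q := by
    intro q' hq'
    obtain ⟨q, hq, -, hg, hP, -⟩ := hch q' hq'
    have hq1 : q ∈ cyl 1 := prod_mono (Metric.ball_subset_ball hδ1) le_rfl hq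
    rw [hP]
    refine ⟨hΦU₁ (hΦ.mem_source hq1), ?_⟩
    change f q = _
    have h1 := hform q hq
    rw [← hg, norm_smul, mul_pow, Real.norm_of_nonneg hε.le] at h1
    rw [hquad q hq1, sFun_eq]
    linear_combination s * h1 -
      (a q * q.1 0 ^ 2 + 2 * b q * (q.1 0 * q.1 1) + c q * q.1 1 ^ 2) * hs2
  have hs0 : s ≠ 0 := by rintro rfl; simp at hs2
  refine ⟨Φ', hΦ', 2 * s * ε ^ 2, by positivity, fun q hq v => ?_⟩
  have h1 : HasFDerivAt (ψ ∘ coordParam Φ') _ q :=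
    hasFDerivAt_comp_param ((hψ.contMDiffAt (hU.mem_nhds (hval q hq).1)).mdifferentiableAt (by simp))
      ((hΦ'.isLocalDiffeomorphAt hq).mdifferentiableAt (by simp))
  have h2 : HasFDerivAt (ψ ∘ coordParam Φ') _ q :=
    (((hasFDerivAt_sFun q).const_mul (2 * s * ε ^ 2)).const_add (f (0, 0))).congr_of_eventuallyEq (by
      filter_upwards [(isOpen_cyl 1).mem_nhds hq] with z hz using (hval z hz).2)
  have h3 := congrArg (fun L => L v) (h1.unique h2)
  refine ((hdψ _ (hval q hq).1 (dpar (coordParam Φ') q v)).symm.trans h3).trans ?_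
  rfl

end Morse

/-! ### Forms on the cylinder -/

theorem wedge_apply {V : Type*} [NormedAddCommGroup V] [NormedSpace ℝ V] {k : ℕ}
    (α : Fin k → (V →L[ℝ] ℝ)) (v : Fin k → V) :
    wedge α v = Matrix.det (Matrix.of fun j i => α i (v j)) := by
  rw [wedge, ContinuousMultilinearMap.alternatization_apply_apply, Matrix.det_apply]
  rfl

theorem wedge_two (α β : Cyl →L[ℝ] ℝ) (v w : Cyl) :
    wedge ![α, β] ![v, w] = α v * β w - α w * β v := by
  rw [wedge_apply, Matrix.det_fin_two]
  simp
  ring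

theorem exists_cyl_basis : ∃ e : Module.Basis (Fin 3) ℝ Cyl, ⇑e = ![ex, ey, ephi] := by
  have hli : LinearIndependent ℝ ![ex, ey, ephi] := by
    rw [Fintype.linearIndependent_iff]
    intro g hg
    replace hg : g 0 • ex + g 1 • ey + g 2 • ephi = 0 := by simpa [Fin.sum_univ_three] using hg
    have h0 := congrArg (fun q : Cyl => q.1 0) hg
    have h1 := congrArg (fun q : Cyl => q.1 1) hg
    have h2 := congrArg (fun q : Cyl => q.2) hg
    simp [ex, ey, ephi] at h0 h1 h2
    intro i
    fin_cases i <;> assumption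
  exact ⟨basisOfLinearIndependentOfCardEqFinrank hli (by simp),
    coe_basisOfLinearIndependentOfCardEqFinrank _ _⟩

theorem wedge_three : wedge ![dx, dy, dphi] ![ex, ey, ephi] = 1 := by
  rw [wedge_apply, Matrix.det_fin_three]
  simp [dx, dy, dphi, ex, ey, ephi]

theorem three_form_eq (α : Cyl [⋀^Fin 3]→L[ℝ] ℝ) :
    α = α ![ex, ey, ephi] • wedge ![dx, dy, dphi] := by
  obtain ⟨e, he⟩ := exists_cyl_basis
  have h : (α - α ![ex, ey, ephi] • wedge ![dx, dy, dphi]).toAlternatingMap = 0 := by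
    rw [← AlternatingMap.map_basis_eq_zero_iff e, he]
    change α ![ex, ey, ephi] - α ![ex, ey, ephi] • wedge ![dx, dy, dphi] ![ex, ey, ephi] = 0
    rw [wedge_three]; simp
  exact sub_eq_zero.1 (ContinuousAlternatingMap.toAlternatingMap_injective h)

theorem two_form_apply (α : Cyl [⋀^Fin 2]→L[ℝ] ℝ) (v w : Cyl) :
    α ![v, w] = (v.1 0 * w.1 1 - v.1 1 * w.1 0) * α ![ex, ey] +
      (v.1 0 * w.2 - v.2 * w.1 0) * α ![ex, ephi] + (v.1 1 * w.2 - v.2 * w.1 1) * α ![ey, ephi] := by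
  have e : ∀ u, two α v u = v.1 0 * two α ex u + v.1 1 * two α ey u + v.2 * two α ephi u := by
    intro u
    have h := congrArg (two α u) (cyl_eq_sum v)
    rw [map_add, map_add, map_smul, map_smul, map_smul, two_swap α u, two_swap α u, two_swap α u,
      two_swap α u] at h
    simp only [smul_eq_mul] at h
    linarith
  simp only [← two_apply]
  have h : ∀ u, two α u w = w.1 0 * two α u ex + w.1 1 * two α u ey + w.2 * two α u ephi := by
    intro u
    have h := congrArg (two α u) (cyl_eq_sum w)
    rwa [map_add, map_add, map_smul, map_smul, map_smul] at h
  rw [e, h, h, h]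
  simp only [two_self, two_swap α ey ex, two_swap α ephi ex, two_swap α ephi ey]
  ring

theorem two_form_ext {α β : Cyl [⋀^Fin 2]→L[ℝ] ℝ} (h : ∀ v w, α ![v, w] = β ![v, w]) : α = β := by
  ext v
  have : v = ![v 0, v 1] := by ext i : 1; fin_cases i <;> rfl
  rw [this, h]

/-- The components of `ι_X α` for a 3-form `α`. -/
theorem three_form_contract (α : Cyl [⋀^Fin 3]→L[ℝ] ℝ) (X : Cyl) :
    α ![X, ex, ey] = X.2 * α ![ex, ey, ephi] ∧ α ![X, ex, ephi] = -X.1 1 * α ![ex, ey, ephi] ∧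
      α ![X, ey, ephi] = X.1 0 * α ![ex, ey, ephi] := by
  have h : ∀ v w : Cyl, α ![X, v, w] = X.1 0 * α ![ex, v, w] + X.1 1 * α ![ey, v, w] +
      X.2 * α ![ephi, v, w] := by
    intro v w
    have h1 : ∀ Y : Cyl, α ![Y, v, w] = α.curryLeft Y ![v, w] := fun _ => rfl
    have h2 := congrArg (fun Y => α.curryLeft Y ![v, w]) (cyl_eq_sum X)
    simp only [map_add, map_smul] at h2
    exact h2
  have hz : ∀ (u : Fin 3 → Cyl) (i j : Fin 3), i ≠ j → u i = u j → α u = 0 := fun u i j hij he =>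
    α.map_eq_zero_of_eq u he hij
  have s0 : ∀ (u : Fin 3 → Cyl) (i j : Fin 3), i ≠ j → α (u ∘ Equiv.swap i j) = -α u := fun u i j h =>
    α.toAlternatingMap.map_swap u h
  have s2 : α ![ey, ex, ephi] = -α ![ex, ey, ephi] := by
    rw [← s0 _ 0 1 (by decide)]
    congr 1
    ext i : 1; fin_cases i <;> rfl
  have s1 : α ![ephi, ex, ey] = α ![ex, ey, ephi] := by
    have h3 : α ![ephi, ex, ey] = -α ![ey, ex, ephi] := by
      rw [← s0 _ 0 2 (by decide)]
      congr 1
      ext i : 1; fin_cases i <;> rfl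
    rw [h3, s2, neg_neg]
  refine ⟨?_, ?_, ?_⟩
  · rw [h, hz ![ex, ex, ey] 0 1 (by decide) rfl, hz ![ey, ex, ey] 0 2 (by decide) rfl, s1]; ring
  · rw [h, hz ![ex, ex, ephi] 0 1 (by decide) rfl, hz ![ephi, ex, ephi] 0 2 (by decide) rfl, s2]; ring
  · rw [h, hz ![ey, ey, ephi] 0 1 (by decide) rfl, hz ![ephi, ey, ephi] 0 2 (by decide) rfl]; ring

/-- Functions are determined by their values off a coordinate plane. -/
theorem eq_zero_of_mul_eq_zero {L : Cyl →L[ℝ] ℝ} {e : Cyl} (he : L e = 1) {h : Cyl → ℝ}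
    (hc : ContinuousOn h (cyl 1)) (h0 : ∀ q ∈ cyl 1, L q * h q = 0) {q : Cyl} (hq : q ∈ cyl 1) :
    h q = 0 := by
  by_cases hL : L q = 0
  · have hcurve : Filter.Tendsto (fun t : ℝ => q + t • e) (𝓝[≠] 0) (𝓝 q) := by
      have : ContinuousAt (fun t : ℝ => q + t • e) 0 := by fun_prop
      have h1 := this.tendsto
      simp only [zero_smul, add_zero] at h1
      exact h1.mono_left nhdsWithin_le_nhds
    have h1 : Filter.Tendsto (fun t : ℝ => h (q + t • e)) (𝓝[≠] 0) (𝓝 (h q)) :=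
      (hc.continuousAt ((isOpen_cyl 1).mem_nhds hq)).tendsto.comp hcurve
    have h2 : ∀ᶠ t : ℝ in 𝓝[≠] 0, h (q + t • e) = 0 := by
      filter_upwards [hcurve ((isOpen_cyl 1).mem_nhds hq), self_mem_nhdsWithin] with t ht ht0
      have := h0 _ ht
      rw [map_add, map_smul, hL, he] at this
      simpa [show t ≠ 0 from ht0] using this
    exact tendsto_nhds_unique h1 ((Filter.tendsto_congr' h2).2 tendsto_const_nhds)
  · exact (mul_eq_zero.1 (h0 q hq)).resolve_left hL

/-- If `y f = x g`, then `(f, g) = b (x, y)` for a smooth function `b`. -/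
theorem exists_eq_mul_of_mul_eq {f g : Cyl → ℝ} (hf : ContDiffOn ℝ ∞ f (cyl 1))
    (hg : ContDiffOn ℝ ∞ g (cyl 1)) (hper : ∀ q : Cyl, f (q.1, q.2 + 2 * Real.pi) = f q)
    (h : ∀ q ∈ cyl 1, q.1 1 * f q = q.1 0 * g q) :
    ∃ b : Cyl → ℝ, ContDiffOn ℝ ∞ b (cyl 1) ∧ (∀ q : Cyl, b (q.1, q.2 + 2 * Real.pi) = b q) ∧
      ∀ q ∈ cyl 1, f q = q.1 0 * b q ∧ g q = q.1 1 * b q := by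
  have h0 : ∀ q ∈ cyl 1, q.1 0 = 0 → f q = 0 := by
    intro q hq hq0
    -- where `x = 0`, the equation gives `y f = 0`, hence `f = 0` off the axis, and on it by continuity
    let π : Cyl → Cyl := fun q => q - dx q • ex
    have h00 : ∀ q, (π q).1 0 = 0 := fun q => by simp [π, dx, ex]
    have h01 : ∀ q, (π q).1 1 = q.1 1 := fun q => by simp [π, dx, ex]
    have hπc : Continuous π := by fun_prop
    have hπ : MapsTo π (cyl 1) (cyl 1) := fun q hq => by
      rw [mem_cyl] at hq ⊢
      have h1 := norm_sq_eq (π q).1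
      have h2 := norm_sq_eq q.1
      rw [h00, h01] at h1
      nlinarith [norm_nonneg (π q).1, norm_nonneg q.1, sq_nonneg (q.1 0)]
    have h1 := eq_zero_of_mul_eq_zero (L := dy) (e := ey) (by simp [dy, ey]) (h := f ∘ π)
      (hf.continuousOn.comp hπc.continuousOn hπ) (fun q hq => by
        have := h _ (hπ hq)
        rwa [h00, h01, zero_mul] at this) hq
    have h2 : π q = q := by simp [π, show dx q = 0 from hq0]
    rwa [Function.comp_apply, h2] at h1
  obtain ⟨b, hb, hbp, hfb⟩ := exists_eq_x_mul hf hper h0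
  refine ⟨b, hb, hbp, fun q hq => ⟨hfb q hq, ?_⟩⟩
  refine sub_eq_zero.1 (eq_zero_of_mul_eq_zero (L := dx) (e := ex) (by simp [dx, ex])
    (h := fun q => g q - dy q * b q)
    (hg.continuousOn.sub (dy.continuous.continuousOn.mul hb.continuousOn)) (fun q hq => ?_) hq)
  change q.1 0 * (g q - q.1 1 * b q) = 0
  have := h q hq
  rw [hfb q hq] at this
  linarith

/-! ### The flux system in tubular coordinates -/

section Coords

variable {M : Type*} [TopologicalSpace M] [ChartedSpace (EuclideanHalfSpace 3) M]
  {B : VField M} {ν : Form M 1} {μ : Form M 3} {γ : Set M}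
  {Φ : OpenPartialHomeomorph M (EuclideanSpace ℝ (Fin 2) × Circle)}

theorem three_form_apply (α : Cyl [⋀^Fin 3]→L[ℝ] ℝ) (u v w : Cyl) :
    α ![u, v, w] = α ![ex, ey, ephi] * (u.1 0 * v.1 1 * w.2 - u.1 0 * v.2 * w.1 1 -
      u.1 1 * v.1 0 * w.2 + u.1 1 * v.2 * w.1 0 + u.2 * v.1 0 * w.1 1 - u.2 * v.1 1 * w.1 0) := by
  have h := congrArg (fun f => f ![u, v, w]) (three_form_eq α)
  refine h.trans ?_
  change α ![ex, ey, ephi] * wedge ![dx, dy, dphi] ![u, v, w] = _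
  rw [wedge_apply, Matrix.det_fin_three]
  rfl

section Change

variable {κ κ' : Cyl → M} {h : Cyl → Cyl} {H : Cyl →L[ℝ] Cyl} {q : Cyl}

theorem dpar_of_eventuallyEq (hκ' : MDifferentiableAt 𝓘(ℝ, Cyl) (𝓡∂ 3) κ' (h q))
    (hh : HasFDerivAt h H q) (he : ∀ᶠ r in 𝓝 q, κ' (h r) = κ r) :
    dpar κ q = (dpar κ' (h q)).comp H :=
  ((hκ'.hasMFDerivAt.comp q hh.hasMFDerivAt).congr_of_eventuallyEq
    (he.mono fun _ hr => hr.symm)).mfderiv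

/-- Pullbacks under a change of coordinates. -/
theorem pullback_of_eventuallyEq (hκ' : MDifferentiableAt 𝓘(ℝ, Cyl) (𝓡∂ 3) κ' (h q))
    (hh : HasFDerivAt h H q) (he : ∀ᶠ r in 𝓝 q, κ' (h r) = κ r) {k : ℕ} (α : Form M k)
    (v : Fin k → Cyl) : pullback κ α q v = pullback κ' α (h q) (fun i => H (v i)) := by
  have h1 := dpar_of_eventuallyEq hκ' hh he
  have h2 : ∀ p, p = κ q → ∀ u : Fin k → E3, (α p : E3 [⋀^Fin k]→L[ℝ] ℝ) u = α (κ q) u := by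
    rintro p rfl u; rfl
  rw [pullback_apply, pullback_apply]
  have h3 : ∀ i, dpar κ q (v i) = dpar κ' (h q) (H (v i)) := fun i => by rw [h1]; rfl
  refine Eq.trans ?_ (h2 _ he.self_of_nhds _).symm
  exact congrArg (α (κ q) : E3 [⋀^Fin k]→L[ℝ] ℝ) (funext h3)

end Change

theorem IsTubularDiffeo.mdifferentiableAt (hΦ : IsTubularDiffeo γ Φ) {q : Cyl} (hq : q ∈ cyl 1) :
    MDifferentiableAt 𝓘(ℝ, Cyl) (𝓡∂ 3) (coordParam Φ) q :=
  (hΦ.isLocalDiffeomorphAt hq).mdifferentiableAt (by simp)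

/-- The components of a form in the coordinates are periodic in `φ`. -/
theorem IsTubularDiffeo.pullback_periodic (hΦ : IsTubularDiffeo γ Φ) {q : Cyl} (hq : q ∈ cyl 1)
    {k : ℕ} (α : Form M k) (v : Fin k → Cyl) :
    pullback (coordParam Φ) α (q.1, q.2 + 2 * Real.pi) v = pullback (coordParam Φ) α q v := by
  obtain ⟨h, hh⟩ : ∃ h : Cyl → Cyl, ∀ r, h r = (r.1, r.2 + 2 * Real.pi) := ⟨_, fun _ => rfl⟩
  have hd : HasFDerivAt h (ContinuousLinearMap.id ℝ Cyl) q := by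
    refine ((hasFDerivAt_id (𝕜 := ℝ) q).add_const ((0, 2 * Real.pi) : Cyl)).congr_of_eventuallyEq
      (.of_forall fun r => ?_)
    simp [hh, Prod.ext_iff]
  have hq' : h q ∈ cyl 1 := by
    rw [hh, mem_cyl]
    exact mem_cyl.1 hq
  rw [← hh]
  exact (pullback_of_eventuallyEq (hΦ.mdifferentiableAt hq') hd
    (.of_forall fun r => by rw [hh]; exact coordParam_periodic Φ r) α v).symm

theorem IsTubularDiffeo.volume_ne_zero (hΦ : IsTubularDiffeo γ Φ) (hμ : ∀ p, μ p ≠ 0) {q : Cyl}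
    (hq : q ∈ cyl 1) : pullback (coordParam Φ) μ q ![ex, ey, ephi] ≠ 0 := by
  intro h0
  apply hμ (coordParam Φ q)
  have h1 := three_form_eq (pullback (coordParam Φ) μ q)
  rw [h0, zero_smul] at h1
  have hs := (dpar_bijective (hΦ.isLocalDiffeomorphAt hq)).2
  have h2 : ∀ v : Fin 3 → E3, (μ (coordParam Φ q) : E3 [⋀^Fin 3]→L[ℝ] ℝ) v = 0 := by
    intro v
    choose u hu using fun i => hs (v i)
    have h3 := pullback_apply (coordParam Φ) μ q u
    rw [h1] at h3
    refine Eq.trans ?_ h3.symm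
    exact congrArg (μ (coordParam Φ q) : E3 [⋀^Fin 3]→L[ℝ] ℝ) (funext fun i => (hu i).symm)
  exact ContinuousAlternatingMap.ext h2

/-- The vector field `X` which represents `B` in the coordinates satisfies `Φ_* (ι_B μ) = ι_X (Φ_* μ)`. -/
theorem IsTubularDiffeo.exists_field (hΦ : IsTubularDiffeo γ Φ) (B : VField M) (μ : Form M 3)
    {q : Cyl} (hq : q ∈ cyl 1) : ∃ X : Cyl, dpar (coordParam Φ) q X = B (coordParam Φ q) ∧
      ∀ v w, pullback (coordParam Φ) (iota B μ) q ![v, w] =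
        pullback (coordParam Φ) μ q ![X, v, w] := by
  obtain ⟨X, hX⟩ := (dpar_bijective (hΦ.isLocalDiffeomorphAt hq)).2 (B (coordParam Φ q))
  refine ⟨X, hX, fun v w => ?_⟩
  rw [pullback_apply, pullback_apply]
  have : ∀ i, Fin.cons (α := fun _ => E3) (B (coordParam Φ q)) (fun i => dpar (coordParam Φ) q (![v, w] i)) i =
      dpar (coordParam Φ) q (![X, v, w] i) := by
    intro i
    refine Fin.cases ?_ (fun j => ?_) i
    · exact hX.symm
    · rfl
  exact congrArg (μ (coordParam Φ q) : E3 [⋀^Fin 3]→L[ℝ] ℝ) (funext this)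

theorem isPreconnected_cyl (r : ℝ) : IsPreconnected (cyl r) :=
  (convex_ball (0 : E2) r).isPreconnected.prod isPreconnected_univ

/-- The density of the volume form has constant sign, since the solid torus is connected. -/
theorem IsTubularDiffeo.volume_pos [IsManifold (𝓡∂ 3) ∞ M] (hΦ : IsTubularDiffeo γ Φ)
    (hμ : SmoothForm μ) (hμ0 : ∀ p, μ p ≠ 0) {q₀ : Cyl} (hq₀ : q₀ ∈ cyl 1)
    (h0 : 0 < pullback (coordParam Φ) μ q₀ ![ex, ey, ephi]) {q : Cyl} (hq : q ∈ cyl 1) :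
    0 < pullback (coordParam Φ) μ q ![ex, ey, ephi] := by
  by_contra! h1
  have hmc : ContinuousOn (fun q => pullback (coordParam Φ) μ q ![ex, ey, ephi]) (cyl 1) :=
    fun q hq => ((hμ.smoothInterior.contDiffAt_pullback (hΦ.isLocalDiffeomorphAt hq)
      ![ex, ey, ephi]).continuousAt).continuousWithinAt
  obtain ⟨r, hr, hr0⟩ := (isPreconnected_cyl 1).intermediate_value hq hq₀ hmc ⟨h1, h0.le⟩
  exact hΦ.volume_ne_zero hμ0 hr hr0

/-- The potential of a nondegenerate axis is a nonzero multiple of `s` plus a constant in suitable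
positively oriented tubular coordinates. -/
theorem IsNondegenerateAxis.exists_oriented_morse_coords [T2Space M] [IsManifold (𝓡∂ 3) ∞ M]
    [SecondCountableTopology M] (h : IsFluxSystem B ν μ) (hγ : IsNondegenerateAxis B ν γ) :
    ∃ Φ : OpenPartialHomeomorph M (EuclideanSpace ℝ (Fin 2) × Circle), IsTubularDiffeo γ Φ ∧
      (∀ q ∈ cyl 1, 0 < pullback (coordParam Φ) μ q ![ex, ey, ephi]) ∧
      ∃ κ : ℝ, κ ≠ 0 ∧ ∀ q ∈ cyl 1, ∀ v : Cyl,
        pullback (coordParam Φ) ν q (fun _ => v) = κ * (q.1 0 * v.1 0 + q.1 1 * v.1 1) := by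
  obtain ⟨Φ, hΦ, κ, hκ, hν⟩ := hγ.exists_morse_coords h
  replace hν : ∀ q ∈ cyl 1, ∀ v : Cyl,
      pullback (coordParam Φ) ν q (fun _ => v) = κ * (q.1 0 * v.1 0 + q.1 1 * v.1 1) :=
    fun q hq v => (pullback_apply _ _ _ _).trans (hν q hq v)
  by_cases hpos : 0 < pullback (coordParam Φ) μ (0, 0) ![ex, ey, ephi]
  · exact ⟨Φ, hΦ, fun q hq => hΦ.volume_pos h.smooth_mu h.volume (cyl_zero_mem 0) hpos hq, κ, hκ, hν⟩
  -- otherwise reverse the orientation by the reflection in the `x`-axis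
  let G : Cyl →L[ℝ] E2 := dx.smulRight (EuclideanSpace.single 0 1) -
    dy.smulRight (EuclideanSpace.single 1 1)
  have hG0 : ∀ q, G q 0 = q.1 0 := fun q => by simp [G, dx]
  have hG1 : ∀ q, G q 1 = -q.1 1 := fun q => by simp [G, dy]
  obtain ⟨ε, hε, -, Φ', hΦ', hch⟩ := hΦ.exists_change one_pos le_rfl (g := G) G.contDiff.contDiffOn
    (fun q => by simp [G, dx, dy]) (fun φ => by simp [G, dx, dy])
    (fun φ v hv => by
      rw [G.fderiv] at hv
      have h0 := hG0 (v, 0)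
      have h1 := hG1 (v, 0)
      rw [hv] at h0 h1
      ext i
      fin_cases i
      · simpa using h0.symm
      · simpa using h1.symm)
  let H : Cyl →L[ℝ] Cyl := (ε⁻¹ • G).prod dphi
  have hH0 : ∀ q, (H q).1 0 = ε⁻¹ * q.1 0 := fun q => by simp [H, hG0]
  have hH1 : ∀ q, (H q).1 1 = -(ε⁻¹ * q.1 1) := fun q => by simp [H, hG1]
  have hH2 : ∀ q, (H q).2 = q.2 := fun q => rfl
  have hchange : ∀ q' ∈ cyl 1, ∃ q ∈ cyl 1, H q = q' ∧ ∀ {k : ℕ} (α : Form M k) (v : Fin k → Cyl),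
      pullback (coordParam Φ) α q v = pullback (coordParam Φ') α q' (fun i => H (v i)) := by
    intro q' hq'
    obtain ⟨q, hq, hq2, hg, -, he⟩ := hch q' hq'
    have hHq : H q = q' := by
      refine Prod.ext ?_ hq2
      change ε⁻¹ • G q = q'.1
      rw [← hg, inv_smul_smul₀ hε.ne']
    refine ⟨q, hq, hHq, fun α v => ?_⟩
    subst hHq
    exact pullback_of_eventuallyEq (hΦ'.mdifferentiableAt hq') H.hasFDerivAt he α v
  refine ⟨Φ', hΦ', fun q' hq' => ?_, κ * ε ^ 2, by positivity, fun q' hq' v => ?_⟩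
  · obtain ⟨q, hq, -, hα⟩ := hchange q' hq'
    have h1 := (hα μ ![ex, ey, ephi]).trans ((congrArg _ (show (fun i => H (![ex, ey, ephi] i)) =
      ![H ex, H ey, H ephi] by ext i : 1; fin_cases i <;> rfl)).trans (three_form_apply _ _ _ _))
    have h2 : pullback (coordParam Φ) μ q ![ex, ey, ephi] < 0 := by
      by_contra! h2
      exact hpos (hΦ.volume_pos h.smooth_mu h.volume hq
        (lt_of_le_of_ne h2 (hΦ.volume_ne_zero h.volume hq).symm) (cyl_zero_mem 0))
    rw [h1] at h2
    generalize pullback (coordParam Φ') μ q' ![ex, ey, ephi] = c at h2 ⊢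
    simp only [hH0, hH1, hH2] at h2
    simp [ex, ey, ephi] at h2
    have h3 : 0 < ε⁻¹ * ε⁻¹ := by positivity
    nlinarith
  · obtain ⟨q, hq, rfl, hα⟩ := hchange q' hq'
    have h1 := hα ν fun _ => (ε * v.1 0) • ex + (-(ε * v.1 1)) • ey + v.2 • ephi
    have h2 : H ((ε * v.1 0) • ex + (-(ε * v.1 1)) • ey + v.2 • ephi) = v := by
      refine Prod.ext ?_ ?_
      · ext i
        fin_cases i
        · change (H _).1 0 = v.1 0
          rw [hH0]
          simp [ex, ey, ephi, hε.ne']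
        · change (H _).1 1 = v.1 1
          rw [hH1]
          simp [ex, ey, ephi, hε.ne']
      · rw [hH2]; simp [ex, ey, ephi]
    rw [h2, hν q hq] at h1
    rw [← h1, hH0, hH1]
    simp [ex, ey, ephi]
    field_simp

/-- The flux form `β = ι_B μ` in tubular coordinates in which the potential is a function of `s`:
`β = F dx ∧ dy + b ds ∧ dφ`, where `∂_φ F = ∂_θ b` because `β` is closed. -/
theorem IsTubularDiffeo.exists_flux_components [IsManifold (𝓡∂ 3) ∞ M] (h : IsFluxSystem B ν μ)
    (hB : ∀ p ∈ γ, B p ≠ 0) (hΦ : IsTubularDiffeo γ Φ) {κ : ℝ} (hκ : κ ≠ 0)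
    (hν : ∀ q ∈ cyl 1, ∀ v : Cyl,
      pullback (coordParam Φ) ν q (fun _ => v) = κ * (q.1 0 * v.1 0 + q.1 1 * v.1 1)) :
    ∃ F b : Cyl → ℝ, ContDiffOn ℝ ∞ F (cyl 1) ∧ ContDiffOn ℝ ∞ b (cyl 1) ∧
      (∀ q : Cyl, F (q.1, q.2 + 2 * Real.pi) = F q) ∧
      (∀ q : Cyl, b (q.1, q.2 + 2 * Real.pi) = b q) ∧
      (∀ q ∈ cyl 1, ∀ v w, pullback (coordParam Φ) (iota B μ) q ![v, w] =
        F q * (v.1 0 * w.1 1 - v.1 1 * w.1 0) + b q * ((q.1 0 * v.1 0 + q.1 1 * v.1 1) * w.2 -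
          (q.1 0 * w.1 0 + q.1 1 * w.1 1) * v.2)) ∧
      (∀ φ, F (0, φ) ≠ 0) ∧ ∀ q ∈ cyl 1, fderiv ℝ F q ephi = fderiv ℝ b q (dth q) := by
  classical
  have hμ := h.smooth_mu.smoothInterior
  have hβ := hμ.iota h.smooth_B
  -- the vector field `X` representing `B` is tangent to the tori `s = const`, because `ν(B) = 0`
  have hX : ∀ q ∈ cyl 1, ∃ X : Cyl, (X = 0 → B (coordParam Φ q) = 0) ∧
      q.1 0 * X.1 0 + q.1 1 * X.1 1 = 0 ∧
      ∀ v w, pullback (coordParam Φ) (iota B μ) q ![v, w] =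
        pullback (coordParam Φ) μ q ![X, v, w] := by
    intro q hq
    obtain ⟨X, hX, hXβ⟩ := hΦ.exists_field B μ hq
    refine ⟨X, ?_, ?_, hXβ⟩
    · rintro rfl
      rw [map_zero] at hX
      exact hX.symm
    · have h1 : pullback (coordParam Φ) ν q (fun _ => X) = 0 := by
        rw [pullback_apply]
        refine Eq.trans ?_ (h.nu_B (coordParam Φ q))
        exact congrArg (ν (coordParam Φ q) : E3 [⋀^Fin 1]→L[ℝ] ℝ) (funext fun _ => hX)
      rw [hν q hq] at h1
      exact (mul_eq_zero.1 h1).resolve_left hκ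
  -- the components are cut off outside the solid torus to make them periodic everywhere
  let comp : Cyl → Cyl → Cyl → ℝ := fun v w q =>
    if q ∈ cyl 1 then pullback (coordParam Φ) (iota B μ) q ![v, w] else 0
  have hcomp : ∀ v w, ∀ q ∈ cyl 1, comp v w q = pullback (coordParam Φ) (iota B μ) q ![v, w] :=
    fun v w q hq => if_pos hq
  have hcs : ∀ v w, ContDiffOn ℝ ∞ (comp v w) (cyl 1) := fun v w =>
    ContDiffOn.congr (fun q hq => (hβ.contDiffAt_pullback (hΦ.isLocalDiffeomorphAt hq)
      ![v, w]).contDiffWithinAt) (hcomp v w)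
  have hcp : ∀ v w (q : Cyl), comp v w (q.1, q.2 + 2 * Real.pi) = comp v w q := by
    intro v w q
    have hiff : ((q.1, q.2 + 2 * Real.pi) : Cyl) ∈ cyl 1 ↔ q ∈ cyl 1 := by simp [mem_cyl]
    by_cases hq : q ∈ cyl 1
    · rw [hcomp _ _ _ (hiff.2 hq), hcomp _ _ _ hq, hΦ.pullback_periodic hq]
    · simp only [comp, hiff, if_neg hq]
  -- tangency means `y β(∂_x, ∂_φ) = x β(∂_y, ∂_φ)`
  obtain ⟨b, hb, hbp, hfb⟩ := exists_eq_mul_of_mul_eq (hcs ex ephi) (hcs ey ephi) (hcp _ _)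
    (fun q hq => by
      obtain ⟨X, -, hX0, hXβ⟩ := hX q hq
      rw [hcomp _ _ q hq, hcomp _ _ q hq, hXβ, hXβ, (three_form_contract _ X).2.1,
        (three_form_contract _ X).2.2]
      linear_combination -(pullback (coordParam Φ) μ q ![ex, ey, ephi]) * hX0)
  refine ⟨comp ex ey, b, hcs _ _, hb, hcp _ _, hbp, fun q hq v w => ?_, fun φ h0 => ?_,
    fun q hq => ?_⟩
  · have h1 := hfb q hq
    rw [hcomp _ _ q hq, hcomp _ _ q hq] at h1
    rw [two_form_apply, h1.1, h1.2, hcomp _ _ q hq]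
    ring
  · have hq := cyl_zero_mem φ
    obtain ⟨X, hX0, -, hXβ⟩ := hX _ hq
    apply hB _ (hΦ.coordParam_mem φ)
    apply hX0
    have hm := hΦ.volume_ne_zero h.volume hq
    have h1 := hfb _ hq
    rw [hcomp _ _ _ hq, hcomp _ _ _ hq, hXβ, hXβ, (three_form_contract _ X).2.1,
      (three_form_contract _ X).2.2] at h1
    rw [hcomp _ _ _ hq, hXβ, (three_form_contract _ X).1] at h0
    have e2 : X.2 = 0 := (mul_eq_zero.1 h0).resolve_right hm
    have e1 : X.1 1 = 0 := by
      refine neg_eq_zero.1 ((mul_eq_zero.1 (h1.1.trans ?_)).resolve_right hm)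
      simp
    have e0 : X.1 0 = 0 := by
      refine (mul_eq_zero.1 (h1.2.trans ?_)).resolve_right hm
      simp
    rw [cyl_eq_sum X, e0, e1, e2]
    simp
  · have hd := hβ.extDeriv_pullback_eq_zero (hΦ.isLocalDiffeomorphAt hq)
      (extD_iota_eq_zero h (coordParam Φ q))
    have hdiff := hβ.pullback_differentiableAt (hΦ.isLocalDiffeomorphAt hq)
    have hder : ∀ v w u, fderiv ℝ (comp v w) q u =
        fderiv ℝ (pullback (coordParam Φ) (iota B μ)) q u ![v, w] := by
      intro v w u
      have h2 : HasFDerivAt (fun r => pullback (coordParam Φ) (iota B μ) r ![v, w]) _ q :=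
        (ContinuousAlternatingMap.apply ℝ Cyl ℝ ![v, w]).hasFDerivAt.comp q hdiff.hasFDerivAt
      have h3 : comp v w =ᶠ[𝓝 q] fun r => pullback (coordParam Φ) (iota B μ) r ![v, w] := by
        filter_upwards [(isOpen_cyl 1).mem_nhds hq] with r hr using hcomp v w r hr
      rw [h3.fderiv_eq, h2.fderiv]
      rfl
    -- `dβ(∂_x, ∂_y, ∂_φ) = 0`
    have h1 : fderiv ℝ (comp ey ephi) q ex - fderiv ℝ (comp ex ephi) q ey +
        fderiv ℝ (comp ex ey) q ephi = 0 := by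
      have h2 := congrArg (fun α => α ![ex, ey, ephi]) hd
      rw [extDeriv, ContinuousAlternatingMap.alternatizeUncurryFin_apply, Fin.sum_univ_succ,
        Fin.sum_univ_succ, Fin.sum_univ_succ] at h2
      rw [show Fin.removeNth 0 ![ex, ey, ephi] = ![ey, ephi] by ext i : 1; fin_cases i <;> rfl,
        show (Fin.succ 0).removeNth ![ex, ey, ephi] = ![ex, ephi] by
          ext i : 1; fin_cases i <;> rfl,
        show (Fin.succ 0).succ.removeNth ![ex, ey, ephi] = ![ex, ey] by
          ext i : 1; fin_cases i <;> rfl] at h2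
      simp at h2
      rw [hder, hder, hder]
      linarith
    have hmul : ∀ (v w : Cyl) (L : Cyl →L[ℝ] ℝ), (∀ r ∈ cyl 1, comp v w r = L r * b r) →
        ∀ u, fderiv ℝ (comp v w) q u = L q * fderiv ℝ b q u + L u * b q := by
      intro v w L hL u
      have h2 : HasFDerivAt (fun r => L r * b r) _ q := L.hasFDerivAt.mul
        ((hb.contDiffAt ((isOpen_cyl 1).mem_nhds hq)).differentiableAt (by simp)).hasFDerivAt
      have h3 : comp v w =ᶠ[𝓝 q] fun r => L r * b r := by
        filter_upwards [(isOpen_cyl 1).mem_nhds hq] with r hr using hL r hr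
      rw [h3.fderiv_eq, h2.fderiv]
      simp
      ring
    rw [hmul _ _ dy (fun r hr => (hfb r hr).2), hmul _ _ dx (fun r hr => (hfb r hr).1)] at h1
    rw [dth_eq, map_sub, map_smul, map_smul]
    simp [dx, dy, ex, ey] at h1 ⊢
    linarith

end Coords

/-! ### Conclusion from the normal form of the flux form -/

section Conclusion

variable {M : Type*} [TopologicalSpace M] [ChartedSpace (EuclideanHalfSpace 3) M]
  [IsManifold (𝓡∂ 3) ∞ M] {B : VField M} {ν : Form M 1} {μ : Form M 3} {γ : Set M}
  {Φ : OpenPartialHomeomorph M (EuclideanSpace ℝ (Fin 2) × Circle)}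

/-- Smoothness up to the endpoint `0` of an antiderivative; the two-sided derivative at `0` comes from
the extension of `b` by the constant `b 0`. -/
theorem exists_antideriv {b : ℝ → ℝ} (hb : ContDiffOn ℝ ∞ b (Ico 0 (1 / 2))) :
    ∃ G : ℝ → ℝ, ContDiffOn ℝ ∞ G (Ico 0 (1 / 2)) ∧ ∀ s ∈ Ico (0 : ℝ) (1 / 2), HasDerivAt G (b s) s := by
  let b' : ℝ → ℝ := fun s => b (max s 0)
  have hb' : ContinuousOn b' (Iio (1 / 2)) :=
    hb.continuousOn.comp (by fun_prop) fun s hs => ⟨le_max_right _ _, max_lt hs (by norm_num)⟩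
  have hG : ∀ s ∈ Ico (0 : ℝ) (1 / 2), HasDerivAt (fun s => ∫ t in (0 : ℝ)..s, b' t) (b s) s := by
    intro s hs
    have h1 : b' s = b s := by simp only [b', max_eq_left hs.1]
    rw [← h1]
    refine intervalIntegral.integral_hasDerivAt_right ?_ ?_ ?_
    · refine ContinuousOn.intervalIntegrable (hb'.mono ?_)
      rw [uIcc_of_le hs.1]
      exact fun t ht => ht.2.trans_lt hs.2
    · exact hb'.stronglyMeasurableAtFilter isOpen_Iio s hs.2
    · exact hb'.continuousAt (Iio_mem_nhds hs.2)
  refine ⟨fun s => ∫ t in (0 : ℝ)..s, b' t, ?_, hG⟩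
  rw [contDiffOn_infty_iff_derivWithin (uniqueDiffOn_Ico _ _)]
  refine ⟨fun s hs => (hG s hs).differentiableAt.differentiableWithinAt, hb.congr fun s hs => ?_⟩
  exact (hG s hs).hasDerivWithinAt.derivWithin (uniqueDiffOn_Ico _ _ s hs)

/-- The inverse of the density of `μ` with respect to `dx ∧ dy ∧ dφ` descends to a smooth function on the
tubular neighbourhood. -/
theorem IsTubularDiffeo.exists_density (hΦ : IsTubularDiffeo γ Φ) (hμ : SmoothForm μ)
    (hm : ∀ q ∈ cyl 1, 0 < pullback (coordParam Φ) μ q ![ex, ey, ephi]) :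
    ∃ f : M → ℝ, ContMDiffOn (𝓡∂ 3) 𝓘(ℝ, ℝ) ∞ f Φ.source ∧ (∀ p ∈ Φ.source, 0 < f p) ∧
      ∀ q ∈ cyl 1, f (coordParam Φ q) = (pullback (coordParam Φ) μ q ![ex, ey, ephi])⁻¹ := by
  set m : Cyl → ℝ := fun q => pullback (coordParam Φ) μ q ![ex, ey, ephi] with hmdef
  let f : M → ℝ := fun p => (m ((Φ p).1, Complex.arg (Φ p).2))⁻¹
  have hf : ∀ q ∈ cyl 1, f (coordParam Φ q) = (m q)⁻¹ := by
    intro q hq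
    have h1 : Function.Periodic (fun φ => m (q.1, φ)) (2 * Real.pi) := fun φ =>
      hΦ.pullback_periodic (q := (q.1, φ)) (mem_cyl.2 (mem_cyl.1 hq)) μ _
    obtain ⟨n, hn⟩ := Circle.exp_eq_exp.1 (Circle.exp_arg (Circle.exp q.2))
    simp only [f, hΦ.apply_coordParam hq, pexp]
    rw [hn]
    exact congrArg _ (h1.int_mul n q.2)
  have hsurj : ∀ p ∈ Φ.source, ∃ q ∈ cyl 1, coordParam Φ q = p := fun p hp =>
    ⟨((Φ p).1, Complex.arg (Φ p).2), mem_cyl.2 (hΦ.norm_lt hp), coordParam_of_eq hp (Circle.exp_arg _)⟩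
  refine ⟨f, fun p hp => ?_, fun p hp => ?_, hf⟩
  · obtain ⟨q, hq, rfl⟩ := hsurj p hp
    obtain ⟨Ψ, hqΨ, hΨ⟩ := hΦ.isLocalDiffeomorphAt hq
    have hms : ContDiffAt ℝ ∞ (fun q => (m q)⁻¹) q :=
      (hμ.smoothInterior.contDiffAt_pullback (hΦ.isLocalDiffeomorphAt hq) _).inv (hm q hq).ne'
    rw [hΨ hqΨ]
    have hinv : Ψ.symm (Ψ q) = q := Ψ.left_inv hqΨ
    have h1 : ContMDiffAt (𝓡∂ 3) 𝓘(ℝ, Cyl) ∞ Ψ.symm (Ψ q) :=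
      (Ψ.symm.isLocalDiffeomorphAt _ _ _ (Ψ.map_source hqΨ)).contMDiffAt
    have h2 : ContMDiffAt (𝓡∂ 3) 𝓘(ℝ, ℝ) ∞ ((fun q => (m q)⁻¹) ∘ Ψ.symm) (Ψ q) := by
      refine ContMDiffAt.comp (Ψ q) ?_ h1
      rw [hinv]
      exact hms.contMDiffAt
    refine (h2.congr_of_eventuallyEq ?_).contMDiffWithinAt
    filter_upwards [h1.continuousAt (by rw [hinv]; exact (isOpen_cyl 1).mem_nhds hq),
      Ψ.open_target.mem_nhds (Ψ.map_source hqΨ)] with p' hp1 hp2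
    have h3 : coordParam Φ (Ψ.symm p') = p' := (hΨ (Ψ.map_target hp2)).trans (Ψ.right_inv hp2)
    have h4 := hf _ hp1
    rw [h3] at h4
    exact h4
  · obtain ⟨q, hq, rfl⟩ := hsurj p hp
    rw [hf q hq]
    exact inv_pos.2 (hm q hq)

/-- If `β = F(s) dx ∧ dy + b(s) ds ∧ dφ` in positively oriented tubular coordinates, the flux system
has the required form, with `ρ = 1`, `f` the inverse of the density of `μ`, and `G` an
antiderivative of `b`. -/
theorem IsTubularDiffeo.conclusion (hΦ : IsTubularDiffeo γ Φ) (B : VField M) (hμ : SmoothForm μ)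
    (hm : ∀ q ∈ cyl 1, 0 < pullback (coordParam Φ) μ q ![ex, ey, ephi]) {F b : ℝ → ℝ}
    (hF : ContDiffOn ℝ ∞ F (Ico 0 (1 / 2))) (hb : ContDiffOn ℝ ∞ b (Ico 0 (1 / 2)))
    (hβ : ∀ q ∈ cyl 1, ∀ v w, pullback (coordParam Φ) (iota B μ) q ![v, w] =
        F (sFun q) * (v.1 0 * w.1 1 - v.1 1 * w.1 0) +
          b (sFun q) * ((q.1 0 * v.1 0 + q.1 1 * v.1 1) * w.2 -
          (q.1 0 * w.1 0 + q.1 1 * w.1 1) * v.2)) :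
    ∃ (f : M → ℝ) (F G ρ : ℝ → ℝ),
        ContMDiffOn (𝓡∂ 3) 𝓘(ℝ, ℝ) ∞ f Φ.source ∧ (∀ p ∈ Φ.source, 0 < f p) ∧
        ContDiffOn ℝ ∞ F (Ico 0 (1 / 2)) ∧ ContDiffOn ℝ ∞ G (Ico 0 (1 / 2)) ∧
        ContDiffOn ℝ ∞ ρ (Ico 0 (1 / 2)) ∧ (∀ s ∈ Ico (0 : ℝ) (1 / 2), 0 < ρ s) ∧
        ∀ q : Cyl, q.1 ∈ Metric.ball (0 : EuclideanSpace ℝ (Fin 2)) 1 →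
          pullback (coordParam Φ) (iota B μ) q =
              F (sFun q) • wedge ![dx, dy] +
              wedge ![fderiv ℝ (fun r => G (sFun r)) q, dphi] ∧
          (f (coordParam Φ q))⁻¹ • B (coordParam Φ q) =
              mfderiv 𝓘(ℝ, Cyl) (𝓡∂ 3) (coordParam Φ) q
                ((derivWithin G (Ico 0 (1 / 2)) (sFun q) / ρ (sFun q)) •
                    (q.1 1 • ex - q.1 0 • ey) +
                  (F (sFun q) / ρ (sFun q)) • ephi) ∧
          pullback (coordParam Φ) (fun p => f p • μ p) q =
              ρ (sFun q) •
                wedge ![dx, dy, dphi] := by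
  obtain ⟨f, hfs, hfp, hfm⟩ := hΦ.exists_density hμ hm
  obtain ⟨G, hG, hGb⟩ := exists_antideriv hb
  refine ⟨f, F, G, fun _ => 1, hfs, hfp, hF, hG, contDiffOn_const, fun _ _ => one_pos, fun q hq1 => ?_⟩
  have hq : q ∈ cyl 1 := ⟨hq1, trivial⟩
  have hs := sFun_mem hq
  have hGd : HasFDerivAt (fun r => G (sFun r)) (b (sFun q) • (q.1 0 • dx + q.1 1 • dy)) q :=
    (hGb _ hs).comp_hasFDerivAt q (hasFDerivAt_sFun q)
  have hGw : derivWithin G (Ico 0 (1 / 2)) (sFun q) = b (sFun q) :=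
    (hGb _ hs).hasDerivWithinAt.derivWithin (uniqueDiffOn_Ico _ _ _ hs)
  have hm0 := (hm q hq).ne'
  refine ⟨two_form_ext fun v w => ?_, ?_, ?_⟩
  · rw [hβ q hq, hGd.fderiv]
    change _ = F (sFun q) * wedge ![dx, dy] ![v, w] + wedge ![_, dphi] ![v, w]
    rw [wedge_two, wedge_two]
    simp [dx, dy, dphi]
    ring
  · obtain ⟨X, hX, hXβ⟩ := hΦ.exists_field B μ hq
    rw [hfm q hq, inv_inv, hGw, div_one, div_one]
    have h0 := hXβ ey ephi
    have h1 := hXβ ex ephi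
    have h2 := hXβ ex ey
    rw [hβ q hq, (three_form_contract _ X).2.2] at h0
    rw [hβ q hq, (three_form_contract _ X).2.1] at h1
    rw [hβ q hq, (three_form_contract _ X).1] at h2
    generalize pullback (coordParam Φ) μ q ![ex, ey, ephi] = m at h0 h1 h2 ⊢
    have h3 : b (sFun q) • (q.1 1 • ex - q.1 0 • ey) + F (sFun q) • ephi = m • X := by
      simp [ex, ey, ephi] at h0 h1 h2
      refine Prod.ext ?_ ?_
      · ext i
        fin_cases i
        · simp [ex, ey, ephi]; linarith
        · simp [ex, ey, ephi]; linarith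
      · simp [ex, ey, ephi]; linarith
    rw [h3]
    have h4 : dpar (coordParam Φ) q (m • X) = m • dpar (coordParam Φ) q X := map_smul _ _ _
    exact ((congrArg (fun z : E3 => m • z) hX).symm.trans h4.symm)
  · have h1 : pullback (coordParam Φ) (fun p => f p • μ p) q =
        f (coordParam Φ q) • pullback (coordParam Φ) μ q := by
      ext v
      rfl
    rw [h1, three_form_eq (pullback (coordParam Φ) μ q), hfm q hq, smul_smul, inv_mul_cancel₀ hm0]

end Conclusion

/-! ### Straightening the flux form by rotations of the disks -/

section Rotation

variable {u : Cyl → ℝ} {q : Cyl}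

theorem hasFDerivAt_rot_zero {du : Cyl →L[ℝ] ℝ} (hu : HasFDerivAt u du q) :
    HasFDerivAt (fun q => rot (u q) q.1 0)
      (Real.cos (u q) • dx - Real.sin (u q) • dy - (rot (u q) q.1 1) • du) q := by
  have h0 : HasFDerivAt (fun q : Cyl => q.1 0) dx q := dx.hasFDerivAt
  have h1 : HasFDerivAt (fun q : Cyl => q.1 1) dy q := dy.hasFDerivAt
  have h := (hu.cos.mul h0).sub (hu.sin.mul h1)
  refine (h.congr_of_eventuallyEq (.of_forall fun r => ?_)).congr_fderiv ?_
  · simp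
  · ext <;> simp <;> ring

theorem hasFDerivAt_rot_one {du : Cyl →L[ℝ] ℝ} (hu : HasFDerivAt u du q) :
    HasFDerivAt (fun q => rot (u q) q.1 1)
      (Real.sin (u q) • dx + Real.cos (u q) • dy + (rot (u q) q.1 0) • du) q := by
  have h0 : HasFDerivAt (fun q : Cyl => q.1 0) dx q := dx.hasFDerivAt
  have h1 : HasFDerivAt (fun q : Cyl => q.1 1) dy q := dy.hasFDerivAt
  have h := (hu.sin.mul h0).add (hu.cos.mul h1)
  refine (h.congr_of_eventuallyEq (.of_forall fun r => ?_)).congr_fderiv ?_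
  · simp
  · ext <;> simp <;> ring

/-- The derivative of `(x, y, φ) ↦ (ε⁻¹ R_u (x, y), φ)`, with `R_u` the rotation by the angle `u`. -/
theorem exists_hasFDerivAt_rot {du : Cyl →L[ℝ] ℝ} (hu : HasFDerivAt u du q) (ε : ℝ) :
    ∃ H : Cyl →L[ℝ] Cyl, HasFDerivAt (fun r : Cyl => ((ε⁻¹ • rot (u r) r.1, r.2) : Cyl)) H q ∧
      ∀ v : Cyl, (H v).1 0 = ε⁻¹ * (rot (u q) v.1 0 - rot (u q) q.1 1 * du v) ∧
        (H v).1 1 = ε⁻¹ * (rot (u q) v.1 1 + rot (u q) q.1 0 * du v) ∧ (H v).2 = v.2 := by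
  have h0 := hasFDerivAt_rot_zero hu
  have h1 := hasFDerivAt_rot_one hu
  have hg : HasFDerivAt (fun r : Cyl => rot (u r) r.1) (fderiv ℝ (fun r : Cyl => rot (u r) r.1) q) q := by
    refine DifferentiableAt.hasFDerivAt ?_
    rw [differentiableAt_euclidean]
    intro i
    fin_cases i
    · exact h0.differentiableAt
    · exact h1.differentiableAt
  have hcomp : ∀ i, HasFDerivAt (fun r : Cyl => rot (u r) r.1 i)
      ((EuclideanSpace.proj i).comp (fderiv ℝ (fun r : Cyl => rot (u r) r.1) q)) q := fun i =>
    (EuclideanSpace.proj (𝕜 := ℝ) i).hasFDerivAt.comp _ hg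
  refine ⟨_, (hg.const_smul ε⁻¹).prodMk hasFDerivAt_snd, fun v => ⟨?_, ?_, rfl⟩⟩
  · have e := congrArg (fun L => L v) ((hcomp 0).unique h0)
    change ε⁻¹ * (fderiv ℝ (fun r : Cyl => rot (u r) r.1) q v) 0 = _
    refine congrArg (ε⁻¹ * ·) (e.trans ?_)
    simp [dx, dy]
  · have e := congrArg (fun L => L v) ((hcomp 1).unique h1)
    change ε⁻¹ * (fderiv ℝ (fun r : Cyl => rot (u r) r.1) q v) 1 = _
    refine congrArg (ε⁻¹ * ·) (e.trans ?_)
    simp [dx, dy]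

/-- If `F_a ds ∧ du = (F - F_a) dx ∧ dy + (b - b_a) ds ∧ dφ`, the rotation by the angle `u`, followed by
the dilation by `ε⁻¹`, pulls `ε² (F_a dx ∧ dy + b_a ds ∧ dφ)` back to `F dx ∧ dy + b ds ∧ dφ`. Here all
forms are evaluated at the vectors `v` and `w`, whose images are `Hv` and `Hw`; `z` and `z'` are the
base points. -/
theorem rot_form_eq {v w : Cyl} {c ε F b Fa ba du_v du_w u : ℝ} {z : E2} (hε : ε ≠ 0) {Hv Hw : Cyl}
    (hv0 : Hv.1 0 = ε⁻¹ * (rot u v.1 0 - rot u z 1 * du_v))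
    (hv1 : Hv.1 1 = ε⁻¹ * (rot u v.1 1 + rot u z 0 * du_v)) (hv2 : Hv.2 = v.2)
    (hw0 : Hw.1 0 = ε⁻¹ * (rot u w.1 0 - rot u z 1 * du_w))
    (hw1 : Hw.1 1 = ε⁻¹ * (rot u w.1 1 + rot u z 0 * du_w)) (hw2 : Hw.2 = w.2)
    (hdu : Fa * ((z 0 * v.1 0 + z 1 * v.1 1) * du_w - (z 0 * w.1 0 + z 1 * w.1 1) * du_v) =
      (F - Fa) * (v.1 0 * w.1 1 - v.1 1 * w.1 0) + (b - ba) *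
        ((z 0 * v.1 0 + z 1 * v.1 1) * w.2 - (z 0 * w.1 0 + z 1 * w.1 1) * v.2))
    {z' : E2} (hz' : ε • z' = rot u z) (hc : c = ε ^ 2) :
    F * (v.1 0 * w.1 1 - v.1 1 * w.1 0) + b * ((z 0 * v.1 0 + z 1 * v.1 1) * w.2 -
        (z 0 * w.1 0 + z 1 * w.1 1) * v.2) =
      c * Fa * (Hv.1 0 * Hw.1 1 - Hv.1 1 * Hw.1 0) + c * ba * ((z' 0 * Hv.1 0 + z' 1 * Hv.1 1) * Hw.2 -
        (z' 0 * Hw.1 0 + z' 1 * Hw.1 1) * Hv.2) := by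
  have e0 : ε * z' 0 = rot u z 0 := by rw [← hz']; rfl
  have e1 : ε * z' 1 = rot u z 1 := by rw [← hz']; rfl
  have a : ∀ x, ε * (ε⁻¹ * x) = x := fun x => mul_inv_cancel_left₀ hε x
  have f0 : ε * Hv.1 0 = rot u v.1 0 - rot u z 1 * du_v := by rw [hv0, a]
  have f1 : ε * Hv.1 1 = rot u v.1 1 + rot u z 0 * du_v := by rw [hv1, a]
  have g0 : ε * Hw.1 0 = rot u w.1 0 - rot u z 1 * du_w := by rw [hw0, a]
  have g1 : ε * Hw.1 1 = rot u w.1 1 + rot u z 0 * du_w := by rw [hw1, a]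
  have h1 : c * Fa * (Hv.1 0 * Hw.1 1 - Hv.1 1 * Hw.1 0) =
      Fa * ((ε * Hv.1 0) * (ε * Hw.1 1) - (ε * Hv.1 1) * (ε * Hw.1 0)) := by rw [hc]; ring
  have h2 : c * ba * ((z' 0 * Hv.1 0 + z' 1 * Hv.1 1) * Hw.2 -
        (z' 0 * Hw.1 0 + z' 1 * Hw.1 1) * Hv.2) =
      ba * (((ε * z' 0) * (ε * Hv.1 0) + (ε * z' 1) * (ε * Hv.1 1)) * Hw.2 -
        ((ε * z' 0) * (ε * Hw.1 0) + (ε * z' 1) * (ε * Hw.1 1)) * Hv.2) := by rw [hc]; ring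
  have hcs := Real.sin_sq_add_cos_sq u
  -- rotations preserve scalar products and areas
  have hdot : ∀ y : E2, rot u z 0 * rot u y 0 + rot u z 1 * rot u y 1 = z 0 * y 0 + z 1 * y 1 := by
    intro y
    simp only [rot_zero', rot_one']
    linear_combination (z 0 * y 0 + z 1 * y 1) * hcs
  have hcr : rot u v.1 0 * rot u w.1 1 - rot u v.1 1 * rot u w.1 0 =
      v.1 0 * w.1 1 - v.1 1 * w.1 0 := by
    simp only [rot_zero', rot_one']
    linear_combination (v.1 0 * w.1 1 - v.1 1 * w.1 0) * hcs
  rw [h1, h2, e0, e1, f0, f1, g0, g1, hv2, hw2]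
  linear_combination -hdu + (-Fa) * hcr - Fa * du_w * hdot v.1 + Fa * du_v * hdot w.1 -
    ba * w.2 * hdot v.1 + ba * v.2 * hdot w.1

/-- The equation `F_a ds ∧ du = (F - F_a) dx ∧ dy + (b - b_a) ds ∧ dφ` of `rot_form_eq` holds for
`u = w / F_a` if `∂_θ w = F - F_a` and `∂_φ w = b - b_a`: the differential of `F_a` is a multiple of
`ds`, and `ds ∧ dθ = dx ∧ dy`. -/
theorem linearization_eq {dw dFa du : Cyl →L[ℝ] ℝ} {c F Fa b ba : ℝ}
    (hmul : ∀ v, dw v = c * dFa v + Fa * du v) (h1 : dFa (dth q) = 0) (h2 : dFa ephi = 0)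
    (h3 : dw (dth q) = F - Fa) (h4 : dw ephi = b - ba) (v w : Cyl) :
    Fa * ((q.1 0 * v.1 0 + q.1 1 * v.1 1) * du w - (q.1 0 * w.1 0 + q.1 1 * w.1 1) * du v) =
      (F - Fa) * (v.1 0 * w.1 1 - v.1 1 * w.1 0) + (b - ba) *
        ((q.1 0 * v.1 0 + q.1 1 * v.1 1) * w.2 - (q.1 0 * w.1 0 + q.1 1 * w.1 1) * v.2) := by
  have hL : ∀ (L : Cyl →L[ℝ] ℝ) (v : Cyl), L v = v.1 0 * L ex + v.1 1 * L ey + v.2 * L ephi := by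
    intro L v
    have := congrArg L (cyl_eq_sum v)
    simpa only [map_add, map_smul, smul_eq_mul] using this
  rw [dth_eq, map_sub, map_smul, map_smul, smul_eq_mul, smul_eq_mul] at h1 h3
  have key : ∀ v, Fa * du v = dw v - c * dFa v := fun v => by rw [hmul]; ring
  rw [mul_sub, mul_left_comm, mul_left_comm Fa, key, key, hL dw v, hL dw w, hL dFa v, hL dFa w, h2, h4]
  linear_combination (v.1 0 * w.1 1 - v.1 1 * w.1 0) * h3 - c * (v.1 0 * w.1 1 - v.1 1 * w.1 0) * h1

end Rotation

section NormalForm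

variable {M : Type*} [TopologicalSpace M] [T2Space M] [SecondCountableTopology M]
  [ChartedSpace (EuclideanHalfSpace 3) M] [IsManifold (𝓡∂ 3) ∞ M] {B : VField M} {ν : Form M 1}
  {μ : Form M 3} {γ : Set M}

omit [T2Space M] [SecondCountableTopology M] [IsManifold (𝓡∂ 3) ∞ M] in
/-- Tubular coordinates can be changed by rotating the disks by an angle `u(x, y, φ)` and rescaling. -/
theorem IsTubularDiffeo.exists_rotation_change
    {Φ : OpenPartialHomeomorph M (EuclideanSpace ℝ (Fin 2) × Circle)} (hΦ : IsTubularDiffeo γ Φ)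
    {δ : ℝ} (hδ : 0 < δ) (hδ1 : δ ≤ 1) {u : Cyl → ℝ} (hu : ContDiffOn ℝ ∞ u (cyl δ))
    (hup : ∀ q : Cyl, u (q.1, q.2 + 2 * Real.pi) = u q) :
    ∃ ε : ℝ, 0 < ε ∧ ε ≤ 1 ∧ ∃ Φ' : OpenPartialHomeomorph M (EuclideanSpace ℝ (Fin 2) × Circle),
      IsTubularDiffeo γ Φ' ∧ ∀ q' ∈ cyl 1, ∃ q ∈ cyl δ, q.2 = q'.2 ∧ ε • q'.1 = rot (u q) q.1 ∧
      ∃ H : Cyl →L[ℝ] Cyl, Function.Surjective H ∧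
        (∀ v : Cyl, (H v).1 0 = ε⁻¹ * (rot (u q) v.1 0 - rot (u q) q.1 1 * fderiv ℝ u q v) ∧
        (H v).1 1 = ε⁻¹ * (rot (u q) v.1 1 + rot (u q) q.1 0 * fderiv ℝ u q v) ∧ (H v).2 = v.2) ∧
        ∀ {k : ℕ} (α : Form M k) (v : Fin k → Cyl),
          pullback (coordParam Φ) α q v = pullback (coordParam Φ') α q' (fun i => H (v i)) := by
  have hsub : cyl δ ⊆ cyl 1 := prod_mono (Metric.ball_subset_ball hδ1) le_rfl
  have hud : ∀ q ∈ cyl δ, HasFDerivAt u (fderiv ℝ u q) q := fun q hq =>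
    ((hu.contDiffAt ((isOpen_cyl δ).mem_nhds hq)).differentiableAt (by simp)).hasFDerivAt
  have hax : ∀ φ, ((0, φ) : Cyl) ∈ cyl δ := fun φ => by simpa [mem_cyl] using hδ
  have hr0 : ∀ t, rot t 0 = 0 := fun t => norm_eq_zero.1 (by rw [norm_rot, norm_zero])
  have hrinj : ∀ t z, rot t z = 0 → z = 0 := fun t z hz =>
    norm_eq_zero.1 (by rw [← norm_rot t z, hz, norm_zero])
  have hg : ContDiffOn ℝ ∞ (fun q : Cyl => rot (u q) q.1) (cyl δ) := by
    have h1 : ContDiffOn ℝ ∞ (fun q : Cyl => (u q, q.1)) (cyl δ) :=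
      hu.prodMk contDiffOn_fst
    have h2 := contDiff_rot.contDiffOn (s := univ) |>.comp h1 fun _ _ => trivial
    exact h2
  have hinj : ∀ φ v, fderiv ℝ (fun q : Cyl => rot (u q) q.1) (0, φ) (v, 0) = 0 → v = 0 := by
    intro φ v hv
    obtain ⟨H, hH, hHv⟩ := exists_hasFDerivAt_rot (hud _ (hax φ)) 1
    have h1 : HasFDerivAt (fun q : Cyl => rot (u q) q.1)
        ((ContinuousLinearMap.fst ℝ E2 ℝ).comp H) (0, φ) := by
      have h2 := hH.fst
      simpa only [inv_one, one_smul] using h2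
    have hv' : (H (v, 0)).1 = 0 := by rw [← hv, h1.fderiv]; rfl
    obtain ⟨e0, e1, -⟩ := hHv (v, 0)
    have hz : rot (u (0, φ)) ((0, φ) : Cyl).1 = 0 := hr0 _
    rw [hv', hz] at e0 e1
    refine hrinj (u (0, φ)) v (PiLp.ext fun i => ?_)
    fin_cases i
    · have e : (0 : ℝ) = 1⁻¹ * (rot (u (0, φ)) v 0 - 0 * fderiv ℝ u (0, φ) (v, 0)) := e0
      rw [inv_one, one_mul, zero_mul, sub_zero] at e
      exact e.symm
    · have e : (0 : ℝ) = 1⁻¹ * (rot (u (0, φ)) v 1 + 0 * fderiv ℝ u (0, φ) (v, 0)) := e1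
      rw [inv_one, one_mul, zero_mul, add_zero] at e
      exact e.symm
  obtain ⟨ε, hε, hε1, Φ', hΦ', hch⟩ := hΦ.exists_change hδ hδ1 hg (fun q => by rw [hup])
    (fun φ => hr0 _) hinj
  refine ⟨ε, hε, hε1, Φ', hΦ', ?_⟩
  intro q' hq'
  obtain ⟨q, hq, hq2, hg, -, he⟩ := hch q' hq'
  obtain ⟨H, hH, hHv⟩ := exists_hasFDerivAt_rot (hud q hq) ε
  obtain ⟨η, hη⟩ : ∃ η : Cyl → Cyl, η = fun r => (ε⁻¹ • rot (u r) r.1, r.2) := ⟨_, rfl⟩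
  have hηq : η q = q' := by
    rw [hη]
    refine Prod.ext ?_ hq2
    change ε⁻¹ • rot (u q) q.1 = q'.1
    rw [← hg, inv_smul_smul₀ hε.ne']
  rw [← hη] at hH
  replace he : ∀ᶠ r in 𝓝 q, coordParam Φ' (η r) = coordParam Φ r := by rw [hη]; exact he
  have hd' : MDifferentiableAt 𝓘(ℝ, Cyl) (𝓡∂ 3) (coordParam Φ') (η q) := by
    rw [hηq]; exact hΦ'.mdifferentiableAt hq'
  refine ⟨q, hq, hq2, hg, H, ?_, hHv, fun α v => ?_⟩
  · intro y
    have h1 := dpar_of_eventuallyEq hd' hH he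
    obtain ⟨x, hx⟩ := (dpar_bijective (hΦ.isLocalDiffeomorphAt (hsub hq))).2
      (dpar (coordParam Φ') (η q) y)
    rw [h1] at hx
    refine ⟨x, (dpar_bijective (hΦ'.isLocalDiffeomorphAt hq')).1 ?_⟩
    rw [← hηq]
    exact hx
  · rw [pullback_of_eventuallyEq hd' hH he, hηq]

/-- Positively oriented tubular coordinates in which `β = F(s) dx ∧ dy + b(s) ds ∧ dφ`. -/
theorem IsNondegenerateAxis.exists_normal_form (h : IsFluxSystem B ν μ)
    (hγ : IsNondegenerateAxis B ν γ) :
    ∃ Φ : OpenPartialHomeomorph M (EuclideanSpace ℝ (Fin 2) × Circle), IsTubularDiffeo γ Φ ∧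
      (∀ q ∈ cyl 1, 0 < pullback (coordParam Φ) μ q ![ex, ey, ephi]) ∧
      ∃ F b : ℝ → ℝ, ContDiffOn ℝ ∞ F (Ico 0 (1 / 2)) ∧ ContDiffOn ℝ ∞ b (Ico 0 (1 / 2)) ∧
      ∀ q ∈ cyl 1, ∀ v w, pullback (coordParam Φ) (iota B μ) q ![v, w] =
        F (sFun q) * (v.1 0 * w.1 1 - v.1 1 * w.1 0) +
          b (sFun q) * ((q.1 0 * v.1 0 + q.1 1 * v.1 1) * w.2 -
          (q.1 0 * w.1 0 + q.1 1 * w.1 1) * v.2) := by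
  obtain ⟨Φ, hΦ, hm, κ, hκ, hν⟩ := hγ.exists_oriented_morse_coords h
  obtain ⟨F, b, hF, hb, hFp, hbp, hβ, hF0, hcl⟩ :=
    hΦ.exists_flux_components h hγ.1.one_dimensional hκ hν
  obtain ⟨w, Fa, ba, hw, hFa, hba, hwp, hFath, hFaph, hbath, hbaph, hwth, hwph, hFa0⟩ :=
    exists_torus_linearization hF hb hFp hbp hcl
  obtain ⟨F₀, hF₀, hFaF₀⟩ := exists_eq_comp_sFun hFa hFath hFaph
  obtain ⟨b₀, hb₀, hbab₀⟩ := exists_eq_comp_sFun hba hbath hbaph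
  have hsp : ∀ q : Cyl, sFun (q.1, q.2 + 2 * Real.pi) = sFun q := fun q => rfl
  obtain ⟨δ, hδ, hδ1, hpos⟩ := exists_pos_on_cyl (h := fun q => F₀ (sFun q) ^ 2)
    ((hFa.continuousOn.congr fun q hq => (hFaF₀ q hq).symm).pow 2) (fun q => by rw [hsp])
    (fun φ => by
      rw [← hFaF₀ _ (cyl_zero_mem φ), hFa0 _ rfl]
      exact sq_pos_of_ne_zero (hF0 φ))
  have hsub : cyl δ ⊆ cyl 1 := prod_mono (Metric.ball_subset_ball hδ1) le_rfl
  have hFane : ∀ q ∈ cyl δ, F₀ (sFun q) ≠ 0 := fun q hq h0 => by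
    have := hpos q hq
    simp [h0] at this
  -- The angle of rotation: rotating by `u` changes `F_a` and `b_a` by `∂_θ w` and `∂_φ w`. The division
  -- is possible near the axis, where `F_a = F ≠ 0` since `B ≠ 0` there.
  let u : Cyl → ℝ := fun q => w q / F₀ (sFun q)
  have hu : ContDiffOn ℝ ∞ u (cyl δ) :=
    ((hw.mono hsub).div (hFa.mono hsub) fun q hq => by
      rw [hFaF₀ q (hsub hq)]; exact hFane q hq).congr fun q hq => by
        simp only [u, Pi.div_apply, hFaF₀ q (hsub hq)]
  have hud : ∀ q ∈ cyl δ, HasFDerivAt u (fderiv ℝ u q) q := fun q hq =>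
    ((hu.contDiffAt ((isOpen_cyl δ).mem_nhds hq)).differentiableAt (by simp)).hasFDerivAt
  have hr0 : ∀ t, rot t 0 = 0 := fun t => norm_eq_zero.1 (by rw [norm_rot, norm_zero])
  have hrinj : ∀ t z, rot t z = 0 → z = 0 := fun t z hz =>
    norm_eq_zero.1 (by rw [← norm_rot t z, hz, norm_zero])
  obtain ⟨ε, hε, hε1, Φ', hΦ', hchange⟩ := hΦ.exists_rotation_change hδ hδ1 hu
    (fun q => by simp only [u, hwp, hsp])
  have hε2 : ε ^ 2 ≤ 1 := by nlinarith
  have hscale : MapsTo (fun s : ℝ => ε ^ 2 * s) (Ico 0 (1 / 2)) (Ico 0 (1 / 2)) := fun s hs =>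
    ⟨mul_nonneg (sq_nonneg _) hs.1, by nlinarith [hs.1, hs.2]⟩
  have hscs : ContDiff ℝ ∞ fun s : ℝ => ε ^ 2 * s := contDiff_const.mul contDiff_id
  refine ⟨Φ', hΦ', fun q' hq' => ?_, fun s => ε ^ 2 * F₀ (ε ^ 2 * s), fun s => ε ^ 2 * b₀ (ε ^ 2 * s),
    contDiffOn_const.mul (hF₀.comp hscs.contDiffOn hscale),
    contDiffOn_const.mul (hb₀.comp hscs.contDiffOn hscale), fun q' hq' v' w' => ?_⟩
  · -- it suffices to compare orientations at one point of the axis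
    refine hΦ'.volume_pos h.smooth_mu h.volume (cyl_zero_mem 0) ?_ hq'
    obtain ⟨q, hq, -, hg, H, -, hH, hα⟩ := hchange _ (cyl_zero_mem 0)
    have hq0 : q.1 = 0 := hrinj (u q) _ (by rw [← hg]; simp)
    have h1 := (hα μ ![ex, ey, ephi]).trans ((congrArg _ (show (fun i => H (![ex, ey, ephi] i)) =
      ![H ex, H ey, H ephi] by ext i : 1; fin_cases i <;> rfl)).trans (three_form_apply _ _ _ _))
    have h2 := hm q (hsub hq)
    rw [h1] at h2
    generalize pullback (coordParam Φ') μ (0, 0) ![ex, ey, ephi] = c at h2 ⊢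
    simp only [(hH _).1, (hH _).2.1, (hH _).2.2, hq0, hr0] at h2
    simp [ex, ey, ephi] at h2
    have h3 : 0 < c * (ε⁻¹ * ε⁻¹) := by
      linear_combination (exp := 1) h2 + c * ε⁻¹ * ε⁻¹ * Real.sin_sq_add_cos_sq (u q)
    exact pos_of_mul_pos_left h3 (by positivity)
  · obtain ⟨q, hq, -, hg, H, hsurj, hH, hα⟩ := hchange q' hq'
    obtain ⟨v, rfl⟩ := hsurj v'
    obtain ⟨w', rfl⟩ := hsurj w'
    have hq1 := hsub hq
    have hs : sFun q = ε ^ 2 * sFun q' := by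
      rw [sFun_eq, sFun_eq, ← norm_rot (u q) q.1, ← hg, norm_smul, Real.norm_of_nonneg hε.le]
      ring
    have h1 : pullback (coordParam Φ) (iota B μ) q ![v, w'] =
        pullback (coordParam Φ') (iota B μ) q' ![H v, H w'] :=
      (hα (iota B μ) ![v, w']).trans (congrArg _ (by ext i : 1; fin_cases i <;> rfl))
    beta_reduce
    rw [← h1, hβ q hq1, ← hs, ← hFaF₀ q hq1, ← hbab₀ q hq1]
    refine rot_form_eq (u := u q) hε.ne' (hH v).1 (hH v).2.1 (hH v).2.2 (hH w').1 (hH w').2.1 (hH w').2.2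
      ?_ hg rfl
    refine linearization_eq (dw := fderiv ℝ w q) (dFa := fderiv ℝ Fa q) (c := u q) (fun z => ?_)
      (hFath q hq1) (hFaph q hq1) (hwth q hq1) (hwph q hq1) v w'
    have hd : ∀ {k : Cyl → ℝ}, ContDiffOn ℝ ∞ k (cyl 1) → HasFDerivAt k (fderiv ℝ k q) q := fun hk =>
      ((hk.contDiffAt ((isOpen_cyl 1).mem_nhds hq1)).differentiableAt (by simp)).hasFDerivAt
    have h2 : w =ᶠ[𝓝 q] fun r => u r * Fa r := by
      filter_upwards [(isOpen_cyl δ).mem_nhds hq] with r hr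
      simp only [u, hFaF₀ r (hsub hr), div_mul_cancel₀ _ (hFane r hr)]
    have h3 := (hd hw).unique (((hud q hq).mul (hd hFa)).congr_of_eventuallyEq h2)
    rw [h3]
    simp

end NormalForm

end FluxSystem

end

theorem mainTheorem9 {M : Type*} [TopologicalSpace M] [T2Space M] [SecondCountableTopology M]
    [ChartedSpace (EuclideanHalfSpace 3) M] [IsManifold (𝓡∂ 3) ∞ M]
    (B : VField M) (ν : Form M 1) (μ : Form M 3)
    (hflux : IsFluxSystem B ν μ)
    (γ : Set M) (hγ : IsNondegenerateAxis B ν γ) :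
    ∃ Φ : OpenPartialHomeomorph M (EuclideanSpace ℝ (Fin 2) × Circle),
      IsTubularDiffeo γ Φ ∧
      ∃ (f : M → ℝ) (F G ρ : ℝ → ℝ),
        ContMDiffOn (𝓡∂ 3) 𝓘(ℝ, ℝ) ∞ f Φ.source ∧ (∀ p ∈ Φ.source, 0 < f p) ∧
        ContDiffOn ℝ ∞ F (Ico 0 (1 / 2)) ∧ ContDiffOn ℝ ∞ G (Ico 0 (1 / 2)) ∧
        ContDiffOn ℝ ∞ ρ (Ico 0 (1 / 2)) ∧ (∀ s ∈ Ico (0 : ℝ) (1 / 2), 0 < ρ s) ∧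
        ∀ q : Cyl, q.1 ∈ Metric.ball (0 : EuclideanSpace ℝ (Fin 2)) 1 →
          -- `β = ι_B μ = F(s) dx ∧ dy + dG(s) ∧ dφ`
          pullback (coordParam Φ) (iota B μ) q =
              F (sFun q) • wedge ![dx, dy] +
              wedge ![fderiv ℝ (fun r => G (sFun r)) q, dphi] ∧
          -- `B/f = (G'(s)/ρ(s)) (y ∂_x - x ∂_y) + (F(s)/ρ(s)) ∂_φ`
          (f (coordParam Φ q))⁻¹ • B (coordParam Φ q) =
              mfderiv 𝓘(ℝ, Cyl) (𝓡∂ 3) (coordParam Φ) q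
                ((derivWithin G (Ico 0 (1 / 2)) (sFun q) / ρ (sFun q)) •
                    (q.1 1 • ex - q.1 0 • ey) +
                  (F (sFun q) / ρ (sFun q)) • ephi) ∧
          -- `f μ = ρ(s) dx ∧ dy ∧ dφ`
          pullback (coordParam Φ) (fun p => f p • μ p) q =
              ρ (sFun q) •
                wedge ![dx, dy, dphi] := by
  obtain ⟨Φ, hΦ, hm, F, b, hF, hb, hβ⟩ := hγ.exists_normal_form hflux
  exact ⟨Φ, hΦ, hΦ.conclusion B hflux.smooth_mu hm hF hb hβ⟩
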